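/- **Setting.** Let $m\in\mathbb N$ and let $\sigma_1,\dots,\sigma_m$ be finite Borel measures on $\mathbb R$, each of constant sign and with compact support containing infinitely many points. Put $\Delta_k=\mathrm{Co}(\operatorname{supp}\sigma_k)$ (the smallest interval containing the support) for $1\le k\le m$, $\Delta_0=\emptyset$, and assume $\Delta_k\cap\Delta_{k+1}=\emptyset$ for $1\le k\le m-1$. Write $\widehat s(z)=\int\frac{ds(t)}{z-t}$, $d\langle s,t\rangle=\widehat t\,ds$, and $\langle\mu_i,\dots,\mu_j\rangle=\langle\mu_i,\langle\mu_{i+1},\dots,\mu_j\rangle\rangle$. The Nikishin system $S=(s_1,\dots,s_m)=\mathcal N(\sigma_1,\dots,\sigma_m)$ is $s_k=\langle\sigma_1,\dots,\sigma_k\rangle$. For a measure $s$ arising below, $\tau(s)$ denotes the finite measure of constant sign with $\mathrm{Co}(\operatorname{supp}\tau(s))\subset\mathrm{Co}(\operatorname{supp}s)$ and $1/\widehat s=\ell+\widehat{\tau(s)}$ on $\mathbb C\setminus \mathrm{Co}(\operatorname{supp}s)$ for a polynomial $\ell$ of degree $1$. For $\mathbf n\in\mathbb Z_+^m$ let $|\mathbf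 n|=n_1+\dots+n_m$. A polynomial $Q_{\mathbf n}$ is a (monic) $\mathbf n$-th multiple orthogonal polynomial if it is monic, $\deg Q_{\mathbf n}\le|\mathbf n|$, and $\int x^\nu Q_{\mathbf n}(x)\,ds_k(x)=0$ for $0\le\nu\le n_k-1$, $1\le k\le m$. For $m\ne3$, $\mathbb Z_+^m(*)$ is the set of $\mathbf n\in\mathbb Z_+^m$ for which there are no $i<j<k$ with $n_i<n_j<n_k$; $\mathbb Z_+^3(*)=\mathbb Z_+^3$. The permutation $\tau_{\mathbf n}$ of $\{1,\dots,m\}$ is defined recursively: $\tau_{\mathbf n}(i)$ is the smallest index of a largest component $n_j$ among $j\notin\{\tau_{\mathbf n}(1),\dots,\tau_{\mathbf n}(i-1)\}$. For a permutation $\tau$, $\mathbb Z_+^m(*,\tau)=\{\mathbf n\in\mathbb Z_+^m(*):\tau_{\mathbf n}=\tau\}$. For $1\le l\le m$, $\mathbf n_l$ is $\mathbf n$ with its $l$-th component increased by $1$. **Second type functions.** Let $\mathbf n\in\mathbb Z_+^m(*)$. Put $\mathbf n^0=\mathbf n$, $\Sigma^0=(\sigma_1,\dots,\sigma_m)$,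 $\Psi_{\mathbf n,0}=Q_{\mathbf n}$. Given $\mathbf n^k=(n^k_{k+1},\dots,n^k_m)$, let $r_k$ be the smallest index at which the maximum of the components of $\mathbf n^k$ is attained; $\mathbf n^{k+1}=(n^{k+1}_{k+2},\dots,n^{k+1}_m)$ is obtained from $\mathbf n^k$ by deleting $n^k_{r_k}$ (so $n^{k+1}_j=n^k_{j-1}$ for $j\le r_k$ and $n^{k+1}_j=n^k_j$ for $j>r_k$). Given $\Sigma^k=(\sigma^k_{k+1},\dots,\sigma^k_m)$, write $s^k_{i,j}=\langle\sigma^k_i,\dots,\sigma^k_j\rangle$ and $\tau^k_{i,j}=\tau(s^k_{i,j})$, and let $$\Psi_{\mathbf n,k+1}(z)=\int\frac{\Psi_{\mathbf n,k}(x)}{z-x}\,ds^k_{k+1,r_k}(x).$$ If $r_k=k+1$ then $\Sigma^{k+1}=(\sigma^k_{k+2},\dots,\sigma^k_m)$; if $r_k\ge k+2$ then $$\Sigma^{k+1}=(\tau^k_{k+2,r_k},\ \widehat s^k_{k+2,r_k}d\tau^k_{k+3,r_k},\dots,\widehat s^k_{r_k-1,r_k}d\tau^k_{r_k,r_k},\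 \widehat s^k_{r_k,r_k}d\sigma^k_{r_k+1},\ \sigma^k_{r_k+2},\dots,\sigma^k_m).$$ *Exceptional case* $m=3$, $n_1<n_2<n_3$: the $\mathbf n^k$ are as above, but, with $s_{2,3}=\langle\sigma_2,\sigma_3\rangle$, $s_{3,2}=\langle\sigma_3,\sigma_2\rangle$, $\tau_{2,3}=\tau(s_{2,3})$, $\tau_{3,2}=\tau(s_{3,2})$, $$\Psi_{\mathbf n,1}(z)=\int\frac{Q_{\mathbf n}(x)}{z-x}\,d\langle\sigma_1,\sigma_2,\sigma_3\rangle(x),\qquad \Psi_{\mathbf n,2}(z)=\int\frac{\Psi_{\mathbf n,1}(x)}{z-x}\,\frac{\widehat s_{3,2}(x)}{\widehat\sigma_3(x)}\,d\tau_{2,3}(x),$$ and $\sigma^0_1,\sigma^1_2,\sigma^2_3$ stand for $\sigma_1$, $\tau_{2,3}$, $(\widehat s_{2,3}/\widehat\sigma_2)\,d\tau_{3,2}$, respectively. **Lemma.** Let $\mathbf n\in\mathbb Z_+^m(*)$ and $k\in\{0,\dots,m-1\}$. 1. $\Psi_{\mathbf n,k}$ has exactly $|\mathbf n^k|$ zeros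 in the interior (in $\mathbb R$) of $\Delta_{k+1}$, all of them simple, and no other zeros in $\mathbb C\setminus\Delta_k$. 2. If $I$ is the closure of a connected component of $\Delta_{k+1}\setminus\operatorname{supp}\sigma^k_{k+1}$, then $\Psi_{\mathbf n,k}$ has at most one zero on $I$. 3. Let $\tau$ be a permutation of $\{1,\dots,m\}$ and $l\in\{1,\dots,m\}$ with $\mathbf n,\mathbf n_l\in\mathbb Z_+^m(*,\tau)$. Then strictly between two consecutive zeros of $\Psi_{\mathbf n_l,k}$ on $\Delta_{k+1}$ lies exactly one zero of $\Psi_{\mathbf n,k}$, and strictly between two consecutive zeros of $\Psi_{\mathbf n,k}$ on $\Delta_{k+1}$ lies exactly one zero of $\Psi_{\mathbf n_l,k}$. -/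

import Mathlib

open MeasureTheory Set
open scoped Polynomial

noncomputable section

namespace Nikishin

/-! Finite real Borel measures of constant sign are Mathlib signed measures `s` on `ℝ` with
`0 ≤ s` or `s ≤ 0`. Systems of measures `(σ₁, …, σ_m)` and multi-indices `(n₁, …, n_m)` are
functions on `ℕ` of which only the values at `1, …, m` matter. -/

/-- The measure `s` does not change sign. -/
def HasConstantSign (s : SignedMeasure ℝ) : Prop := 0 ≤ s ∨ s ≤ 0

/-- The (closed) support of a signed measure. -/
def supp (s : SignedMeasure ℝ) : Set ℝ := s.variation.support

/-- The smallest interval `Co(supp s)` containing the support. -/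
def hull (s : SignedMeasure ℝ) : Set ℝ := convexHull ℝ (supp s)

/-- The Cauchy transform `ŝ(z) = ∫ ds(t) / (z - t)`. -/
def cauchy (s : SignedMeasure ℝ) (z : ℂ) : ℂ := ∫ᵛ t, (z - (t : ℂ))⁻¹ ∂<•s

/-- The Cauchy transform at real points, as a real number. -/
def cauchyReal (s : SignedMeasure ℝ) (x : ℝ) : ℝ := ∫ᵛ t, (x - t)⁻¹ ∂<•s

/-- The measure `g ds`. -/
def density (g : ℝ → ℝ) (s : SignedMeasure ℝ) : SignedMeasure ℝ :=
  VectorMeasure.withDensity s g (ContinuousLinearMap.lsmul ℝ ℝ)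

/-- `⟨s, t⟩`, that is, `d⟨s, t⟩ = t̂ ds`. -/
def angle (s t : SignedMeasure ℝ) : SignedMeasure ℝ := density (cauchyReal t) s

/-- `bracketAux μ d i = ⟨μ_i, ⟨μ_{i+1}, …, μ_{i+d}⟩⟩`. -/
def bracketAux (μ : ℕ → SignedMeasure ℝ) : ℕ → ℕ → SignedMeasure ℝ
  | 0, i => μ i
  | d + 1, i => angle (μ i) (bracketAux μ d (i + 1))

/-- `s_{i,j} = ⟨μ_i, …, μ_j⟩` for `i ≤ j`. -/
def bracket (μ : ℕ → SignedMeasure ℝ) (i j : ℕ) : SignedMeasure ℝ := bracketAux μ (j - i) i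

/-- `τ` is the measure in the decomposition `1 / ŝ = l + τ̂` off `Co(supp s)`, where `l` is a
polynomial of degree one: it has constant sign and lives on `Co(supp s)`. -/
def IsInverse (s τ : SignedMeasure ℝ) : Prop :=
  HasConstantSign τ ∧ hull τ ⊆ hull s ∧
    ∃ l : ℝ[X], l.degree = 1 ∧
      ∀ z : ℂ, (∀ x ∈ hull s, z ≠ (x : ℂ)) →
        (cauchy s z)⁻¹ = Polynomial.aeval z l + cauchy τ z

open scoped Classical in
/-- The measure `τ` with `1 / ŝ = l + τ̂`. -/
def inverse (s : SignedMeasure ℝ) : SignedMeasure ℝ :=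
  if h : ∃ τ, IsInverse s τ then h.choose else 0

/-- `(σ₁, …, σ_m)` generates a Nikishin system. -/
def Generates (m : ℕ) (σ : ℕ → SignedMeasure ℝ) : Prop :=
  (∀ k, 1 ≤ k → k ≤ m →
    HasConstantSign (σ k) ∧ IsCompact (supp (σ k)) ∧ (supp (σ k)).Infinite) ∧
  ∀ k, 1 ≤ k → k < m → Disjoint (hull (σ k)) (hull (σ (k + 1)))

/-- `Δ_k = Co(supp σ_k)` for `k ≥ 1`, and `Δ_0 = ∅`. -/
def Delta (σ : ℕ → SignedMeasure ℝ) (k : ℕ) : Set ℝ := if k = 0 then ∅ else hull (σ k)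

/-- `Q` is a monic `n`-th multiple orthogonal polynomial for the Nikishin system
`s_k = ⟨σ_1, …, σ_k⟩`, `1 ≤ k ≤ m`. -/
def IsMultipleOrthogonal (m : ℕ) (σ : ℕ → SignedMeasure ℝ) (n : ℕ → ℕ) (Q : ℂ[X]) : Prop :=
  Q.Monic ∧ Q.natDegree ≤ ∑ j ∈ Finset.Icc 1 m, n j ∧
    ∀ k, 1 ≤ k → k ≤ m → ∀ ν < n k,
      ∫ᵛ x, Q.eval (x : ℂ) * (x : ℂ) ^ ν ∂<•(bracket σ 1 k) = 0

/-- The class `ℤ₊^m(*)`: no `i < j < k` with `n_i < n_j < n_k`; for `m = 3` all multi-indices. -/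
def InStar (m : ℕ) (n : ℕ → ℕ) : Prop :=
  m = 3 ∨ ¬ ∃ i j k, 1 ≤ i ∧ i < j ∧ j < k ∧ k ≤ m ∧ n i < n j ∧ n j < n k

/-- `τ = τ_n`: for every `i`, `τ(i)` is the first index of a largest component of `n` among the
indices different from `τ(1), …, τ(i-1)`. -/
def IsOrdering (m : ℕ) (n : ℕ → ℕ) (τ : Equiv.Perm (Icc 1 m)) : Prop :=
  ∀ i k : Icc 1 m, (∀ i' < i, τ i' ≠ k) →
    (k < τ i → n k < n (τ i)) ∧ (τ i < k → n k ≤ n (τ i))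

/-- The class `ℤ₊^m(*, τ)`. -/
def InStarClass (m : ℕ) (τ : Equiv.Perm (Icc 1 m)) (n : ℕ → ℕ) : Prop :=
  InStar m n ∧ IsOrdering m n τ

/-- `n_l`: the `l`-th component is increased by one. -/
def bump (n : ℕ → ℕ) (l : ℕ) : ℕ → ℕ := Function.update n l (n l + 1)

/-- The first position in `k+1, …, m` of a largest component among `n_{k+1}, …, n_m`. -/
def firstMax (m k : ℕ) (n : ℕ → ℕ) : ℕ :=
  sInf {r | k + 1 ≤ r ∧ r ≤ m ∧ ∀ j, k + 1 ≤ j → j ≤ m → n j ≤ n r}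

/-- The multi-index `n^k = (n^k_{k+1}, …, n^k_m)`: `n^{k+1}` arises from `n^k` by deleting the
component `r_k` and shifting the components before it one place to the right. -/
def index (m : ℕ) (n : ℕ → ℕ) : ℕ → ℕ → ℕ
  | 0 => n
  | k + 1 => fun j =>
      if j ≤ firstMax m k (index m n k) then index m n k (j - 1) else index m n k j

/-- `r_k`. -/
def rIndex (m : ℕ) (n : ℕ → ℕ) (k : ℕ) : ℕ := firstMax m k (index m n k)

/-- `|n^k|`. -/
def indexSize (m : ℕ) (n : ℕ → ℕ) (k : ℕ) : ℕ := ∑ j ∈ Finset.Icc (k + 1) m, index m n k j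

/-- The step from `Σ^k = (μ_{k+1}, …, μ_m)` to `Σ^{k+1}`, when `r_k = r`. -/
def nextSystem (μ : ℕ → SignedMeasure ℝ) (k r : ℕ) : ℕ → SignedMeasure ℝ := fun j =>
  if r = k + 1 then μ j
  else if j = k + 2 then inverse (bracket μ (k + 2) r)
  else if j ≤ r then density (cauchyReal (bracket μ (j - 1) r)) (inverse (bracket μ j r))
  else if j = r + 1 then density (cauchyReal (bracket μ r r)) (μ j)
  else μ j

/-- The system `Σ^k = (σ^k_{k+1}, …, σ^k_m)`. -/
def system (m : ℕ) (σ : ℕ → SignedMeasure ℝ) (n : ℕ → ℕ) : ℕ → ℕ → SignedMeasure ℝ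
  | 0 => σ
  | k + 1 => nextSystem (system m σ n k) k (rIndex m n k)

/-- The case `m = 3`, `n_1 < n_2 < n_3`, in which the second type functions have a construction
of their own. -/
def Exceptional (m : ℕ) (n : ℕ → ℕ) : Prop := m = 3 ∧ n 1 < n 2 ∧ n 2 < n 3

/-- `s_{2,3} = ⟨σ_2, σ_3⟩`. -/
def s23 (σ : ℕ → SignedMeasure ℝ) : SignedMeasure ℝ := angle (σ 2) (σ 3)

/-- `s_{3,2} = ⟨σ_3, σ_2⟩`. -/
def s32 (σ : ℕ → SignedMeasure ℝ) : SignedMeasure ℝ := angle (σ 3) (σ 2)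

/-- The measures `s_{1,3}`, `(ŝ_{3,2} / σ̂_3) dτ_{2,3}`, `(ŝ_{2,3} / σ̂_2) dτ_{3,2}` that serve
as `s^0_{r_0}`, `s^1_{r_1}`, `s^2_{r_2}` in the exceptional case. -/
def exceptionalKernel (σ : ℕ → SignedMeasure ℝ) : ℕ → SignedMeasure ℝ
  | 0 => bracket σ 1 3
  | 1 => density (fun x => cauchyReal (s32 σ) x / cauchyReal (σ 3) x) (inverse (s23 σ))
  | _ => density (fun x => cauchyReal (s23 σ) x / cauchyReal (σ 2) x) (inverse (s32 σ))

/-- The measures on `Δ_1, Δ_2, Δ_3` that serve as `σ^0_1`, `σ^1_2`, `σ^2_3` in the exceptional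
case. -/
def exceptionalFirst (σ : ℕ → SignedMeasure ℝ) : ℕ → SignedMeasure ℝ
  | 0 => σ 1
  | 1 => inverse (s23 σ)
  | _ => exceptionalKernel σ 2

open scoped Classical in
/-- The measure `s^k_{r_k} = ⟨σ^k_{k+1}, …, σ^k_{r_k}⟩`. -/
def kernel (m : ℕ) (σ : ℕ → SignedMeasure ℝ) (n : ℕ → ℕ) (k : ℕ) : SignedMeasure ℝ :=
  if Exceptional m n then exceptionalKernel σ k
  else bracket (system m σ n k) (k + 1) (rIndex m n k)

open scoped Classical in
/-- The measure `σ^k_{k+1}`. -/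
def firstMeasure (m : ℕ) (σ : ℕ → SignedMeasure ℝ) (n : ℕ → ℕ) (k : ℕ) : SignedMeasure ℝ :=
  if Exceptional m n then exceptionalFirst σ k else system m σ n k (k + 1)

/-- The functions of second type: `Ψ_{n,0} = Q_n` and
`Ψ_{n,k+1}(z) = ∫ Ψ_{n,k}(x) / (z - x) ds^k_{r_k}(x)`. -/
def Psi (m : ℕ) (σ : ℕ → SignedMeasure ℝ) (n : ℕ → ℕ) (Q : ℂ[X]) : ℕ → ℂ → ℂ
  | 0 => fun z => Q.eval z
  | k + 1 => fun z => ∫ᵛ x, Psi m σ n Q k (x : ℂ) / (z - (x : ℂ)) ∂<•(kernel m σ n k)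

/-- Strictly between any two consecutive zeros of `f` on `J` lies exactly one zero of `g`. -/
def SeparatesZeros (J : Set ℝ) (f g : ℂ → ℂ) : Prop :=
  ∀ a ∈ J, ∀ b ∈ J, a < b → f a = 0 → f b = 0 → (∀ c ∈ Ioo a b, f (c : ℂ) ≠ 0) →
    ∃! c : ℝ, c ∈ Ioo a b ∧ g c = 0

end Nikishin

end

noncomputable section

/-! ### Signed measures of constant sign and integration against them. -/

namespace Nikishin

/-! Write N_k for the component of n^k that is deleted at step k, so that |n^k| = N_k + … + N_{m-1}
(`sum_index_rIndex`). The proof has an analytic half, which counts zeros from both ends of the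
construction, and an algebraic half, which supplies the orthogonality relations.

Analytic half. Let Ψ_{k+1} be the Cauchy transform of Ψ_k dκ_k, and let Ψ_k be orthogonal with
respect to κ_k to the polynomials of degree less than N_k (`Chain`, `OrthChain`). If Y is a
conjugation-symmetric family of zeros of Ψ_{k+1} off Δ_{k+1}, then dividing κ_k by the real
polynomial ∏ (x - y) gives N_k + |Y| relations for Ψ_k (`Chain.exists_orth`), and M relations force
M zeros of odd order inside Δ_{k+1} (`RealAnalyticOn.exists_odd_zeros`). Starting from Ψ_0 = P of
degree at most ∑ N_i + e, this bounds the number of zeros of Ψ_k by N_k + … + N_{m-1} + e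
(`Chain.card_le`). Starting from Ψ_{m-1} and going back, it produces N_k + … + N_{m-1} zeros
(`Chain.exists_zeros`). For e = 0 the two counts agree, so the zeros are simple and there are no
others (`Chain.zeros`). If a < b were zeros on the closure of one gap of the support, the factor (x
- a)(x - b), nonnegative on the support, could be dropped from the test polynomial, against
orthogonality (`Chain.false_of_gap`). For interlacing, n and n_l give the same chain because their
components are ordered alike. Every nontrivial real combination of the two functions then comes from
a polynomial with e = 1 and has no multiple zero on Δ_{k+1} (`Chain.order_le_one`), so their
Wronskian does not vanish and Rolle's theorem applies.

Algebraic half. Fubini turns moments of Ψ_{k+1} against w into moments of Ψ_k ŵ against the kernel,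
whose density with respect to σ^k_{k+1} is ŝ_{k+2,r} (or 1 when r = k + 1). Since 1/ŝ = ℓ + τ̂, the
product ŵ ŝ_{k+2,r} is a combination of transforms ŝ_{k+2,a}, the constant 1 and a linear polynomial
times ŝ_{k+2,r} (`IsSystem.exists_cauchy_reduced`). The condition on n makes the components before
the first maximum nonincreasing, so every index a that occurs carries enough relations. The linear
factor costs one degree, which the strict inequality n_{j-1} < n_r provides (`IsSystem.orth_next`).
In the exceptional case the components increase instead, and densities with quotients of transforms
yield the relations in the order n_3, n_2, n_1.

The inverse measure τ exists by a Schur complement: ŝ is a resolvent function of multiplication by x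
on L², and its reciprocal is linear minus a resolvent function of a compression
(`exists_measure_of_resolvent`). -/

lemma toSignedMeasure_congr {μ ν : Measure ℝ} [IsFiniteMeasure μ] [IsFiniteMeasure ν]
    (h : μ = ν) : μ.toSignedMeasure = ν.toSignedMeasure := by
  subst h; rfl

lemma eq_toSignedMeasure_variation {s : SignedMeasure ℝ} (h : 0 ≤ s) :
    ∃ _ : IsFiniteMeasure s.variation, s = s.variation.toSignedMeasure := by
  have hs' : 0 ≤[Set.univ] s := by rwa [VectorMeasure.le_restrict_univ_iff_le]
  obtain ⟨μ, hμ, e⟩ : ∃ μ : Measure ℝ, ∃ _ : IsFiniteMeasure μ, s = μ.toSignedMeasure :=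
    ⟨_, SignedMeasure.toMeasureOfZeroLE_finite s hs' MeasurableSet.univ, (s.toMeasureOfZeroLE_toSignedMeasure hs').symm⟩
  have e2 : s.variation = μ := by rw [e]; exact Measure.variation_toSignedMeasure
  have hfin : IsFiniteMeasure s.variation := by rw [e2]; exact hμ
  exact ⟨hfin, e.trans (toSignedMeasure_congr e2.symm)⟩

/-- Reduces every integral against `s` to a Bochner integral against a positive finite measure, up
to a sign. -/
lemma HasConstantSign.exists_eq_smul {s : SignedMeasure ℝ} (h : HasConstantSign s) :
    ∃ ε : ℝ, (ε = 1 ∨ ε = -1) ∧ ∃ _ : IsFiniteMeasure s.variation,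
      s = ε • s.variation.toSignedMeasure := by
  rcases h with h | h
  · obtain ⟨h1, h2⟩ := eq_toSignedMeasure_variation h
    exact ⟨1, Or.inl rfl, h1, by rw [one_smul]; exact h2⟩
  · obtain ⟨h1, h2⟩ := eq_toSignedMeasure_variation (s := -s) (by
      intro i hi
      have := h i hi
      simpa using this)
    have h3 : (-s).variation = s.variation := VectorMeasure.variation_neg s
    have h4 : IsFiniteMeasure s.variation := h3 ▸ h1
    refine ⟨-1, Or.inr rfl, h4, ?_⟩
    rw [← toSignedMeasure_congr h3, ← h2]
    simp

/-- The measure `s` has constant sign and is carried by `K`. -/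
structure Carried (s : SignedMeasure ℝ) (K : Set ℝ) : Prop where
  sign : HasConstantSign s
  supp_subset : supp s ⊆ K

/-- The measure `s` has constant sign, is carried by `K` and has infinite support. -/
structure Tame (s : SignedMeasure ℝ) (K : Set ℝ) : Prop extends Carried s K where
  infinite : (supp s).Infinite

lemma HasConstantSign.exists_integral_eq {E : Type*} [NormedAddCommGroup E] [NormedSpace ℝ E]
    {s : SignedMeasure ℝ} (h : HasConstantSign s) :
    ∃ ε : ℝ, (ε = 1 ∨ ε = -1) ∧ ∀ f : ℝ → E, ∫ᵛ x, f x ∂<•s = ε • ∫ x, f x ∂s.variation := by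
  obtain ⟨ε, hε, hfin, hs⟩ := h.exists_eq_smul
  refine ⟨ε, hε, fun f => ?_⟩
  conv_lhs => rw [hs]
  rw [VectorMeasure.integral_smul_vectorMeasure, VectorMeasure.integral_toSignedMeasure]

namespace Carried

variable {s t : SignedMeasure ℝ} {K L : Set ℝ}

lemma ae_mem_supp : ∀ᵐ x ∂s.variation, x ∈ supp s := Measure.support_mem_ae

lemma ae_mem (h : Carried s K) : ∀ᵐ x ∂s.variation, x ∈ K :=
  ae_mem_supp.mono fun _ hx => h.2 hx

lemma integrable {E : Type*} [NormedAddCommGroup E] (h : Carried s K) (hK : IsCompact K) {f : ℝ → E} (hf : ContinuousOn f K) :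
    s.Integrable f := by
  obtain ⟨ε, hε, hfin, hs⟩ := h.1.exists_eq_smul
  have h1 : IntegrableOn f K s.variation := hf.integrableOn_compact hK
  rwa [IntegrableOn, Measure.restrict_eq_self_of_ae_mem h.ae_mem] at h1

lemma integral_congr {E : Type*} [NormedAddCommGroup E] [NormedSpace ℝ E] (h : Carried s K) {f g : ℝ → E} (hfg : ∀ x ∈ K, f x = g x) :
    ∫ᵛ x, f x ∂<•s = ∫ᵛ x, g x ∂<•s :=
  VectorMeasure.integral_congr_ae (h.ae_mem.mono hfg)

lemma integral_const_mul (h : Carried s K) (c : ℂ) (f : ℝ → ℂ) :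
    ∫ᵛ x, c * f x ∂<•s = c * ∫ᵛ x, f x ∂<•s := by
  obtain ⟨ε, hε, hs⟩ := h.1.exists_integral_eq (E := ℂ)
  rw [hs, hs, MeasureTheory.integral_const_mul, mul_smul_comm]

lemma integral_mul_const (h : Carried s K) (c : ℂ) (f : ℝ → ℂ) :
    ∫ᵛ x, f x * c ∂<•s = (∫ᵛ x, f x ∂<•s) * c := by
  simp_rw [mul_comm _ c]; exact h.integral_const_mul c f

lemma integral_ofReal (h : Carried s K) (f : ℝ → ℝ) :
    ∫ᵛ x, (f x : ℂ) ∂<•s = ((∫ᵛ x, f x ∂<•s : ℝ) : ℂ) := by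
  obtain ⟨ε, hε, hfin, hs⟩ := h.1.exists_eq_smul
  rw [hs, VectorMeasure.integral_smul_vectorMeasure, VectorMeasure.integral_smul_vectorMeasure,
    VectorMeasure.integral_toSignedMeasure, VectorMeasure.integral_toSignedMeasure,
    integral_complex_ofReal]
  simp

lemma integral_conj (h : Carried s K) (f : ℝ → ℂ) :
    ∫ᵛ x, (starRingEnd ℂ) (f x) ∂<•s = (starRingEnd ℂ) (∫ᵛ x, f x ∂<•s) := by
  obtain ⟨ε, hε, hs⟩ := h.1.exists_integral_eq (E := ℂ)
  rw [hs, hs, _root_.integral_conj]; simp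

/-- Vanishing holds at every point of the support, not just almost everywhere: by continuity, a
nonzero value at a support point would persist on a set of positive measure. -/
lemma eq_zero_of_integral_eq_zero (h : Carried s K) (hK : IsCompact K) {f : ℝ → ℝ}
    (hf : ContinuousOn f K) (hpos : ∀ x ∈ supp s, 0 ≤ f x)
    (h0 : ∫ᵛ x, (f x : ℂ) ∂<•s = 0) : ∀ x ∈ supp s, f x = 0 := by
  obtain ⟨ε, hε, hs⟩ := h.1.exists_integral_eq (E := ℝ)
  rw [h.integral_ofReal, hs] at h0
  have hε0 : ε ≠ 0 := by rcases hε with rfl | rfl <;> norm_num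
  have h1 : ∫ x, f x ∂s.variation = 0 := by
    have := Complex.ofReal_eq_zero.1 h0
    simpa [hε0] using this
  have h2 : f =ᵐ[s.variation] 0 :=
    (integral_eq_zero_iff_of_nonneg_ae (ae_mem_supp.mono hpos) (h.integrable hK hf)).1 h1
  intro x hx
  by_contra hne
  have hcont := hf x (h.2 hx)
  have hev : ∀ᶠ y in nhdsWithin x K, f y ≠ 0 := hcont.eventually_ne hne
  rw [eventually_nhdsWithin_iff] at hev
  have hpos := (Measure.mem_support_iff_forall x).1 hx _ hev
  refine hpos.ne' ?_
  have : ∀ᵐ y ∂s.variation, ¬ (y ∈ K → f y ≠ 0) := by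
    filter_upwards [h2, h.ae_mem] with y hy hyK
    simp [hyK, hy]
  simpa [ae_iff] using this

lemma integral_integral_swap (hs : Carried s K) (ht : Carried t L) (hK : IsCompact K)
    (hL : IsCompact L) {f : ℝ → ℝ → ℂ} (hf : ContinuousOn (Function.uncurry f) (K ×ˢ L)) :
    ∫ᵛ x, (∫ᵛ y, f x y ∂<•t) ∂<•s = ∫ᵛ y, (∫ᵛ x, f x y ∂<•s) ∂<•t := by
  obtain ⟨ε, hε, hsi⟩ := hs.1.exists_integral_eq (E := ℂ)
  obtain ⟨δ, hδ, hti⟩ := ht.1.exists_integral_eq (E := ℂ)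
  obtain ⟨-, -, h1, -⟩ := hs.1.exists_eq_smul
  obtain ⟨-, -, h2, -⟩ := ht.1.exists_eq_smul
  simp_rw [hsi, hti, integral_smul]
  rw [smul_comm, MeasureTheory.integral_integral_swap]
  have h3 : IntegrableOn (Function.uncurry f) (K ×ˢ L) (s.variation.prod t.variation) :=
    hf.integrableOn_compact (hK.prod hL)
  rw [IntegrableOn, ← Measure.prod_restrict, Measure.restrict_eq_self_of_ae_mem hs.ae_mem,
    Measure.restrict_eq_self_of_ae_mem ht.ae_mem] at h3
  exact h3

end Carried

/-! ### Densities of one sign. -/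

/-- `g` is continuous on `K`, without zeros or sign changes there. -/
structure SignedOn (g : ℝ → ℝ) (K : Set ℝ) : Prop where
  cont : ContinuousOn g K
  sign : (∀ x ∈ K, 0 < g x) ∨ ∀ x ∈ K, g x < 0

/-- With s = ε|s| and g = δ|g| on `K`, the measure g ds is εδ times the positive measure |g| d|s|;
all three claims are read off from this. -/
lemma density_eq {s : SignedMeasure ℝ} {K : Set ℝ} (hK : IsCompact K) (h : Carried s K)
    {g : ℝ → ℝ} (hg : SignedOn g K) :
    (density g s).variation = s.variation.withDensity (fun x => ‖g x‖ₑ) ∧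
    HasConstantSign (density g s) ∧
    ∀ f : ℝ → ℂ, ∫ᵛ x, f x ∂<•(density g s) = ∫ᵛ x, (g x : ℂ) * f x ∂<•s := by
  obtain ⟨ε, hε, hfin, hs⟩ := h.1.exists_eq_smul
  have hi : s.Integrable g := h.integrable hK hg.cont
  have hvar : (density g s).variation = s.variation.withDensity (fun x => ‖g x‖ₑ) := by
    rw [density, VectorMeasure.variation_withDensity hi (by simp),
      VectorMeasure.variation_transpose_lsmul]
  have hfin2 : IsFiniteMeasure (s.variation.withDensity fun x => ‖g x‖ₑ) :=
    ⟨by simpa using! hi.2⟩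
  have hset : ∀ A, MeasurableSet A → density g s A = ε * ∫ x in A, g x ∂s.variation := by
    intro A hA
    rw [density, VectorMeasure.withDensity_apply hi]
    have hflip : (ContinuousLinearMap.lsmul ℝ ℝ : ℝ →L[ℝ] ℝ →L[ℝ] ℝ) =
        (ContinuousLinearMap.lsmul ℝ ℝ : ℝ →L[ℝ] ℝ →L[ℝ] ℝ).flip := by
      ext; simp
    rw [hflip]
    conv_lhs => rw [hs]
    rw [VectorMeasure.restrict_smul, VectorMeasure.integral_smul_vectorMeasure,
      VectorMeasure.setIntegral_toSignedMeasure hA, smul_eq_mul]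
  obtain ⟨δ, hδ, hgδ⟩ : ∃ δ : ℝ, (δ = 1 ∨ δ = -1) ∧ ∀ x ∈ K, g x = δ * ‖g x‖ := by
    rcases hg.sign with h1 | h1
    · exact ⟨1, Or.inl rfl, fun x hx => by simp [abs_of_pos (h1 x hx)]⟩
    · exact ⟨-1, Or.inr rfl, fun x hx => by simp [abs_of_neg (h1 x hx)]⟩
  have heq : density g s =
      (ε * δ) • (s.variation.withDensity fun x => ‖g x‖ₑ).toSignedMeasure := by
    ext A hA
    rw [hset A hA, smul_apply, Measure.toSignedMeasure_apply_measurable hA,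
      smul_eq_mul, mul_assoc]
    congr 1
    rw [measureReal_def, withDensity_apply _ hA, ← integral_norm_eq_lintegral_enorm
      hi.aestronglyMeasurable.restrict, ← MeasureTheory.integral_const_mul]
    apply integral_congr_ae
    exact ae_restrict_of_ae (h.ae_mem.mono hgδ)
  refine ⟨hvar, ?_, fun f => ?_⟩
  · rw [heq]
    have h0 : 0 ≤ (s.variation.withDensity fun x => ‖g x‖ₑ).toSignedMeasure :=
      Measure.zero_le_toSignedMeasure _
    rcases hε with rfl | rfl <;> rcases hδ with rfl | rfl
    · left; simpa using h0
    · right; intro i hi; rw [smul_apply]; have := h0 i hi; simpa only [mul_neg, mul_one, one_mul, neg_smul, one_smul, Left.neg_nonpos_iff, FunLike.coe_zero, Pi.zero_apply] using this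
    · right; intro i hi; rw [smul_apply]; have := h0 i hi; simpa only [mul_neg, mul_one, one_mul, neg_smul, one_smul, Left.neg_nonpos_iff, FunLike.coe_zero, Pi.zero_apply] using this
    · left; simpa using h0
  · conv_lhs => rw [heq]
    conv_rhs => rw [hs]
    rw [VectorMeasure.integral_smul_vectorMeasure, VectorMeasure.integral_smul_vectorMeasure,
      VectorMeasure.integral_toSignedMeasure, VectorMeasure.integral_toSignedMeasure, mul_smul]
    congr 1
    rw [integral_withDensity_eq_integral_toReal_smul₀ hi.aestronglyMeasurable.enorm (by simp),
      ← integral_smul]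
    apply integral_congr_ae
    filter_upwards [h.ae_mem] with x hx
    conv_rhs => rw [hgδ x hx]
    simp [mul_assoc]

section density

variable {s : SignedMeasure ℝ} {K : Set ℝ} {g : ℝ → ℝ}

lemma supp_density (hK : IsCompact K) (h : Carried s K) (hg : SignedOn g K) :
    supp (density g s) = supp s := by
  have hi : s.Integrable g := h.integrable hK hg.cont
  rw [supp, (density_eq hK h hg).1]
  apply Set.Subset.antisymm
  · exact (withDensity_absolutelyContinuous _ _).support_mono
  · refine (withDensity_absolutelyContinuous' hi.aestronglyMeasurable.enorm ?_).support_mono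
    filter_upwards [h.ae_mem] with x hx
    have : g x ≠ 0 := by
      rcases hg.sign with h1 | h1
      exacts [(h1 x hx).ne', (h1 x hx).ne]
    simpa using this

lemma Carried.density (h : Carried s K) (hK : IsCompact K) (hg : SignedOn g K) :
    Carried (density g s) K :=
  ⟨(density_eq hK h hg).2.1, (supp_density hK h hg).le.trans h.2⟩

lemma Tame.density (h : Tame s K) (hK : IsCompact K) (hg : SignedOn g K) :
    Tame (Nikishin.density g s) K :=
  ⟨h.toCarried.density hK hg, by rw [supp_density hK h.1 hg]; exact h.infinite⟩

lemma integral_density (hK : IsCompact K) (h : Carried s K) (hg : SignedOn g K) (f : ℝ → ℂ) :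
    ∫ᵛ x, f x ∂<•(density g s) = ∫ᵛ x, (g x : ℂ) * f x ∂<•s :=
  (density_eq hK h hg).2.2 f

end density

/-! ### Scalar spectral measures of bounded self-adjoint operators. -/

section spectral

variable {H : Type*} [NormedAddCommGroup H] [InnerProductSpace ℂ H] [CompleteSpace H]

open scoped InnerProductSpace

lemma ofReal_re_inner_of_isSelfAdjoint {T : H →L[ℂ] H} (hT : IsSelfAdjoint T) (v : H) :
    ((⟪v, T v⟫_ℂ).re : ℂ) = ⟪v, T v⟫_ℂ := by
  have h1 : ⟪T v, v⟫_ℂ = ⟪v, T v⟫_ℂ := by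
    rw [← ContinuousLinearMap.adjoint_inner_right, hT.adjoint_eq]
  have h2 := inner_conj_symm (𝕜 := ℂ) v (T v)
  rw [h1] at h2
  exact Complex.conj_eq_iff_re.1 h2

/-- The scalar spectral measure of a bounded self-adjoint operator. -/
lemma exists_spectral_measure {B : H →L[ℂ] H} (hB : IsSelfAdjoint B) {a b : ℝ} (hab : a ≤ b)
    (hs : spectrum ℝ B ⊆ Icc a b) (v : H) :
    ∃ ν : Measure ℝ, IsFiniteMeasure ν ∧ (∀ᵐ x ∂ν, x ∈ Icc a b) ∧
      ∀ f : ℝ → ℝ, ContinuousOn f (Icc a b) → ((∫ x, f x ∂ν : ℝ) : ℂ) = ⟪v, cfc f B v⟫_ℂ := by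
  have hc : ∀ f : CompactlySupportedContinuousMap (Icc a b) ℝ,
      Continuous (IccExtend hab f) := fun f => f.continuous.Icc_extend'
  -- The functional f ↦ ⟨v, f(B)v⟩ on C[a, b], to which the Riesz–Markov–Kakutani theorem is
  -- applied. `IccExtend` supplies functions on all of ℝ, as the functional calculus requires; only
  -- their values on the spectrum count.
  let Λ₀ : CompactlySupportedContinuousMap (Icc a b) ℝ →ₗ[ℝ] ℝ :=
    { toFun := fun f => (⟪v, cfc (IccExtend hab f) B v⟫_ℂ).re
      map_add' := fun f g => by
        have : IccExtend hab (f + g : CompactlySupportedContinuousMap (Icc a b) ℝ) =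
          fun x => IccExtend hab f x + IccExtend hab g x := by ext x; simp [IccExtend]
        rw [this, cfc_add _ _ _ (hc f).continuousOn (hc g).continuousOn]
        simp
      map_smul' := fun r f => by
        have : IccExtend hab (r • f : CompactlySupportedContinuousMap (Icc a b) ℝ) =
          fun x => r * IccExtend hab f x := by ext x; simp [IccExtend]
        rw [this, cfc_const_mul _ _ _ (hc f).continuousOn]
        simp [inner_smul_right_eq_smul] }
  have hmono : ∀ f : CompactlySupportedContinuousMap (Icc a b) ℝ, 0 ≤ f → 0 ≤ Λ₀ f := by
    intro f hf
    have h1 : 0 ≤ cfc (IccExtend hab f) B := cfc_nonneg fun x _ => hf _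
    rw [ContinuousLinearMap.nonneg_iff_isPositive] at h1
    exact h1.re_inner_nonneg_right v
  let Λ : CompactlySupportedContinuousMap (Icc a b) ℝ →ₚ[ℝ] ℝ := PositiveLinearMap.mk₀ Λ₀ hmono
  have hreg : (RealRMK.rieszMeasure Λ).Regular := MeasureTheory.Content.regular _
  let ν₀ := RealRMK.rieszMeasure Λ
  have hfin : IsFiniteMeasure ν₀ := ⟨isCompact_univ.measure_lt_top⟩
  have hemb : MeasurableEmbedding (Subtype.val : Icc a b → ℝ) :=
    MeasurableEmbedding.subtype_coe measurableSet_Icc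
  refine ⟨ν₀.map Subtype.val, inferInstance, ?_, fun f hf => ?_⟩
  · rw [hemb.ae_map_iff]
    exact Filter.Eventually.of_forall fun x => x.2
  · rw [hemb.integral_map]
    let F : CompactlySupportedContinuousMap (Icc a b) ℝ :=
      ⟨⟨fun x => f x, hf.domRestrict⟩, HasCompactSupport.of_compactSpace _⟩
    have h1 := RealRMK.integral_rieszMeasure Λ F
    have h2 : ∫ x : Icc a b, f x ∂ν₀ = (⟪v, cfc (IccExtend hab F) B v⟫_ℂ).re := h1
    rw [h2, ofReal_re_inner_of_isSelfAdjoint (cfc_predicate _ _)]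
    rw [cfc_congr (f := IccExtend hab F) (g := f)]
    intro x hx
    rw [IccExtend_of_mem hab _ (hs hx)]
    rfl

/-- The calculus in use is for real functions, so the resolvent kernel is split as (z - x)⁻¹ = z̄
φ(x) - φ(x) x with φ = |z - x|⁻². Since φ(B) inverts B² - 2 Re(z) B + |z|², the solution `w` of (z -
B)w = v is z̄ φ(B)v - (φ x)(B)v. -/
lemma inner_resolvent_eq_integral {B : H →L[ℂ] H} (hB : IsSelfAdjoint B) {a b : ℝ}
    (hs : spectrum ℝ B ⊆ Icc a b) {v : H} {ν : Measure ℝ} [IsFiniteMeasure ν]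
    (hν : ∀ᵐ x ∂ν, x ∈ Icc a b)
    (hf : ∀ f : ℝ → ℝ, ContinuousOn f (Icc a b) → ((∫ x, f x ∂ν : ℝ) : ℂ) = ⟪v, cfc f B v⟫_ℂ)
    {z : ℂ} (hz : ∀ x ∈ Icc a b, z ≠ (x : ℂ)) {w : H} (hw : z • w - B w = v) :
    ∫ x, (z - (x : ℂ))⁻¹ ∂ν = ⟪v, w⟫_ℂ := by
  let φ : ℝ → ℝ := fun x => (Complex.normSq (z - x))⁻¹
  have hq : Continuous fun x : ℝ => Complex.normSq (z - x) :=
    Complex.continuous_normSq.comp (continuous_const.sub Complex.continuous_ofReal)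
  have hne : ∀ x ∈ Icc a b, Complex.normSq (z - x) ≠ 0 := fun x hx => by
    simpa [sub_eq_zero] using hz x hx
  have hφ : ContinuousOn φ (Icc a b) := hq.continuousOn.inv₀ hne
  have hφ' : ContinuousOn (fun x => φ x * x) (Icc a b) := hφ.mul continuousOn_id
  have hC : cfc φ B * cfc (fun x => Complex.normSq (z - x)) B = 1 := by
    rw [← cfc_mul _ _ _ (hφ.mono hs) hq.continuousOn]
    rw [← cfc_one ℝ B]
    exact cfc_congr fun x hx => inv_mul_cancel₀ (hne x (hs hx))
  have hB2 : cfc (fun x => Complex.normSq (z - x)) B =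
      B * B - (2 * z.re) • B + (Complex.normSq z) • (1 : H →L[ℂ] H) := by
    have h1 : (fun x : ℝ => Complex.normSq (z - x)) =
        fun x => (x * x - (2 * z.re) * x) + Complex.normSq z * 1 := by
      ext x; simp [Complex.normSq_apply]; ring
    rw [h1, cfc_add _ _ _ (by fun_prop) (by fun_prop), cfc_sub _ _ _ (by fun_prop) (by fun_prop),
      cfc_mul _ _ _ (by fun_prop) (by fun_prop), cfc_const_mul _ _ _ (by fun_prop),
      cfc_const_mul _ _ _ (by fun_prop), cfc_id' ℝ B, cfc_const_one ℝ B]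
  have hCB : cfc (fun x => φ x * x) B = cfc φ B * B := by
    rw [cfc_mul _ _ _ (hφ.mono hs) (by fun_prop), cfc_id' ℝ B]
  have hw2 : w = (starRingEnd ℂ z) • cfc φ B v - cfc (fun x => φ x * x) B v := by
    have h3 : cfc (fun x => Complex.normSq (z - x)) B w = (starRingEnd ℂ z) • v - B v := by
      rw [hB2, ← hw]
      have e1 : (2 * z.re) • B w = (z + starRingEnd ℂ z) • B w := by
        rw [Complex.add_conj, Complex.coe_smul]
      have e2 : Complex.normSq z • w = (starRingEnd ℂ z * z) • w := by
        rw [← Complex.normSq_eq_conj_mul_self, Complex.coe_smul]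
      simp only [_root_.add_apply, _root_.sub_apply, _root_.smul_apply,
        mul_apply_eq_comp, one_apply_eq_self, map_sub, map_smul, e1, e2]
      module
    have h4 : w = cfc φ B (cfc (fun x => Complex.normSq (z - x)) B w) := by
      have := congrArg (fun T : H →L[ℂ] H => T w) hC
      simpa using this.symm
    rw [h4, h3, hCB, map_sub, map_smul]
    rfl
  have hi : ∀ g : ℝ → ℝ, ContinuousOn g (Icc a b) → Integrable (fun x => (g x : ℂ)) ν := by
    intro g hg
    have h1 : IntegrableOn g (Icc a b) ν := hg.integrableOn_compact isCompact_Icc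
    rw [IntegrableOn, Measure.restrict_eq_self_of_ae_mem hν] at h1
    exact h1.ofReal
  have h5 : ∀ x : ℝ, (z - (x : ℂ))⁻¹ =
      starRingEnd ℂ z * (φ x : ℂ) - ((φ x * x : ℝ) : ℂ) := by
    intro x
    rw [Complex.inv_def]
    simp only [φ]
    push_cast
    rw [map_sub, Complex.conj_ofReal]
    ring
  simp_rw [h5]
  rw [integral_sub ((hi φ hφ).const_mul _) (hi _ hφ'), MeasureTheory.integral_const_mul,
    integral_complex_ofReal, integral_complex_ofReal, hf _ hφ, hf _ hφ', hw2, inner_sub_right,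
    inner_smul_right]

end spectral

/-! ### Multiplication by the coordinate on L². -/

section multiplication

open scoped InnerProductSpace ENNReal

variable {μ : Measure ℝ} [IsFiniteMeasure μ] {a b : ℝ}

lemma memLp_clamp (μ : Measure ℝ) [IsFiniteMeasure μ] (hab : a ≤ b) :
    MemLp (fun x : ℝ => ((projIcc a b hab x : ℝ) : ℂ)) ∞ μ := by
  refine memLp_top_of_bound (C := max |a| |b|) ?_ ?_
  · exact (Complex.continuous_ofReal.comp
      (continuous_subtype_val.comp continuous_projIcc)).aestronglyMeasurable
  · refine Filter.Eventually.of_forall fun x => ?_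
    rw [Complex.norm_real]
    exact abs_le_max_abs_abs (projIcc a b hab x).2.1 (projIcc a b hab x).2.2

/-- Multiplication by the coordinate, clamped to `[a, b]`, on `L²(μ)`. -/
def mulCoord (μ : Measure ℝ) [IsFiniteMeasure μ] (hab : a ≤ b) : Lp ℂ 2 μ →L[ℂ] Lp ℂ 2 μ :=
  LinearMap.mkContinuous
    { toFun := fun f => ((memLp_clamp μ hab).toLp _ : Lp ℂ ∞ μ) • f
      map_add' := fun f g => Lp.add_smul _ _ _
      map_smul' := fun c f => (Lp.smul_comm c _ f).symm }
    ‖((memLp_clamp μ hab).toLp _ : Lp ℂ ∞ μ)‖ fun f => Lp.norm_smul_le _ _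

lemma coeFn_mulCoord (hab : a ≤ b) (hμ : ∀ᵐ x ∂μ, x ∈ Icc a b) (f : Lp ℂ 2 μ) :
    mulCoord μ hab f =ᵐ[μ] fun x => (x : ℂ) * f x := by
  have h1 : mulCoord μ hab f =ᵐ[μ] (((memLp_clamp μ hab).toLp _ : Lp ℂ ∞ μ) : ℝ → ℂ) • (f : ℝ → ℂ) :=
    Lp.coeFn_lpSMul _ _
  filter_upwards [h1, (memLp_clamp μ hab).coeFn_toLp, hμ] with x h1 h2 h3
  rw [h1, Pi.smul_apply', h2, projIcc_of_mem hab h3, smul_eq_mul]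

/-- Multiplication by a nonnegative function w has the quadratic form ∫ w |f|² ≥ 0; take w = x - a
and w = b - x. -/
lemma mulCoord_sub_nonneg (hab : a ≤ b) (hμ : ∀ᵐ x ∂μ, x ∈ Icc a b) :
    a • (1 : Lp ℂ 2 μ →L[ℂ] Lp ℂ 2 μ) ≤ mulCoord μ hab ∧
      mulCoord μ hab ≤ b • (1 : Lp ℂ 2 μ →L[ℂ] Lp ℂ 2 μ) := by
  have key : ∀ (T : Lp ℂ 2 μ →L[ℂ] Lp ℂ 2 μ) (w : ℝ → ℝ),
      (∀ᵐ x ∂μ, 0 ≤ w x) → (∀ f, T f =ᵐ[μ] fun x => (w x : ℂ) * f x) → 0 ≤ T := by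
    intro T w hw hT
    rw [ContinuousLinearMap.nonneg_iff_isPositive, ← ContinuousLinearMap.isPositive_toLinearMap_iff,
      LinearMap.isPositive_iff_complex]
    intro f
    have h1 : ⟪T f, f⟫_ℂ = ((∫ x, w x * ‖f x‖ ^ 2 ∂μ : ℝ) : ℂ) := by
      rw [L2.inner_def, ← integral_complex_ofReal]
      refine integral_congr_ae ((hT f).mono fun x hx => ?_)
      simp only [hx, RCLike.inner_apply, map_mul, Complex.conj_ofReal]
      push_cast
      rw [← Complex.mul_conj']
      ring
    have h2 : 0 ≤ ∫ x, w x * ‖f x‖ ^ 2 ∂μ :=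
      integral_nonneg_of_ae (hw.mono fun x hx => by
        have : 0 ≤ w x := hx
        show 0 ≤ w x * ‖f x‖ ^ 2
        positivity)
    rw [ContinuousLinearMap.coe_coe, h1]
    simpa using h2
  constructor
  · rw [← sub_nonneg]
    refine key _ (fun x => x - a) (hμ.mono fun x hx => sub_nonneg.2 hx.1) fun f => ?_
    have e : (mulCoord μ hab - a • (1 : Lp ℂ 2 μ →L[ℂ] Lp ℂ 2 μ)) f =
      mulCoord μ hab f - (a : ℂ) • f := rfl
    rw [e]
    filter_upwards [Lp.coeFn_sub (mulCoord μ hab f) ((a : ℂ) • f), Lp.coeFn_smul (a : ℂ) f,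
      coeFn_mulCoord hab hμ f] with x h1 h2 h3
    rw [h1, Pi.sub_apply, h2, h3, Pi.smul_apply, smul_eq_mul]
    push_cast; ring
  · rw [← sub_nonneg]
    refine key _ (fun x => b - x) (hμ.mono fun x hx => sub_nonneg.2 hx.2) fun f => ?_
    have e : (b • (1 : Lp ℂ 2 μ →L[ℂ] Lp ℂ 2 μ) - mulCoord μ hab) f =
      (b : ℂ) • f - mulCoord μ hab f := rfl
    rw [e]
    filter_upwards [Lp.coeFn_sub ((b : ℂ) • f) (mulCoord μ hab f), Lp.coeFn_smul (b : ℂ) f,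
      coeFn_mulCoord hab hμ f] with x h1 h2 h3
    rw [h1, Pi.sub_apply, h2, h3, Pi.smul_apply, smul_eq_mul]
    push_cast; ring

end multiplication

/-! ### Reciprocals of resolvent functions by a Schur complement. -/

section compression

open scoped InnerProductSpace

variable {H : Type*} [NormedAddCommGroup H] [InnerProductSpace ℂ H] [CompleteSpace H]

lemma isSelfAdjoint_of_between {X : H →L[ℂ] H} {a : ℝ} (h : a • (1 : H →L[ℂ] H) ≤ X) :
    IsSelfAdjoint X := by
  have h1 : IsSelfAdjoint (X - a • (1 : H →L[ℂ] H)) := IsSelfAdjoint.of_nonneg (sub_nonneg.2 h)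
  have h2 : IsSelfAdjoint (a • (1 : H →L[ℂ] H)) := (IsSelfAdjoint.all a).smul (.one _)
  have h3 := h1.add h2
  rwa [sub_add_cancel] at h3

/-- The Schur complement of a resolvent: the reciprocal of the resolvent function of `X` at `e` is
expressed by a spectral measure of the compression of `X` to the complement of `e`. -/
lemma exists_measure_of_resolvent {X : H →L[ℂ] H} {a b : ℝ} (hab : a ≤ b)
    (ha : a • (1 : H →L[ℂ] H) ≤ X) (hb : X ≤ b • (1 : H →L[ℂ] H)) {e : H} (he : e ≠ 0) :
    ∃ ν : Measure ℝ, IsFiniteMeasure ν ∧ (∀ᵐ x ∂ν, x ∈ Icc a b) ∧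
      ∀ z : ℂ, (∀ x ∈ Icc a b, z ≠ (x : ℂ)) → ∀ g : H, z • g - X g = e → ⟪e, g⟫_ℂ ≠ 0 →
        ∫ x, (z - (x : ℂ))⁻¹ ∂ν =
          ‖e‖ ^ 2 * z - (‖e‖ ^ 2) ^ 2 / ⟪e, g⟫_ℂ - (⟪e, X e⟫_ℂ).re := by
  have hX := isSelfAdjoint_of_between ha
  let P : H →L[ℂ] H := (ℂ ∙ e)ᗮ.starProjection
  have hPs : star P = P := isSelfAdjoint_starProjection _
  have hPP : P * P = P := (ℂ ∙ e)ᗮ.isIdempotentElem_starProjection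
  have hPf : ∀ f, P f = f - (⟪e, f⟫_ℂ / (‖e‖ : ℂ) ^ 2) • e := by
    intro f
    have h1 : P f = f - (ℂ ∙ e).starProjection f := by
      simp only [P, Submodule.starProjection_orthogonal]
      simp
    rw [h1, Submodule.starProjection_singleton]
    simp
  have he2 : ((‖e‖ : ℂ) ^ 2) ≠ 0 := by simpa using he
  have hPe : P e = 0 := by
    rw [hPf, inner_self_eq_norm_sq_to_K]
    simp only [Complex.coe_algebraMap, div_self he2]
    simp
  have hPi : ∀ u w, ⟪P u, w⟫_ℂ = ⟪u, P w⟫_ℂ := fun u w => by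
    rw [← ContinuousLinearMap.adjoint_inner_right]
    congr 2
  have hPPf : ∀ u, P (P u) = P u := fun u => by
    conv_rhs => rw [← hPP]
    rfl
  -- On the span of `e`, `B` is set to `a` rather than 0, which keeps its spectrum in [a, b]; the
  -- vector P X e is orthogonal to `e`, so the resolvent function is not affected.
  let B : H →L[ℂ] H := P * X * P + a • (1 - P)
  have hBa : a • (1 : H →L[ℂ] H) ≤ B := by
    rw [← sub_nonneg]
    have h1 : B - a • (1 : H →L[ℂ] H) = star P * (X - a • 1) * P := by
      rw [hPs]
      simp only [B, mul_sub, sub_mul, smul_sub, mul_smul_comm, smul_mul_assoc, mul_one, hPP]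
      abel
    rw [h1]
    exact star_left_conjugate_nonneg (sub_nonneg.2 ha) _
  have hBb : B ≤ b • (1 : H →L[ℂ] H) := by
    rw [← sub_nonneg]
    have h1 : b • (1 : H →L[ℂ] H) - B =
        star P * (b • 1 - X) * P + (b - a) • (star (1 - P) * (1 - P)) := by
      have h2 : star (1 - P) * (1 - P) = 1 - P := by
        rw [star_sub, star_one, hPs]
        simp only [mul_sub, sub_mul, mul_one, one_mul, hPP]
        abel
      rw [h2, hPs]
      simp only [B, mul_sub, sub_mul, smul_sub, sub_smul, mul_smul_comm, smul_mul_assoc, mul_one,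
        hPP]
      abel
    rw [h1]
    exact add_nonneg (star_left_conjugate_nonneg (sub_nonneg.2 hb) _)
      (smul_nonneg (sub_nonneg.2 hab) (star_mul_self_nonneg _))
  have hB : IsSelfAdjoint B := isSelfAdjoint_of_between hBa
  have hs : spectrum ℝ B ⊆ Icc a b := fun x hx =>
    ⟨(algebraMap_le_iff_le_spectrum (a := B) hB).1 (by rwa [Algebra.algebraMap_eq_smul_one]) x hx,
      (le_algebraMap_iff_spectrum_le (a := B) hB).1 (by rwa [Algebra.algebraMap_eq_smul_one]) x hx⟩
  obtain ⟨ν, hfin, hν, hf⟩ := exists_spectral_measure hB hab hs (P (X e))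
  refine ⟨ν, hfin, hν, fun z hz g hg hα => ?_⟩
  set α := ⟪e, g⟫_ℂ with hαdef
  set N : ℂ := (‖e‖ : ℂ) ^ 2 with hN
  have hXg : X g = z • g - e := by rw [← hg]; abel
  have hPg : P g = g - (α / N) • e := hPf g
  -- Apply `P` to z g - X g = e, with g = P g + (α/N) e: the component of `g` along `e` becomes a
  -- multiple of P X e.
  have hres : z • ((N / α) • P g) - B ((N / α) • P g) = P (X e) := by
    have hBg : B (P g) = P (X (P g)) := by
      show P (X (P (P g))) + a • (P g - P (P g)) = _
      rw [hPPf, sub_self, smul_zero, add_zero]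
    have h2 : z • P g - B (P g) = (α / N) • P (X e) := by
      have h3 : P (X (P g)) = z • P g - (α / N) • P (X e) := by
        conv_lhs => rw [hPg]
        rw [map_sub, hXg, map_smul, map_sub, map_sub, map_smul, map_smul, hPe, sub_zero]
      rw [hBg, h3]; abel
    rw [map_smul, smul_comm, ← smul_sub, h2, smul_smul,
      div_mul_div_cancel₀ hα, div_self he2, one_smul]
  rw [inner_resolvent_eq_integral hB hs hν hf hz hres, inner_smul_right, hPi, hPPf, hPg,
    inner_sub_right, inner_smul_right]
  have h4 : ⟪X e, g⟫_ℂ = z * α - N := by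
    rw [← ContinuousLinearMap.adjoint_inner_right, hX.adjoint_eq, hXg, inner_sub_right,
      inner_smul_right, inner_self_eq_norm_sq_to_K]
    rfl
  have h5 : ⟪X e, e⟫_ℂ = ((⟪e, X e⟫_ℂ).re : ℂ) := by
    rw [ofReal_re_inner_of_isSelfAdjoint hX, ← ContinuousLinearMap.adjoint_inner_right,
      hX.adjoint_eq]
  rw [h4, h5]
  field_simp

end compression

/-- For `X` = multiplication by x on L²(μ) and e = 1, the Cauchy transform of `μ` is α = ⟨e, (z -
X)⁻¹ e⟩. With M = ‖e‖², the compression formula reads ν̂ = M z - M²/α - ⟨e, X e⟩; solving for 1/α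
gives the constants and the scaling of the measure by M⁻². -/
lemma exists_inverse_measure {μ : Measure ℝ} [IsFiniteMeasure μ] (hμ0 : μ ≠ 0) {a b : ℝ}
    (hab : a ≤ b) (hμ : ∀ᵐ x ∂μ, x ∈ Icc a b) :
    ∃ ν : Measure ℝ, IsFiniteMeasure ν ∧ (∀ᵐ x ∂ν, x ∈ Icc a b) ∧ ∃ c₀ c₁ : ℝ, c₁ ≠ 0 ∧
      ∀ z : ℂ, (∀ x ∈ Icc a b, z ≠ (x : ℂ)) → ∫ x, (z - (x : ℂ))⁻¹ ∂μ ≠ 0 →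
        (∫ x, (z - (x : ℂ))⁻¹ ∂μ)⁻¹ = c₁ * z + c₀ - ∫ x, (z - (x : ℂ))⁻¹ ∂ν := by
  let e : Lp ℂ 2 μ := (memLp_const (1 : ℂ)).toLp _
  have hec : e =ᵐ[μ] fun _ => (1 : ℂ) := (memLp_const (1 : ℂ)).coeFn_toLp
  have he : e ≠ 0 := by
    intro h
    have h1 := Lp.coeFn_zero ℂ 2 μ
    rw [← h] at h1
    refine hμ0 (ae_eq_bot.1 (Filter.eventually_false_iff_eq_bot.1 ?_))
    filter_upwards [h1, hec] with x h2 h3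
    rw [h2] at h3
    simp at h3
  obtain ⟨h1, h2⟩ := mulCoord_sub_nonneg hab hμ
  obtain ⟨ν, hfin, hν, hF⟩ := exists_measure_of_resolvent hab h1 h2 he
  set M : ℝ := ‖e‖ ^ 2
  have hM : M ≠ 0 := by positivity
  refine ⟨(ENNReal.ofReal (M ^ 2)⁻¹) • ν, Measure.smul_finite _ ENNReal.ofReal_ne_top, Measure.ae_smul_measure hν _,
    -(inner ℂ e (mulCoord μ hab e)).re / M ^ 2, M⁻¹, inv_ne_zero hM, fun z hz hne => ?_⟩
  have hcont : ContinuousOn (fun x : ℝ => (z - (x : ℂ))⁻¹) (Icc a b) :=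
    ContinuousOn.inv₀ (by fun_prop) fun x hx => sub_ne_zero.2 (hz x hx)
  have hmeas : AEStronglyMeasurable (fun x : ℝ => (z - (x : ℂ))⁻¹) μ := by
    have := hcont.aestronglyMeasurable (μ := μ) measurableSet_Icc
    rwa [Measure.restrict_eq_self_of_ae_mem hμ] at this
  obtain ⟨C, hC⟩ := isCompact_Icc.exists_bound_of_continuousOn hcont
  have hmem : MemLp (fun x : ℝ => (z - (x : ℂ))⁻¹) 2 μ :=
    MemLp.of_bound hmeas C (hμ.mono fun x hx => hC x hx)
  let g : Lp ℂ 2 μ := hmem.toLp _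
  have hgc : g =ᵐ[μ] fun x => (z - (x : ℂ))⁻¹ := hmem.coeFn_toLp
  have hg : z • g - mulCoord μ hab g = e := by
    apply Lp.ext
    filter_upwards [Lp.coeFn_sub (z • g) (mulCoord μ hab g), Lp.coeFn_smul z g, hgc, hec,
      coeFn_mulCoord hab hμ g, hμ] with x h1 h2 h3 h4 h5 h6
    rw [h1, Pi.sub_apply, h2, h5, Pi.smul_apply, h3, h4, smul_eq_mul, ← sub_mul]
    exact mul_inv_cancel₀ (sub_ne_zero.2 (hz x h6))
  have hin : inner ℂ e g = ∫ x, (z - (x : ℂ))⁻¹ ∂μ := by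
    rw [L2.inner_def]
    refine integral_congr_ae ?_
    filter_upwards [hgc, hec] with x h1 h2
    simp [h1, h2]
  have h3 := hF z hz g hg (by rwa [hin])
  rw [hin] at h3
  rw [integral_smul_measure, h3, ENNReal.toReal_ofReal (by positivity)]
  have hMc : (M : ℂ) ≠ 0 := by exact_mod_cast hM
  have e1 : (‖e‖ : ℂ) ^ 2 = (M : ℂ) := by simp [M]
  rw [e1, Complex.real_smul]
  push_cast
  field_simp
  ring

/-! ### Cauchy transforms off a compact set. -/

/-- The complement of `K ⊆ ℝ` in the complex plane. -/
def off (K : Set ℝ) : Set ℂ := {z | ∀ x ∈ K, z ≠ (x : ℂ)}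

lemma off_anti {K L : Set ℝ} (h : K ⊆ L) : off L ⊆ off K := fun _ hz x hx => hz x (h hx)

lemma isOpen_off {K : Set ℝ} (hK : IsCompact K) : IsOpen (off K) := by
  have : off K = (Complex.ofReal '' K)ᶜ := by
    ext z
    simp only [off, mem_ofPred_eq, mem_compl_iff, mem_image, not_exists, not_and]
    exact forall₂_congr fun x _ => ⟨fun h h' => h h'.symm, fun h h' => h h'.symm⟩
  rw [this]
  exact (hK.image Complex.continuous_ofReal).isClosed.isOpen_compl

lemma mem_off_of_im_ne_zero {K : Set ℝ} {z : ℂ} (hz : z.im ≠ 0) : z ∈ off K := by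
  rintro x - rfl; simp at hz

lemma ofReal_mem_off {K : Set ℝ} {x : ℝ} : (x : ℂ) ∈ off K ↔ x ∉ K :=
  ⟨fun h hx => h x hx rfl, fun h y hy e => h (by rwa [Complex.ofReal_injective e])⟩

lemma sub_ne_zero_of_mem_off {K : Set ℝ} {z : ℂ} (hz : z ∈ off K) {x : ℝ} (hx : x ∈ K) :
    z - x ≠ 0 := sub_ne_zero.2 (hz x hx)

/-- The Cauchy transform of `g ds`. -/
def transform (s : SignedMeasure ℝ) (g : ℝ → ℂ) (z : ℂ) : ℂ :=
  ∫ᵛ x, g x / (z - (x : ℂ)) ∂<•s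

lemma cauchy_eq_transform (s : SignedMeasure ℝ) : cauchy s = transform s fun _ => 1 := by
  ext z; simp [cauchy, transform]

namespace Carried

variable {s t : SignedMeasure ℝ} {K L : Set ℝ} {f g : ℝ → ℂ} {z : ℂ}

lemma cauchy_ofReal (h : Carried s K) (x : ℝ) : cauchy s x = cauchyReal s x := by
  rw [cauchyReal, ← h.integral_ofReal, cauchy]
  push_cast; rfl

lemma integral_add (h : Carried s K) (hK : IsCompact K) (hf : ContinuousOn f K)
    (hg : ContinuousOn g K) :
    ∫ᵛ x, (f x + g x) ∂<•s = ∫ᵛ x, f x ∂<•s + ∫ᵛ x, g x ∂<•s :=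
  VectorMeasure.integral_fun_add (h.integrable hK hf) (h.integrable hK hg)

lemma integral_sub (h : Carried s K) (hK : IsCompact K) (hf : ContinuousOn f K)
    (hg : ContinuousOn g K) :
    ∫ᵛ x, (f x - g x) ∂<•s = ∫ᵛ x, f x ∂<•s - ∫ᵛ x, g x ∂<•s :=
  VectorMeasure.integral_fun_sub (h.integrable hK hf) (h.integrable hK hg)

lemma integral_sum (h : Carried s K) (hK : IsCompact K) {ι : Type*} (I : Finset ι)
    {f : ι → ℝ → ℂ} (hf : ∀ i ∈ I, ContinuousOn (f i) K) :
    ∫ᵛ x, (∑ i ∈ I, f i x) ∂<•s = ∑ i ∈ I, ∫ᵛ x, f i x ∂<•s :=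
  VectorMeasure.integral_finsetSum I fun i hi => h.integrable hK (hf i hi)

lemma integral_ne_zero (h : Carried s K) (hK : IsCompact K) (hne : (supp s).Nonempty)
    {f : ℝ → ℝ} (hf : SignedOn f K) : ∫ᵛ x, (f x : ℂ) ∂<•s ≠ 0 := by
  intro h0
  obtain ⟨x, hx⟩ := hne
  rcases hf.sign with h1 | h1
  · exact (h1 x (h.2 hx)).ne' (h.eq_zero_of_integral_eq_zero hK hf.cont
      (fun y hy => (h1 y (h.2 hy)).le) h0 x hx)
  · have h2 := h.eq_zero_of_integral_eq_zero hK hf.cont.neg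
      (fun y hy => by simpa using (h1 y (h.2 hy)).le) (by
        have := h.integral_const_mul (-1) fun x => (f x : ℂ)
        rw [h0] at this
        simpa using this) x hx
    simp at h2
    exact (h1 x (h.2 hx)).ne h2

end Carried

lemma SignedOn.of_ne_zero {g : ℝ → ℝ} {K : Set ℝ} (hg : ContinuousOn g K) (hK : IsPreconnected K)
    (h : ∀ x ∈ K, g x ≠ 0) : SignedOn g K := by
  refine ⟨hg, ?_⟩
  by_contra hcon
  push Not at hcon
  obtain ⟨⟨x, hx, hx'⟩, ⟨y, hy, hy'⟩⟩ := hcon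
  obtain ⟨w, hw, hw0⟩ := hK.intermediate_value hx hy hg ⟨hx', hy'⟩
  exact h w hw hw0

namespace Carried

variable {s t : SignedMeasure ℝ} {K L : Set ℝ} {f g : ℝ → ℂ} {z : ℂ}

lemma continuousOn_div (hz : z ∈ off K) (hg : ContinuousOn g K) :
    ContinuousOn (fun x : ℝ => g x / (z - x)) K :=
  hg.div (by fun_prop) fun _ hx => sub_ne_zero_of_mem_off hz hx

lemma differentiableOn_transform (h : Carried s K) (hK : IsCompact K) (hg : ContinuousOn g K) :
    DifferentiableOn ℂ (transform s g) (off K) := by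
  obtain ⟨ε, hε, hs⟩ := h.1.exists_integral_eq (E := ℂ)
  obtain ⟨-, -, hfin, -⟩ := h.1.exists_eq_smul
  intro z hz
  obtain ⟨r, hr, hball⟩ := Metric.isOpen_iff.1 (isOpen_off hK) z hz
  obtain ⟨C, hC⟩ := hK.exists_bound_of_continuousOn hg
  have hdist : ∀ w ∈ Metric.ball z (r / 2), ∀ x ∈ K, r / 2 ≤ ‖w - x‖ := by
    intro w hw x hx
    by_contra hlt
    push Not at hlt
    have h1 : dist (x : ℂ) z < r := by
      have h2 := dist_triangle (x : ℂ) w z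
      rw [Metric.mem_ball] at hw
      rw [dist_comm (x : ℂ) w, dist_eq_norm w (x : ℂ)] at h2
      linarith
    exact hball h1 x hx rfl
  have hsub : Metric.ball z (r / 2) ⊆ off K := fun w hw => hball (Metric.ball_subset_ball (by linarith) hw)
  have key := hasDerivAt_integral_of_dominated_loc_of_deriv_le (𝕜 := ℂ) (μ := s.variation)
    (F := fun w (x : ℝ) => g x / (w - x)) (F' := fun w (x : ℝ) => -g x / (w - x) ^ 2) (x₀ := z)
    (bound := fun _ => C / (r / 2) ^ 2) (s := Metric.ball z (r / 2))
    (Metric.ball_mem_nhds z (half_pos hr))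
    (by
      filter_upwards [Metric.ball_mem_nhds z (half_pos hr)] with w hw
      exact (h.integrable hK (continuousOn_div (hsub hw) hg)).aestronglyMeasurable)
    (h.integrable hK (continuousOn_div hz hg))
    (by
      refine (h.integrable hK (f := fun x : ℝ => -g x / (z - x) ^ 2) ?_).aestronglyMeasurable
      exact hg.neg.div (by fun_prop) fun x hx => pow_ne_zero _ (sub_ne_zero_of_mem_off hz hx))
    (by
      filter_upwards [h.ae_mem] with x hx w hw
      rw [norm_div, norm_neg, norm_pow]
      have := hdist w hw x hx
      have hC0 : 0 ≤ C := (norm_nonneg _).trans (hC x hx)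
      gcongr
      exact hC x hx)
    (integrable_const _)
    (by
      filter_upwards [h.ae_mem] with x hx w hw
      have hne := sub_ne_zero_of_mem_off (hsub hw) hx
      have h1 := ((hasDerivAt_id w).sub_const (x : ℂ)).inv hne |>.const_mul (g x)
      simp only [id, div_eq_mul_inv] at h1 ⊢
      exact h1.congr_deriv (by ring))
  have h2 : transform s g = fun w => ε • ∫ x, g x / (w - (x : ℂ)) ∂s.variation := by
    ext w; exact hs _
  rw [h2]
  exact (key.2.differentiableAt.const_smul ε).differentiableWithinAt

lemma analyticAt_transform (h : Carried s K) (hK : IsCompact K) (hg : ContinuousOn g K)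
    (hz : z ∈ off K) : AnalyticAt ℂ (transform s g) z :=
  (h.differentiableOn_transform hK hg).analyticAt ((isOpen_off hK).mem_nhds hz)

lemma continuousOn_transform_real (h : Carried s K) (hK : IsCompact K) (hg : ContinuousOn g K)
    (hKL : Disjoint K L) : ContinuousOn (fun x : ℝ => transform s g x) L :=
  (h.differentiableOn_transform hK hg).continuousOn.comp Complex.continuous_ofReal.continuousOn
    fun _ hx => ofReal_mem_off.2 fun hx' => hKL.le_bot ⟨hx', hx⟩

lemma continuousOn_cauchy (h : Carried s K) (hK : IsCompact K) :
    ContinuousOn (cauchy s) (off K) := by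
  rw [cauchy_eq_transform]
  exact (h.differentiableOn_transform hK continuousOn_const).continuousOn

lemma continuousOn_cauchyReal (h : Carried s K) (hK : IsCompact K) (hKL : Disjoint K L) :
    ContinuousOn (cauchyReal s) L := by
  have h1 : ContinuousOn (fun x : ℝ => cauchy s x) L := by
    rw [cauchy_eq_transform]
    exact h.continuousOn_transform_real hK continuousOn_const hKL
  have h2 : cauchyReal s = fun x : ℝ => (cauchy s x).re := by
    ext x; rw [h.cauchy_ofReal]; simp
  rw [h2]
  exact Complex.continuous_re.comp_continuousOn h1

/-- Partial fractions: (z - y)/((x - y)(z - x)) = 1/(z - x) - 1/(y - x). When `y` is a zero of the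
transform, dividing `g` by x - y thus divides the transform by z - y. -/
lemma transform_div_mul (h : Carried s K) (hK : IsCompact K) (hg : ContinuousOn g K) {y : ℂ}
    (hy : y ∈ off K) (hz : z ∈ off K) :
    transform s (fun x => g x / (x - y)) z * (z - y) = transform s g z - transform s g y := by
  rw [transform, transform, transform, ← h.integral_mul_const,
    ← h.integral_sub hK (continuousOn_div hz hg) (continuousOn_div hy hg)]
  refine h.integral_congr fun x hx => ?_
  have h1 := sub_ne_zero_of_mem_off hz hx
  have h2 := sub_ne_zero_of_mem_off hy hx
  have h3 : (x : ℂ) - y ≠ 0 := by rw [← neg_sub]; exact neg_ne_zero.2 h2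
  field_simp
  ring

lemma transform_conj (h : Carried s K) (hg : ∀ x, starRingEnd ℂ (g x) = g x) :
    transform s g (starRingEnd ℂ z) = starRingEnd ℂ (transform s g z) := by
  rw [transform, transform, ← h.integral_conj]
  refine h.integral_congr fun x _ => ?_
  rw [map_div₀, map_sub, Complex.conj_ofReal, hg]

lemma mul_transform (h : Carried s K) (hK : IsCompact K) (hg : ContinuousOn g K) (hz : z ∈ off K) :
    z * transform s g z = ∫ᵛ x, g x ∂<•s + transform s (fun x => x * g x) z := by
  rw [transform, transform, ← h.integral_const_mul,
    ← h.integral_add hK hg (continuousOn_div hz (by fun_prop))]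
  refine h.integral_congr fun x hx => ?_
  have h1 := sub_ne_zero_of_mem_off hz hx
  field_simp
  ring

/-- For real `z` off the interval the kernel (z - t)⁻¹ has one sign on `K`; for nonreal `z` its
imaginary part, -Im z |z - t|⁻², does. The integral of such a function against a nonzero measure of
constant sign is not zero. -/
lemma cauchy_ne_zero (h : Carried s K) (hK : IsCompact K) (hKc : Convex ℝ K)
    (hne : (supp s).Nonempty) (hz : z ∈ off K) : cauchy s z ≠ 0 := by
  by_cases him : z.im = 0
  · obtain ⟨x, rfl⟩ : ∃ x : ℝ, z = x := ⟨z.re, Complex.ext rfl (by simp [him])⟩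
    have hx := ofReal_mem_off.1 hz
    have h1 : ∀ t ∈ K, x - t ≠ 0 := fun t ht h0 => hx (by rwa [sub_eq_zero.1 h0])
    have h2 : SignedOn (fun t => (x - t)⁻¹) K :=
      SignedOn.of_ne_zero (ContinuousOn.inv₀ (by fun_prop) h1) hKc.isPreconnected
        fun t ht => inv_ne_zero (h1 t ht)
    have := h.integral_ne_zero hK hne h2
    simpa [cauchy] using this
  · intro h0
    have h1 : ∀ t : ℝ, Complex.normSq (z - t) ≠ 0 := fun t h => by
      have := Complex.normSq_eq_zero.1 h
      apply him
      have := congrArg Complex.im this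
      simpa using this
    have hc : Continuous fun t : ℝ => Complex.normSq (z - t) :=
      Complex.continuous_normSq.comp (by fun_prop)
    have h2 : SignedOn (fun t : ℝ => (Complex.normSq (z - t))⁻¹) K :=
      ⟨hc.continuousOn.inv₀ fun t _ => h1 t,
        Or.inl fun t _ => inv_pos.2 ((Complex.normSq_nonneg _).lt_of_ne (h1 t).symm)⟩
    refine h.integral_ne_zero hK hne h2 ?_
    have h3 : ∫ᵛ t : ℝ, (((Complex.normSq (z - t))⁻¹ : ℝ) : ℂ) ∂<•s =
        (starRingEnd ℂ (cauchy s z) - cauchy s z) * (2 * z.im * Complex.I)⁻¹ := by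
      have hcont : ContinuousOn (fun x : ℝ => (z - x)⁻¹) K :=
        ContinuousOn.inv₀ (by fun_prop) fun x hx => sub_ne_zero_of_mem_off hz hx
      have hcont' : ContinuousOn (fun x : ℝ => starRingEnd ℂ (z - x)⁻¹) K :=
        Complex.continuous_conj.comp_continuousOn hcont
      rw [cauchy, ← h.integral_conj, ← h.integral_sub hK hcont' hcont, ← h.integral_mul_const]
      refine h.integral_congr fun t _ => ?_
      have e1 : (2 * z.im * Complex.I : ℂ) = z - starRingEnd ℂ z := (Complex.sub_conj z).symm ▸ by push_cast; ring
      have e2 : z - t ≠ 0 := fun h => h1 t (by rw [h]; simp)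
      have e3 : starRingEnd ℂ z - t ≠ 0 := fun h => e2 (by
        have := congrArg (starRingEnd ℂ) h
        simpa using this)
      have e4 : z - starRingEnd ℂ z ≠ 0 := by
        rw [← e1]; simpa using him
      rw [e1, Complex.ofReal_inv, ← Complex.mul_conj, map_inv₀, map_sub, Complex.conj_ofReal]
      field_simp
      ring
    rw [h3, h0]; simp

lemma signedOn_cauchyReal (h : Carried s K) (hK : IsCompact K) (hKc : Convex ℝ K)
    (hne : (supp s).Nonempty) (hLc : Convex ℝ L) (hKL : Disjoint K L) :
    SignedOn (cauchyReal s) L :=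
  SignedOn.of_ne_zero (h.continuousOn_cauchyReal hK hKL) hLc.isPreconnected fun x hx h0 =>
    h.cauchy_ne_zero hK hKc hne (ofReal_mem_off.2 fun hx' => hKL.le_bot ⟨hx', hx⟩)
      (by rw [h.cauchy_ofReal, h0]; simp)

end Carried

/-! ### Decay at infinity, moments and polynomial multiples. -/

namespace Carried

variable {s t : SignedMeasure ℝ} {K L : Set ℝ} {f g : ℝ → ℂ} {z : ℂ}

/-- Decay along z = (n + 1)i is all that is needed: these points are off every real set, at distance
at least n + 1 from it. -/
lemma tendsto_transform (h : Carried s K) (hK : IsCompact K) (hg : ContinuousOn g K) :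
    Filter.Tendsto (fun n : ℕ => transform s g (((n + 1 : ℕ) : ℂ) * Complex.I)) Filter.atTop
      (nhds 0) := by
  obtain ⟨ε, hε, hs⟩ := h.1.exists_integral_eq (E := ℂ)
  obtain ⟨-, -, hfin, -⟩ := h.1.exists_eq_smul
  obtain ⟨C, hC⟩ := hK.exists_bound_of_continuousOn hg
  have hb : ∀ n : ℕ, ‖transform s g (((n + 1 : ℕ) : ℂ) * Complex.I)‖ ≤
      (C * s.variation.real univ) * (1 / ((n : ℝ) + 1)) := by
    intro n
    rw [transform, hs, norm_smul]
    have h1 : ‖ε‖ = 1 := by rcases hε with rfl | rfl <;> simp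
    rw [h1, one_mul]
    have := norm_integral_le_of_norm_le_const (μ := s.variation) (C := C * (1 / ((n : ℝ) + 1)))
      (f := fun x : ℝ => g x / ((((n + 1 : ℕ) : ℂ) * Complex.I) - x)) (by
        filter_upwards [h.ae_mem] with x hx
        rw [norm_div, div_eq_mul_one_div]
        have hC0 : 0 ≤ C := (norm_nonneg _).trans (hC x hx)
        have h2 : (n : ℝ) + 1 ≤ ‖(((n + 1 : ℕ) : ℂ) * Complex.I) - x‖ := by
          refine le_trans ?_ (Complex.abs_im_le_norm _)
          simp
          exact le_abs_self _
        have h3 : (0 : ℝ) < (n : ℝ) + 1 := by positivity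
        gcongr
        exact hC x hx)
    calc _ ≤ _ := this
      _ = _ := by ring
  refine squeeze_zero_norm hb ?_
  simpa using tendsto_one_div_add_atTop_nhds_zero_nat.const_mul (C * s.variation.real univ)

lemma transform_eq_zero_of_eq_polynomial (h : Carried s K) (hK : IsCompact K)
    (hg : ContinuousOn g K) {R : ℂ[X]} (hR : ∀ z ∈ off K, transform s g z = R.eval z) :
    ∀ z ∈ off K, transform s g z = 0 := by
  have h1 : Filter.Tendsto (fun n : ℕ => R.eval (((n + 1 : ℕ) : ℂ) * Complex.I)) Filter.atTop
      (nhds 0) := by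
    refine (h.tendsto_transform hK hg).congr fun n => hR _ (mem_off_of_im_ne_zero ?_)
    simp
    exact_mod_cast Nat.succ_ne_zero n
  have h2 : R = 0 := by
    by_contra hR0
    have hdeg : ¬ 0 < R.degree := by
      intro hpos
      have h3 := R.tendsto_norm_atTop hpos
        (z := fun n : ℕ => ((n + 1 : ℕ) : ℂ) * Complex.I) (l := Filter.atTop) (by
          have : (fun n : ℕ => ‖((n + 1 : ℕ) : ℂ) * Complex.I‖) = fun n : ℕ => ((n + 1 : ℕ) : ℝ) := by
            ext n
            rw [norm_mul, Complex.norm_I, mul_one, Complex.norm_natCast]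
          rw [this]
          exact tendsto_natCast_atTop_atTop.comp (Filter.tendsto_add_atTop_nat 1))
      have h4 := h1.norm
      exact not_tendsto_nhds_of_tendsto_atTop h3 _ h4
    rw [Polynomial.eq_C_of_degree_le_zero (not_lt.1 hdeg)] at h1 hR0
    simp only [Polynomial.eval_C] at h1
    have := tendsto_nhds_unique h1 tendsto_const_nhds
    simp at hR0
    exact hR0 this.symm
  intro z hz
  rw [hR z hz, h2, Polynomial.eval_zero]

/-- By z T(g) = ∫ g ds + T(x g), a vanishing transform T(g) makes T(x g) constant, hence zero by
decay. So ∫ g ds = 0, and the argument repeats with x g. -/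
lemma integral_mul_pow_eq_zero (h : Carried s K) (hK : IsCompact K)
    (h0 : ∀ z ∈ off K, transform s g z = 0) (hg : ContinuousOn g K) (k : ℕ) :
    ∫ᵛ x, (x : ℂ) ^ k * g x ∂<•s = 0 := by
  induction k generalizing g with
  | zero =>
    have h1 : ∀ z ∈ off K, transform s (fun x => x * g x) z =
        (Polynomial.C (-∫ᵛ x, g x ∂<•s)).eval z := by
      intro z hz
      have := h.mul_transform hK hg hz
      rw [h0 z hz] at this
      rw [Polynomial.eval_C]
      linear_combination -this
    have h2 := h.transform_eq_zero_of_eq_polynomial hK (by fun_prop) h1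
    have hI : Complex.I ∈ off K := mem_off_of_im_ne_zero (by simp)
    have h3 := h1 _ hI
    rw [h2 _ hI, Polynomial.eval_C] at h3
    simpa using h3.symm
  | succ k ih =>
    have h1 : ∀ z ∈ off K, transform s (fun x => x * g x) z =
        (Polynomial.C (-∫ᵛ x, g x ∂<•s)).eval z := by
      intro z hz
      have := h.mul_transform hK hg hz
      rw [h0 z hz] at this
      rw [Polynomial.eval_C]
      linear_combination -this
    have h2 := h.transform_eq_zero_of_eq_polynomial hK (by fun_prop) h1
    rw [← ih h2 (by fun_prop)]
    refine h.integral_congr fun x _ => by ring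

/-- The quotient (q(z) - q(x))/(z - x) is a polynomial in z and x, and integrating it in x gives
`q₁`. -/
lemma exists_polynomial_mul_cauchy (h : Carried s K) (hK : IsCompact K) (q : ℝ[X]) :
    ∃ q₁ : ℝ[X], ∀ z ∈ off K, Polynomial.aeval z q * cauchy s z =
      Polynomial.aeval z q₁ + transform s (fun x => ((q.eval x : ℝ) : ℂ)) z := by
  induction q using Polynomial.induction_on with
  | C a =>
    refine ⟨0, fun z hz => ?_⟩
    rw [cauchy, transform]
    simp only [Polynomial.aeval_C, Polynomial.eval_C, map_zero, zero_add, div_eq_mul_inv]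
    rw [h.integral_const_mul]; rfl
  | add p q hp hq =>
    obtain ⟨p₁, hp⟩ := hp
    obtain ⟨q₁, hq⟩ := hq
    refine ⟨p₁ + q₁, fun z hz => ?_⟩
    have h1 : transform s (fun x => (((p + q).eval x : ℝ) : ℂ)) z =
        transform s (fun x => ((p.eval x : ℝ) : ℂ)) z + transform s (fun x => ((q.eval x : ℝ) : ℂ)) z := by
      rw [transform, transform, transform, ← h.integral_add hK]
      · refine h.integral_congr fun x _ => ?_
        rw [Polynomial.eval_add]; push_cast; ring
      · exact continuousOn_div hz (Complex.continuous_ofReal.comp p.continuous).continuousOn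
      · exact continuousOn_div hz (Complex.continuous_ofReal.comp q.continuous).continuousOn
    rw [h1, map_add, map_add, add_mul, hp z hz, hq z hz]
    ring
  | monomial n a ih =>
    obtain ⟨p₁, hp⟩ := ih
    set p : ℝ[X] := Polynomial.C a * Polynomial.X ^ n with hpdef
    refine ⟨Polynomial.X * p₁ + Polynomial.C (∫ᵛ x, p.eval x ∂<•s), fun z hz => ?_⟩
    have h1 : Polynomial.C a * Polynomial.X ^ (n + 1) = Polynomial.X * p := by rw [hpdef]; ring
    have h2 := h.mul_transform hK (g := fun x => ((p.eval x : ℝ) : ℂ))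
      (Complex.continuous_ofReal.comp p.continuous).continuousOn hz
    have h3 : transform s (fun x => (((Polynomial.X * p).eval x : ℝ) : ℂ)) z =
        transform s (fun x => x * ((p.eval x : ℝ) : ℂ)) z := by
      congr 1; ext x; simp
    have h4 := hp z hz
    clear_value p
    rw [h.integral_ofReal] at h2
    rw [h1, h3, map_mul, map_add, map_mul, Polynomial.aeval_X, Polynomial.aeval_C,
      Complex.coe_algebraMap]
    linear_combination h2 + z * h4

end Carried

/-! ### The inverse measure: existence and infinite support. -/

variable {s t : SignedMeasure ℝ} {K L : Set ℝ}

lemma Tame.nonempty (h : Tame s K) : (supp s).Nonempty := h.infinite.nonempty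

lemma convexHull_eq_Icc {S : Set ℝ} (hS : IsCompact S) (hne : S.Nonempty) :
    convexHull ℝ S = Icc (sInf S) (sSup S) := by
  apply Subset.antisymm
  · exact convexHull_min (fun x hx => ⟨csInf_le hS.bddBelow hx, le_csSup hS.bddAbove hx⟩)
      (convex_Icc _ _)
  · exact (convex_convexHull ℝ S).ordConnected.out
      (subset_convexHull ℝ S (hS.sInf_mem hne)) (subset_convexHull ℝ S (hS.sSup_mem hne))

lemma isCompact_convexHull {S : Set ℝ} (hS : IsCompact S) : IsCompact (convexHull ℝ S) := by
  rcases S.eq_empty_or_nonempty with rfl | hne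
  · simp
  · rw [convexHull_eq_Icc hS hne]; exact isCompact_Icc

lemma exists_isInverse (h : Tame s K) (hK : IsCompact K) : ∃ τ, IsInverse s τ := by
  have hcl : IsClosed (supp s) := Measure.isClosed_support
  have hc : IsCompact (supp s) := hK.of_isClosed_subset hcl h.supp_subset
  have hhc : IsCompact (hull s) := isCompact_convexHull hc
  have hconv : Convex ℝ (hull s) := convex_convexHull ℝ _
  have hne : (hull s).Nonempty := h.nonempty.convexHull
  have hI := eq_Icc_of_connected_compact ⟨hne, hconv.isPreconnected⟩ hhc
  set a := sInf (hull s)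
  set b := sSup (hull s)
  have hab : a ≤ b := by
    rw [hI] at hne; exact nonempty_Icc.1 hne
  have hs : Carried s (hull s) := ⟨h.sign, subset_convexHull ℝ _⟩
  obtain ⟨ε, hε, hfin, hsε⟩ := h.sign.exists_eq_smul
  have hμ0 : s.variation ≠ 0 := Measure.nonempty_support_iff.1 h.nonempty
  obtain ⟨ν, hν, hνae, c₀, c₁, hc₁, hF⟩ := exists_inverse_measure hμ0 hab
    (by rw [← hI]; exact hs.ae_mem)
  have hcauchy : ∀ z, cauchy s z = ε * ∫ x, (z - (x : ℂ))⁻¹ ∂s.variation := by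
    intro z
    rw [cauchy]
    conv_lhs => rw [hsε]
    rw [VectorMeasure.integral_smul_vectorMeasure, VectorMeasure.integral_toSignedMeasure,
      Complex.real_smul]
  have hε0 : ε ≠ 0 := by rcases hε with rfl | rfl <;> norm_num
  have hsupp : supp ((-ε) • ν.toSignedMeasure) ⊆ Icc a b := by
    have h1 : ((-ε) • ν.toSignedMeasure).variation = ν := by
      rw [VectorMeasure.variation_smul, Measure.variation_toSignedMeasure]
      rcases hε with rfl | rfl <;> simp
    rw [supp, h1]
    exact Measure.support_subset_of_isClosed isClosed_Icc hνae
  -- Since ε⁻¹ = ε, the reciprocal of ŝ is ε times that of the transform of |s|, whose measure part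
  -- is -ν̂; hence the sign -ε.
  refine ⟨(-ε) • ν.toSignedMeasure, ?_, ?_, Polynomial.C (ε * c₁) * Polynomial.X +
    Polynomial.C (ε * c₀), ?_, fun z hz => ?_⟩
  · have h0 : 0 ≤ ν.toSignedMeasure := Measure.zero_le_toSignedMeasure _
    rcases hε with rfl | rfl
    · right; intro i hi; rw [smul_apply]; have := h0 i hi
      simpa only [neg_smul, one_smul, Left.neg_nonpos_iff, FunLike.coe_zero, Pi.zero_apply] using this
    · left; simpa using h0
  · rw [hI]
    exact convexHull_min hsupp (convex_Icc a b)
  · exact Polynomial.degree_linear (mul_ne_zero hε0 hc₁)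
  · have hz' : z ∈ off (hull s) := hz
    have hne0 := hs.cauchy_ne_zero hhc hconv h.nonempty hz'
    rw [hcauchy] at hne0 ⊢
    have h2 := hF z (by rwa [← hI]) (right_ne_zero_of_mul hne0)
    rw [mul_inv, h2, cauchy, VectorMeasure.integral_smul_vectorMeasure,
      VectorMeasure.integral_toSignedMeasure, Complex.real_smul]
    rcases hε with rfl | rfl
    · simp; ring
    · simp; ring

/-- Beyond unfolding the choice, the point is that the inverse measure has infinite support, so that
it can serve in the next system. Were the support finite, ŝ would be rational, which is impossible
for a measure of constant sign with infinite support. -/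
lemma inverse_spec (h : Tame s K) (hK : IsCompact K) (hKc : Convex ℝ K) :
    Tame (inverse s) K ∧ ∃ l₀ l₁ : ℝ, ∀ z ∈ off K,
      (l₁ * z + l₀ + cauchy (inverse s) z) * cauchy s z = 1 := by
  have hex := exists_isInverse h hK
  have hinv : IsInverse s (inverse s) := by
    rw [inverse, dif_pos hex]; exact hex.choose_spec
  obtain ⟨h1, h2, l, hl, hz⟩ := hinv
  have hhK : hull s ⊆ K := convexHull_min h.supp_subset hKc
  have hτ : Carried (inverse s) K := ⟨h1, (subset_convexHull ℝ _).trans (h2.trans hhK)⟩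
  have hspec : ∀ z ∈ off K, (Polynomial.aeval z l + cauchy (inverse s) z) * cauchy s z = 1 := by
    intro z hzK
    rw [← hz z (off_anti hhK hzK), inv_mul_cancel₀ (h.cauchy_ne_zero hK hKc h.nonempty hzK)]
  refine ⟨⟨hτ, fun hfin => ?_⟩, l.coeff 0, l.coeff 1, fun z hzK => ?_⟩
  · let q : ℝ[X] := ∏ x ∈ hfin.toFinset, (Polynomial.X - Polynomial.C x)
    have hq0 : ∀ x ∈ supp (inverse s), q.eval x = 0 := by
      intro x hx
      rw [Polynomial.eval_prod]
      exact Finset.prod_eq_zero (hfin.mem_toFinset.2 hx) (by simp)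
    have hqI : Polynomial.aeval Complex.I q ≠ 0 := by
      rw [map_prod, Finset.prod_ne_zero_iff]
      intro x _ h0
      have := congrArg Complex.im h0
      simp at this
    obtain ⟨q₁, hq₁⟩ := hτ.exists_polynomial_mul_cauchy hK q
    have hT : ∀ z, transform (inverse s) (fun x => ((q.eval x : ℝ) : ℂ)) z = 0 := by
      intro z
      rw [transform]
      refine VectorMeasure.integral_eq_zero_of_ae ?_
      filter_upwards [Carried.ae_mem_supp] with x hx
      simp [hq0 x hx]
    -- Multiplying (l + τ̂) ŝ = 1 by `q`, which vanishes on the support of τ, gives A ŝ = q.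
    let A : ℝ[X] := q * l + q₁
    have hA : ∀ z ∈ off K, Polynomial.aeval z A * cauchy s z = Polynomial.aeval z q := by
      intro z hzK
      have e1 := hq₁ z hzK
      have e2 := hspec z hzK
      rw [hT, add_zero] at e1
      simp only [A, map_add, map_mul]
      linear_combination (-cauchy s z) * e1 + Polynomial.aeval z q * e2
    obtain ⟨A₁, hA₁⟩ := h.exists_polynomial_mul_cauchy hK A
    have hAc : Continuous fun x : ℝ => ((A.eval x : ℝ) : ℂ) := Complex.continuous_ofReal.comp A.continuous
    have hzero := h.transform_eq_zero_of_eq_polynomial hK hAc.continuousOn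
      (R := (q - A₁).map (algebraMap ℝ ℂ)) (fun z hzK => by
        have e1 := hA z hzK
        have e2 := hA₁ z hzK
        rw [Polynomial.eval_map_algebraMap, map_sub]
        linear_combination e1 - e2)
    -- The transform of A ds differs from A ŝ = q by a polynomial, so it vanishes together with all
    -- moments of A ds; in particular `A` is orthogonal to itself.
    have hsq : ∫ᵛ x, ((A.eval x * A.eval x : ℝ) : ℂ) ∂<•s = 0 := by
      have e1 : ∀ x : ℝ, ((A.eval x * A.eval x : ℝ) : ℂ) =
          ∑ i ∈ Finset.range (A.natDegree + 1), (A.coeff i : ℂ) * ((x : ℂ) ^ i * ((A.eval x : ℝ) : ℂ)) := by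
        intro x
        rw [Complex.ofReal_mul]
        conv_lhs => rw [Polynomial.eval_eq_sum_range]
        push_cast
        rw [Finset.sum_mul]
        exact Finset.sum_congr rfl fun i _ => by
          rw [Polynomial.eval_eq_sum_range]; push_cast; ring
      simp_rw [e1]
      rw [h.integral_sum hK _ (fun i _ => by fun_prop)]
      refine Finset.sum_eq_zero fun i _ => ?_
      rw [h.integral_const_mul, h.integral_mul_pow_eq_zero hK hzero hAc.continuousOn, mul_zero]
    have hA0 := h.eq_zero_of_integral_eq_zero hK (f := fun x => A.eval x * A.eval x)
      (by fun_prop) (fun x _ => mul_self_nonneg _) hsq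
    have hAz : A = 0 := Polynomial.eq_zero_of_infinite_isRoot A
      (h.infinite.mono fun x hx => by simpa using hA0 x hx)
    have hI : Complex.I ∈ off K := mem_off_of_im_ne_zero (by simp)
    have := hA _ hI
    rw [hAz] at this
    simp at this
    exact hqI this.symm
  · rw [← hspec z hzK]
    congr 2
    rw [Polynomial.eq_X_add_C_of_degree_le_one hl.le]
    simp

/-! ### Dividing out zeros of a Cauchy transform. -/

/-- `g` is orthogonal to all polynomials of degree less than `N` with respect to `s`. -/
def Orth (s : SignedMeasure ℝ) (g : ℝ → ℂ) (N : ℕ) : Prop :=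
  ∀ ν < N, ∫ᵛ x, g x * (x : ℂ) ^ ν ∂<•s = 0

lemma Orth.mono {s : SignedMeasure ℝ} {g : ℝ → ℂ} {M N : ℕ} (h : Orth s g N) (hMN : M ≤ N) :
    Orth s g M := fun ν hν => h ν (hν.trans_le hMN)

section zeros

lemma analyticAt_multiset_prod (Y : Multiset ℂ) (z : ℂ) :
    AnalyticAt ℂ (fun w => (Y.map fun y => w - y).prod) z := by
  induction Y using Multiset.induction_on with
  | empty => simpa using analyticAt_const
  | cons y Y ih =>
    simp only [Multiset.map_cons, Multiset.prod_cons]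
    exact (analyticAt_id.sub analyticAt_const).mul ih

lemma analyticOrderAt_sub_const (y z : ℂ) :
    analyticOrderAt (fun w => w - y) z = if z = y then 1 else 0 := by
  split_ifs with h
  · subst h; exact analyticOrderAt_id_sub_const_self
  · exact analyticOrderAt_id_sub_const_of_ne h

lemma analyticOrderAt_eq_add {F G : ℂ → ℂ} {U : Set ℂ} (hU : IsOpen U) {y z : ℂ} (hz : z ∈ U)
    (hG : AnalyticAt ℂ G z) (h : ∀ w ∈ U, F w = G w * (w - y)) :
    analyticOrderAt F z = analyticOrderAt G z + if z = y then 1 else 0 := by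
  have h1 : F =ᶠ[nhds z] G * fun w => w - y := by
    filter_upwards [hU.mem_nhds hz] with w hw using h w hw
  rw [analyticOrderAt_congr h1, analyticOrderAt_mul hG (by fun_prop), analyticOrderAt_sub_const]

lemma Multiset.count_cons_le_add {Y : Multiset ℂ} {y z : ℂ} {n : ℕ∞}
    (h : ((y ::ₘ Y).count z : ℕ∞) ≤ n + if z = y then 1 else 0) : (Y.count z : ℕ∞) ≤ n := by
  rw [Multiset.count_cons] at h
  push_cast at h
  split_ifs at h with h1
  · exact (ENat.add_le_add_iff_right (by simp)).1 h
  · simpa using h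

end zeros

namespace Carried

variable {s t : SignedMeasure ℝ} {K L : Set ℝ} {f g : ℝ → ℂ} {z : ℂ}

lemma integral_mul_polynomial_eq_zero (h : Carried s K) (hK : IsCompact K)
    (hg : ContinuousOn g K) {N : ℕ} (ho : Orth s g N) {q : ℂ[X]} (hq : q.natDegree < N) :
    ∫ᵛ x, g x * q.eval (x : ℂ) ∂<•s = 0 := by
  simp_rw [Polynomial.eval_eq_sum_range, Finset.mul_sum]
  rw [h.integral_sum hK _ fun i _ => by fun_prop]
  refine Finset.sum_eq_zero fun i hi => ?_
  have h1 : ∀ x : ℝ, g x * (q.coeff i * (x : ℂ) ^ i) = q.coeff i * (g x * (x : ℂ) ^ i) :=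
    fun x => by ring
  simp_rw [h1]
  rw [h.integral_const_mul, ho i ((Nat.lt_succ_iff.1 (Finset.mem_range.1 hi)).trans_lt hq), mul_zero]

lemma continuousOn_div_sub {y : ℂ} (hy : y ∈ off K) (hg : ContinuousOn g K) :
    ContinuousOn (fun x : ℝ => g x / (x - y)) K :=
  hg.div (by fun_prop) fun x hx h => hy x hx (sub_eq_zero.1 h).symm

/-- The relation of degree 0 for g/(x - y) is, up to sign, the vanishing of the transform at `y`.
The identity x/(x - y) = 1 + y/(x - y) then lifts each relation for `g` by one degree. -/
lemma orth_div_sub (h : Carried s K) (hK : IsCompact K) (hg : ContinuousOn g K) {N : ℕ}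
    (ho : Orth s g N) {y : ℂ} (hy : y ∈ off K) (h0 : transform s g y = 0) :
    Orth s (fun x => g x / (x - y)) (N + 1) := by
  have hc := continuousOn_div_sub hy hg
  intro ν
  induction ν with
  | zero =>
    intro _
    have h1 : ∀ x ∈ K, g x / (x - y) * (x : ℂ) ^ 0 = (-1) * (g x / (y - x)) := fun x hx => by
      have h2 := sub_ne_zero_of_mem_off hy hx
      have h3 : (x : ℂ) - y ≠ 0 := by rw [← neg_sub]; exact neg_ne_zero.2 h2
      field_simp
      ring
    rw [h.integral_congr h1, h.integral_const_mul]
    change _ * transform s g y = 0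
    rw [h0, mul_zero]
  | succ ν ih =>
    intro hν
    have h1 : ∀ x ∈ K, g x / (x - y) * (x : ℂ) ^ (ν + 1) =
        g x * (x : ℂ) ^ ν + y * (g x / (x - y) * (x : ℂ) ^ ν) := fun x hx => by
      have h2 := sub_ne_zero_of_mem_off hy hx
      have h3 : (x : ℂ) - y ≠ 0 := by rw [← neg_sub]; exact neg_ne_zero.2 h2
      field_simp
      ring
    have hc1 : ContinuousOn (fun x : ℝ => g x * (x : ℂ) ^ ν) K := by fun_prop
    have hc2 : ContinuousOn (fun x : ℝ => y * (g x / (x - y) * (x : ℂ) ^ ν)) K :=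
      continuousOn_const.mul (hc.mul (by fun_prop))
    rw [h.integral_congr h1, h.integral_add hK hc1 hc2, h.integral_const_mul, ho ν (by omega),
      ih (by omega)]
    simp

/-- Zeros of the Cauchy transform of `g ds` off `K` can be divided out, and each of them yields
an additional orthogonality relation. -/
lemma orth_div_prod (h : Carried s K) (hK : IsCompact K) (hg : ContinuousOn g K) {N : ℕ}
    (ho : Orth s g N) (Y : Multiset ℂ) (hY : ∀ y ∈ Y, y ∈ off K)
    (hcount : ∀ z ∈ off K, (Y.count z : ℕ∞) ≤ analyticOrderAt (transform s g) z) :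
    Orth s (fun x => g x / (Y.map fun y => (x : ℂ) - y).prod) (N + Y.card) := by
  induction Y using Multiset.induction_on generalizing g N with
  | empty => simpa using ho
  | cons y Y ih =>
    have hy : y ∈ off K := hY y (Multiset.mem_cons_self _ _)
    have h0 : transform s g y = 0 := by
      have h1 := hcount y hy
      rw [Multiset.count_cons_self] at h1
      refine (analyticOrderAt_ne_zero.1 fun h2 => ?_).2
      rw [h2] at h1
      simp at h1
    have hc := continuousOn_div_sub hy hg
    have h1 := ih (g := fun x => g x / (x - y)) hc (h.orth_div_sub hK hg ho hy h0)
      (fun w hw => hY w (Multiset.mem_cons_of_mem hw)) (fun z hz => by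
        refine Multiset.count_cons_le_add (y := y) ((hcount z hz).trans_eq ?_)
        refine analyticOrderAt_eq_add (isOpen_off hK) hz (h.analyticAt_transform hK hc hz)
          fun w hw => ?_
        rw [h.transform_div_mul hK hg hy hw, h0, sub_zero])
    rw [Multiset.card_cons, add_comm Y.card, ← add_assoc]
    simpa only [Multiset.map_cons, Multiset.prod_cons, div_div] using h1

end Carried

/-! ### Sign changes of real analytic functions and zeros of odd order. -/

lemma nonneg_or_nonpos_of_even_order {F : ℂ → ℂ} {J : Set ℝ} (hJ : IsPreconnected J)
    (hJo : IsOpen J) (han : ∀ x ∈ J, AnalyticAt ℂ F x) (hre : ∀ x ∈ J, (F x).im = 0)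
    (heven : ∀ x ∈ J, ∃ m : ℕ, analyticOrderAt F x = (2 * m : ℕ)) :
    (∀ x ∈ J, 0 ≤ (F x).re) ∨ ∀ x ∈ J, (F x).re ≤ 0 := by
  -- Locally F(y) = (y - x)^{2m} g(y) with g(x) real and nonzero, so `F` has one strict sign on a
  -- punctured neighbourhood; connectedness of `J` makes the sign global.
  have key : ∀ x ∈ J, (∀ᶠ y : ℝ in nhdsWithin x {x}ᶜ, 0 < (F y).re) ∨
      ∀ᶠ y : ℝ in nhdsWithin x {x}ᶜ, (F y).re < 0 := by
    intro x hx
    obtain ⟨m, hm⟩ := heven x hx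
    obtain ⟨g, hg, hg0, hFg⟩ := ((han x hx).analyticOrderAt_eq_natCast).1 hm
    have hcast : Filter.Tendsto (fun y : ℝ => (y : ℂ)) (nhds x) (nhds (x : ℂ)) :=
      Complex.continuous_ofReal.continuousAt
    have hF : ∀ᶠ y : ℝ in nhds x, F y = (((y - x) ^ (2 * m) : ℝ) : ℂ) * g y :=
      (hcast.eventually hFg).mono fun y hy => by rw [hy, smul_eq_mul]; push_cast; rfl
    have hgc : ContinuousAt (fun y : ℝ => g y) x := ContinuousAt.comp (f := fun y : ℝ => (y : ℂ))
      hg.continuousAt Complex.continuous_ofReal.continuousAt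
    have hpow : ∀ y : ℝ, y ∈ ({x}ᶜ : Set ℝ) → 0 < (y - x) ^ (2 * m) := fun y hy => by
      rw [pow_mul]
      have : y - x ≠ 0 := sub_ne_zero.2 hy
      positivity
    have him : (g x).im = 0 := by
      have h1 : ∀ᶠ y : ℝ in nhdsWithin x {x}ᶜ, (g y).im = 0 := by
        filter_upwards [nhdsWithin_le_nhds hF, nhdsWithin_le_nhds (hJo.mem_nhds hx),
          self_mem_nhdsWithin] with y h1 h2 h3
        have h4 := hre y h2
        rw [h1, Complex.im_ofReal_mul] at h4
        exact (mul_eq_zero.1 h4).resolve_left (hpow y h3).ne'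
      have h2 : Filter.Tendsto (fun y : ℝ => (g y).im) (nhdsWithin x {x}ᶜ) (nhds (g x).im) :=
        ((Complex.continuous_im.continuousAt.comp hgc).tendsto).mono_left nhdsWithin_le_nhds
      exact tendsto_nhds_unique (h2.congr' h1) tendsto_const_nhds
    have hre0 : (g x).re ≠ 0 := fun h => hg0 (Complex.ext h him)
    have hgre : ContinuousAt (fun y : ℝ => (g y).re) x := Complex.continuous_re.continuousAt.comp hgc
    rcases hre0.lt_or_gt with h | h
    · right
      filter_upwards [nhdsWithin_le_nhds hF, nhdsWithin_le_nhds (hgre.eventually_lt_const h),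
        self_mem_nhdsWithin] with y h1 h2 h3
      rw [h1, Complex.re_ofReal_mul]
      exact mul_neg_of_pos_of_neg (hpow y h3) h2
    · left
      filter_upwards [nhdsWithin_le_nhds hF, nhdsWithin_le_nhds (hgre.eventually_const_lt h),
        self_mem_nhdsWithin] with y h1 h2 h3
      rw [h1, Complex.re_ofReal_mul]
      exact mul_pos (hpow y h3) h2
  have hcont : ∀ x ∈ J, ContinuousAt (fun y : ℝ => (F y).re) x := fun x hx =>
    Complex.continuous_re.continuousAt.comp (ContinuousAt.comp (f := fun y : ℝ => (y : ℂ))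
      (han x hx).continuousAt Complex.continuous_ofReal.continuousAt)
  have hfull : ∀ (P : ℝ → Prop) (x : ℝ), (∀ᶠ y in nhdsWithin x {x}ᶜ, P y) → P x →
      ∀ᶠ y in nhds x, P y := fun P x h1 h2 => by
    rw [eventually_nhdsWithin_iff] at h1
    filter_upwards [h1] with y hy
    by_cases hyx : y = x
    · rwa [hyx]
    · exact hy hyx
  let u : Set ℝ := {x | ∀ᶠ y : ℝ in nhds x, 0 ≤ (F y).re}
  let v : Set ℝ := {x | ∀ᶠ y : ℝ in nhds x, (F y).re ≤ 0}
  have hu : IsOpen u := isOpen_iff_mem_nhds.2 fun x hx => eventually_eventually_nhds.2 hx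
  have hv : IsOpen v := isOpen_iff_mem_nhds.2 fun x hx => eventually_eventually_nhds.2 hx
  have hcover : J ⊆ u ∪ v := by
    intro x hx
    have hlim : Filter.Tendsto (fun y : ℝ => (F y).re) (nhdsWithin x {x}ᶜ) (nhds (F x).re) :=
      (hcont x hx).tendsto.mono_left nhdsWithin_le_nhds
    rcases key x hx with h | h
    · exact Or.inl (hfull _ x (h.mono fun _ h => h.le) (ge_of_tendsto hlim (h.mono fun _ h => h.le)))
    · exact Or.inr (hfull _ x (h.mono fun _ h => h.le) (le_of_tendsto hlim (h.mono fun _ h => h.le)))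
  have hdisj : J ∩ (u ∩ v) = ∅ := by
    rw [eq_empty_iff_forall_notMem]
    rintro x ⟨hx, hxu, hxv⟩
    rcases key x hx with h | h
    · obtain ⟨y, h1, h2⟩ := (h.and (nhdsWithin_le_nhds hxv)).exists
      exact absurd h1 (not_lt.2 h2)
    · obtain ⟨y, h1, h2⟩ := (h.and (nhdsWithin_le_nhds hxu)).exists
      exact absurd h1 (not_lt.2 h2)
  rcases isPreconnected_iff_subset_of_disjoint.1 hJ u v hu hv hcover hdisj with h | h
  · exact Or.inl fun x hx => (h hx).self_of_nhds
  · exact Or.inr fun x hx => (h hx).self_of_nhds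

/-- `F` is analytic and real on `K ⊆ ℝ`, and not locally zero at any point of `K`. -/
structure RealAnalyticOn (F : ℂ → ℂ) (K : Set ℝ) : Prop where
  analyticAt : ∀ x ∈ K, AnalyticAt ℂ F x
  im_eq_zero : ∀ x ∈ K, (F x).im = 0
  order_ne_top : ∀ x ∈ K, analyticOrderAt F x ≠ ⊤

namespace RealAnalyticOn

variable {F : ℂ → ℂ} {K : Set ℝ} {s : SignedMeasure ℝ}

lemma continuousOn (hF : RealAnalyticOn F K) : ContinuousOn (fun x : ℝ => F x) K := fun x hx =>
  (ContinuousAt.comp (f := fun y : ℝ => (y : ℂ)) (hF.analyticAt x hx).continuousAt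
    Complex.continuous_ofReal.continuousAt).continuousWithinAt

lemma ofReal_re (hF : RealAnalyticOn F K) {x : ℝ} (hx : x ∈ K) : ((F x).re : ℂ) = F x :=
  Complex.ext rfl (by simp [hF.im_eq_zero x hx])

lemma finite_zeros (hF : RealAnalyticOn F K) (hK : IsCompact K) : {x ∈ K | F x = 0}.Finite := by
  by_contra hinf
  obtain ⟨x, hx, hacc⟩ := Set.Infinite.exists_accPt_of_subset_isCompact hinf hK fun x hx => hx.1
  rw [accPt_iff_frequently_nhdsNE] at hacc
  refine hF.order_ne_top x hx (analyticOrderAt_eq_top.2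
    ((hF.analyticAt x hx).frequently_zero_iff_eventually_zero.1 ?_))
  have ht : Filter.Tendsto (fun y : ℝ => (y : ℂ)) (nhdsWithin x {x}ᶜ)
      (nhdsWithin (x : ℂ) {(x : ℂ)}ᶜ) := by
    refine tendsto_nhdsWithin_iff.2 ⟨Complex.continuous_ofReal.continuousAt.tendsto.mono_left
      nhdsWithin_le_nhds, ?_⟩
    filter_upwards [self_mem_nhdsWithin] with y hy
    simpa using hy
  exact ht.frequently (hacc.mono fun y hy => hy.2)

/-- The integral of F q vanishes although F q ≥ 0 on the support, so F q = 0 there. The support is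
infinite, while `F` and `q` have only finitely many zeros on `K`. -/
lemma false_of_orth (hF : RealAnalyticOn F K) (h : Tame s K) (hK : IsCompact K) {M : ℕ}
    (ho : Orth s (fun x => F x) M) {q : ℝ[X]} (hq : q ≠ 0) (hdeg : q.natDegree < M)
    (hpos : ∀ x ∈ supp s, 0 ≤ (F x).re * q.eval x) : False := by
  have h1 : ∫ᵛ x, (((F x).re * q.eval x : ℝ) : ℂ) ∂<•s = 0 := by
    rw [← h.integral_mul_polynomial_eq_zero hK hF.continuousOn ho
      (q := q.map (algebraMap ℝ ℂ)) (by rwa [Polynomial.natDegree_map])]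
    refine h.integral_congr fun x hx => ?_
    rw [Complex.ofReal_mul, hF.ofReal_re hx, Polynomial.eval_map_algebraMap,
      ← Complex.coe_algebraMap, Polynomial.aeval_algebraMap_apply, Polynomial.coe_aeval_eq_eval]
  have h2 := h.eq_zero_of_integral_eq_zero hK
    ((Complex.continuous_re.comp_continuousOn hF.continuousOn).mul q.continuous.continuousOn) hpos h1
  refine h.infinite (((hF.finite_zeros hK).union (q.roots.toFinset.finite_toSet)).subset
    fun x hx => ?_)
  rcases mul_eq_zero.1 (h2 x hx) with h3 | h3
  · exact Or.inl ⟨h.supp_subset hx, by rw [← hF.ofReal_re (h.supp_subset hx)]; simpa using h3⟩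
  · exact Or.inr (by simpa [hq] using h3)

/-- The monic polynomial with simple zeros at the points of `T`. -/
def nodal (T : Finset ℝ) : ℝ[X] := ∏ x ∈ T, (Polynomial.X - Polynomial.C x)

lemma nodal_monic (T : Finset ℝ) : (nodal T).Monic :=
  Polynomial.monic_prod_of_monic _ _ fun x _ => Polynomial.monic_X_sub_C x

lemma natDegree_nodal (T : Finset ℝ) : (nodal T).natDegree = T.card := by
  rw [nodal, Polynomial.natDegree_prod_of_monic _ _ fun x _ => Polynomial.monic_X_sub_C x]
  simp

lemma multiset_prod_eq_nodal (T : Finset ℝ) (x : ℝ) :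
    ((T.val.map fun t : ℝ => (t : ℂ)).map fun y => (x : ℂ) - y).prod =
      (((nodal T).eval x : ℝ) : ℂ) := by
  simp only [nodal, Polynomial.eval_prod, Multiset.map_map, Function.comp_def]
  push_cast
  simp only [Polynomial.eval_sub, Polynomial.eval_X, Polynomial.eval_C, Complex.ofReal_sub]
  rfl

open scoped Classical in
lemma count_map_ofReal (T : Finset ℝ) (x : ℝ) :
    (T.val.map fun t : ℝ => (t : ℂ)).count (x : ℂ) = if x ∈ T then 1 else 0 := by
  rw [Multiset.count_map_eq_count' _ _ Complex.ofReal_injective,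
    Multiset.count_eq_of_nodup T.nodup]
  simp only [Finset.mem_val]

open scoped Classical in
lemma analyticOrderAt_multiset_prod (Y : Multiset ℂ) (z : ℂ) :
    analyticOrderAt (fun w => (Y.map fun y => w - y).prod) z = Y.count z := by
  induction Y using Multiset.induction_on with
  | empty => simp [analyticOrderAt_eq_zero]
  | cons y Y ih =>
    rw [analyticOrderAt_eq_add isOpen_univ (mem_univ z) (analyticAt_multiset_prod Y z)
      (fun w _ => by rw [Multiset.map_cons, Multiset.prod_cons, mul_comm]), ih,
      Multiset.count_cons]
    push_cast; rfl

lemma subset_closure_interior (hKc : Convex ℝ K) (hnt : K.Nontrivial) : K ⊆ closure (interior K) := by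
  obtain ⟨x, hx, y, hy, hxy⟩ := hnt
  have hne : (interior K).Nonempty := by
    rcases hxy.lt_or_gt with hlt | hlt
    · obtain ⟨w, hw⟩ := exists_between hlt
      exact ⟨w, interior_mono (hKc.ordConnected.out hx hy) (by rw [interior_Icc]; exact hw)⟩
    · obtain ⟨w, hw⟩ := exists_between hlt
      exact ⟨w, interior_mono (hKc.ordConnected.out hy hx) (by rw [interior_Icc]; exact hw)⟩
  rw [hKc.closure_interior_eq_closure_of_nonempty_interior hne]
  exact subset_closure

/-- A simple factor at each zero of odd order makes all orders in the interior even. Orders at the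
endpoints do not matter, because the sign extends to them by continuity. -/
lemma nonneg_or_nonpos_mul_nodal (hF : RealAnalyticOn F K) (hKc : Convex ℝ K) (hnt : K.Nontrivial)
    {T : Finset ℝ} (hT : ∀ x ∈ interior K, x ∈ T ↔ ∃ m : ℕ, analyticOrderAt F x = (2 * m + 1 : ℕ)) :
    (∀ x ∈ K, 0 ≤ (F x).re * (nodal T).eval x) ∨ ∀ x ∈ K, (F x).re * (nodal T).eval x ≤ 0 := by
  classical
  let p : ℂ → ℂ := fun w => ((T.val.map fun x : ℝ => (x : ℂ)).map fun y => w - y).prod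
  have hp : ∀ z, AnalyticAt ℂ p z := analyticAt_multiset_prod _
  have hpq : ∀ x : ℝ, p x = ((nodal T).eval x : ℝ) := multiset_prod_eq_nodal T
  have hpord : ∀ x : ℝ, analyticOrderAt p x = if x ∈ T then 1 else 0 := by
    intro x
    rw [analyticOrderAt_multiset_prod, count_map_ofReal]
    split_ifs <;> rfl
  have hFp : (∀ x ∈ interior K, 0 ≤ (F x * p x).re) ∨ ∀ x ∈ interior K, (F x * p x).re ≤ 0 := by
    refine nonneg_or_nonpos_of_even_order (F := fun z => F z * p z) hKc.interior.isPreconnected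
      isOpen_interior (fun x hx => (hF.analyticAt x (interior_subset hx)).mul (hp x)) (fun x hx => ?_)
      fun x hx => ?_
    · rw [hpq, ← hF.ofReal_re (interior_subset hx), ← Complex.ofReal_mul, Complex.ofReal_im]
    · have h1 : analyticOrderAt (fun z => F z * p z) x = analyticOrderAt F x + analyticOrderAt p x :=
        analyticOrderAt_mul (hF.analyticAt x (interior_subset hx)) (hp x)
      rw [h1, hpord]
      obtain ⟨n, hn⟩ := ENat.ne_top_iff_exists.1 (hF.order_ne_top x (interior_subset hx))
      by_cases hxT : x ∈ T
      · obtain ⟨m, hm⟩ := (hT x hx).1 hxT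
        rw [if_pos hxT, hm]
        exact ⟨m + 1, by norm_cast⟩
      · rw [if_neg hxT, ← hn, add_zero]
        rcases Nat.even_or_odd' n with ⟨m, hm | hm⟩
        · exact ⟨m, by rw [hm]⟩
        · exact absurd ((hT x hx).2 ⟨m, by rw [← hn, hm]⟩) hxT
  have hFpre : ∀ x ∈ K, (F x * p x).re = (F x).re * (nodal T).eval x := by
    intro x hx
    rw [hpq, mul_comm, Complex.re_ofReal_mul, mul_comm]
  have hint := subset_closure_interior hKc hnt
  have hcont : ContinuousOn (fun x : ℝ => (F x).re * (nodal T).eval x) K :=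
    (Complex.continuous_re.comp_continuousOn hF.continuousOn).mul (nodal T).continuous.continuousOn
  refine hFp.imp (fun h1 x hxK => ?_) fun h1 x hxK => ?_
  · exact ContinuousWithinAt.closure_le (hint hxK) continuousWithinAt_const
      ((hcont x hxK).mono interior_subset)
      fun y hy => by rw [← hFpre y (interior_subset hy)]; exact h1 y hy
  · exact ContinuousWithinAt.closure_le (hint hxK) ((hcont x hxK).mono interior_subset)
      continuousWithinAt_const fun y hy => by
        rw [← hFpre y (interior_subset hy)]; exact h1 y hy

/-- Orthogonality forces zeros of odd order. -/
lemma exists_odd_zeros (hF : RealAnalyticOn F K) (h : Tame s K) (hK : IsCompact K)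
    (hKc : Convex ℝ K) {M : ℕ} (ho : Orth s (fun x => F x) M) :
    ∃ T : Finset ℝ, T.card = M ∧ ∀ x ∈ T, x ∈ interior K ∧
      ∃ m : ℕ, analyticOrderAt F x = (2 * m + 1 : ℕ) := by
  by_contra hcon
  -- If there are fewer than `M` zeros of odd order, their nodal polynomial has degree less than `M`
  -- and its product with `F` has one sign, against `false_of_orth`.
  let Z : Set ℝ := {x | x ∈ interior K ∧ ∃ m : ℕ, analyticOrderAt F x = (2 * m + 1 : ℕ)}
  have hZfin : Z.Finite := by
    by_contra hinf
    obtain ⟨T, hT, hc⟩ := Set.Infinite.exists_subset_card_eq hinf M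
    exact hcon ⟨T, hc, fun x hx => hT hx⟩
  have hcard : hZfin.toFinset.card < M := by
    by_contra hle
    obtain ⟨T, hT, hc⟩ := Finset.exists_subset_card_eq (not_lt.1 hle)
    exact hcon ⟨T, hc, fun x hx => hZfin.mem_toFinset.1 (hT hx)⟩
  rcases hF.nonneg_or_nonpos_mul_nodal hKc (h.infinite.nontrivial.mono h.supp_subset)
    (T := hZfin.toFinset) (fun x hx => by rw [hZfin.mem_toFinset]; exact and_iff_right hx)
    with h1 | h1
  · exact hF.false_of_orth h hK ho (nodal_monic _).ne_zero (by rwa [natDegree_nodal])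
      fun x hx => h1 x (h.supp_subset hx)
  · exact hF.false_of_orth h hK ho (q := -nodal _) (neg_ne_zero.2 (nodal_monic _).ne_zero)
      (by rwa [Polynomial.natDegree_neg, natDegree_nodal]) fun x hx => by
        simpa using h1 x (h.supp_subset hx)

end RealAnalyticOn

/-! ### Counting zeros along a chain of Cauchy transforms. -/

/-- The functions of second type obtained from the polynomial `P` by successive Cauchy transforms
with respect to `κ 0, κ 1, …`. -/
def secondType (κ : ℕ → SignedMeasure ℝ) (P : ℝ[X]) : ℕ → ℂ → ℂ
  | 0 => fun z => Polynomial.aeval z P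
  | k + 1 => transform (κ k) fun x => secondType κ P k x

/-- Measures `κ k` on compact intervals `Δ (k + 1)`, consecutive intervals being disjoint. -/
structure Chain (m : ℕ) (Δ : ℕ → Set ℝ) (κ : ℕ → SignedMeasure ℝ) : Prop where
  zero : Δ 0 = ∅
  compact : ∀ k < m, IsCompact (Δ (k + 1))
  convex : ∀ k < m, Convex ℝ (Δ (k + 1))
  disjoint : ∀ k < m, Disjoint (Δ k) (Δ (k + 1))
  tame : ∀ k < m, Tame (κ k) (Δ (k + 1))

/-- The orthogonality relations satisfied by the functions of second type. -/
def OrthChain (m : ℕ) (κ : ℕ → SignedMeasure ℝ) (N : ℕ → ℕ) (P : ℝ[X]) : Prop :=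
  ∀ k < m, Orth (κ k) (fun x => secondType κ P k x) (N k)

lemma card_le_natDegree (P : ℂ[X]) (hP : P ≠ 0) (Y : Multiset ℂ) (h : ∀ z, (Y.count z : ℕ∞) ≤
    analyticOrderAt (fun z => P.eval z) z) : Y.card ≤ P.natDegree := by
  induction Y using Multiset.induction_on generalizing P with
  | empty => simp
  | cons y Y ih =>
    have h0 : P.eval y = 0 := by
      have h1 := h y
      rw [Multiset.count_cons_self] at h1
      exact (analyticOrderAt_ne_zero.1 fun h2 : analyticOrderAt (fun z => P.eval z) y = 0 => by
        rw [h2] at h1; simp at h1).2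
    obtain ⟨R, hR⟩ := Polynomial.dvd_iff_isRoot.2 h0
    have hR0 : R ≠ 0 := fun h => hP (by rw [hR, h, mul_zero])
    have h1 := ih R hR0 fun z => by
      refine Multiset.count_cons_le_add (y := y) ((h z).trans_eq ?_)
      refine analyticOrderAt_eq_add isOpen_univ (mem_univ z) (by simpa [Polynomial.coe_aeval_eq_eval] using! (AnalyticAt.aeval_polynomial (analyticAt_id (𝕜 := ℂ) (z := z)) R)) fun w _ => ?_
      rw [hR]; simp [mul_comm]
    rw [hR, Polynomial.natDegree_mul (Polynomial.X_sub_C_ne_zero y) hR0, Multiset.card_cons,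
      Polynomial.natDegree_X_sub_C]
    omega

namespace Chain

variable {m : ℕ} {Δ : ℕ → Set ℝ} {κ : ℕ → SignedMeasure ℝ} {N : ℕ → ℕ} {P : ℝ[X]} {k : ℕ} {e : ℕ}

lemma mem_off (c : Chain m Δ κ) (hk : k < m) {x : ℝ} (hx : x ∈ Δ (k + 1)) : (x : ℂ) ∈ off (Δ k) :=
  ofReal_mem_off.2 fun h => disjoint_left.1 (c.disjoint k hk) h hx

lemma analyticAt (c : Chain m Δ κ) (P : ℝ[X]) (hk : k ≤ m) {z : ℂ} (hz : z ∈ off (Δ k)) :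
    AnalyticAt ℂ (secondType κ P k) z := by
  induction k generalizing z with
  | zero =>
    simp only [secondType]
    exact AnalyticAt.aeval_polynomial analyticAt_id P
  | succ k ih =>
    refine (c.tame k hk).analyticAt_transform (c.compact k hk) (fun x hx => ?_) hz
    exact (ContinuousAt.comp (f := fun y : ℝ => (y : ℂ)) (ih (by omega) (c.mem_off hk hx)).continuousAt
      Complex.continuous_ofReal.continuousAt).continuousWithinAt

lemma secondType_conj (c : Chain m Δ κ) (P : ℝ[X]) (hk : k ≤ m) (z : ℂ) :
    secondType κ P k (starRingEnd ℂ z) = starRingEnd ℂ (secondType κ P k z) := by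
  induction k generalizing z with
  | zero =>
    simp only [secondType]
    exact (Polynomial.aeval_conj P z).symm ▸ rfl
  | succ k ih =>
    exact (c.tame k hk).transform_conj fun x => by rw [← ih (by omega), Complex.conj_ofReal]

lemma continuousOn (c : Chain m Δ κ) (P : ℝ[X]) (hk : k < m) :
    ContinuousOn (fun x : ℝ => secondType κ P k x) (Δ (k + 1)) := fun x hx =>
  (ContinuousAt.comp (f := fun y : ℝ => (y : ℂ)) (c.analyticAt P hk.le (c.mem_off hk hx)).continuousAt
      Complex.continuous_ofReal.continuousAt).continuousWithinAt

/-- `Y` consists of zeros of `secondType κ P k` off `Δ k`, counted at most with their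
multiplicities, and is symmetric about the real axis. -/
structure ZeroSet (Δ : ℕ → Set ℝ) (κ : ℕ → SignedMeasure ℝ) (P : ℝ[X]) (k : ℕ) (Y : Multiset ℂ) :
    Prop where
  mem_off : ∀ y ∈ Y, y ∈ off (Δ k)
  count_le : ∀ z ∈ off (Δ k), (Y.count z : ℕ∞) ≤ analyticOrderAt (secondType κ P k) z
  im_prod : ∀ x : ℝ, (Y.map fun y => (x : ℂ) - y).prod.im = 0

/-- By symmetry of `Y`, ∏ (x - y) is real on the real line, and it has no zeros on the interval Δ (k
+ 1). Dividing κ k by it therefore preserves constant sign and support, and each element of `Y` adds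
one relation. -/
lemma exists_orth (c : Chain m Δ κ) (ho : OrthChain m κ N P) (hk : k < m) {Y : Multiset ℂ}
    (hY : ZeroSet Δ κ P (k + 1) Y) : ∃ s, Tame s (Δ (k + 1)) ∧ supp s = supp (κ k) ∧
      Orth s (fun x => secondType κ P k x) (N k + Y.card) := by
  have hK := c.compact k hk
  let w : ℝ → ℝ := fun x => (Y.map fun y => (x : ℂ) - y).prod.re⁻¹
  have hre : ∀ x : ℝ, (((Y.map fun y => (x : ℂ) - y).prod.re : ℝ) : ℂ) =
      (Y.map fun y => (x : ℂ) - y).prod := fun x => Complex.ext rfl (by simp [hY.im_prod x])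
  have hne : ∀ x ∈ Δ (k + 1), (Y.map fun y => (x : ℂ) - y).prod ≠ 0 := fun x hx h => by
    obtain ⟨y, hy, h0⟩ := Multiset.mem_map.1 (Multiset.prod_eq_zero_iff.1 h)
    exact hY.mem_off y hy x hx (sub_eq_zero.1 h0).symm
  have hne' : ∀ x ∈ Δ (k + 1), (Y.map fun y => (x : ℂ) - y).prod.re ≠ 0 := fun x hx h =>
    hne x hx (by rw [← hre, h, Complex.ofReal_zero])
  have hw : SignedOn w (Δ (k + 1)) := by
    refine SignedOn.of_ne_zero (ContinuousOn.inv₀ ?_ hne') (c.convex k hk).isPreconnected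
      fun x hx => inv_ne_zero (hne' x hx)
    exact fun x hx => (Complex.continuous_re.continuousAt.comp
      (ContinuousAt.comp (f := fun y : ℝ => (y : ℂ)) (analyticAt_multiset_prod Y x).continuousAt
      Complex.continuous_ofReal.continuousAt)).continuousWithinAt
  have ht := c.tame k hk
  refine ⟨density w (κ k), ht.density hK hw, supp_density hK ht.toCarried hw, fun ν hν => ?_⟩
  rw [integral_density hK ht.toCarried hw,
    ← ht.orth_div_prod hK (c.continuousOn P hk) (ho k hk) Y hY.mem_off hY.count_le ν hν]
  refine ht.integral_congr fun x hx => ?_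
  rw [Complex.ofReal_inv, hre]
  field_simp

/-- A zero of infinite order would allow zero sets of any size; e + 1 copies of it already exceed
the bound. -/
lemma realAnalyticOn (c : Chain m Δ κ) (hk : k < m)
    (hU : ∀ Y, ZeroSet Δ κ P k Y → Y.card ≤ e) :
    RealAnalyticOn (secondType κ P k) (Δ (k + 1)) where
  analyticAt x hx := c.analyticAt P hk.le (c.mem_off hk hx)
  im_eq_zero x _ := by
    rw [← Complex.conj_eq_iff_im, ← c.secondType_conj P hk.le, Complex.conj_ofReal]
  order_ne_top x hx htop := by
    have h1 := hU (Multiset.replicate (e + 1) (x : ℂ)) ⟨fun y hy => by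
      rw [Multiset.eq_of_mem_replicate hy]; exact c.mem_off hk hx, fun z _ => by
        by_cases hz : z = x
        · rw [hz, htop]; exact le_top
        · rw [Multiset.count_eq_zero_of_notMem fun h => hz (Multiset.eq_of_mem_replicate h)]
          simp, fun y => by
        rw [Multiset.map_replicate, Multiset.prod_replicate, ← Complex.ofReal_sub,
          ← Complex.ofReal_pow, Complex.ofReal_im]⟩
    rw [Multiset.card_replicate] at h1
    omega

lemma zeroSet_of_odd (c : Chain m Δ κ) (hk : k < m) {T : Finset ℝ}
    (hT : ∀ x ∈ T, x ∈ interior (Δ (k + 1)) ∧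
      ∃ n : ℕ, analyticOrderAt (secondType κ P k) x = (2 * n + 1 : ℕ)) :
    ZeroSet Δ κ P k (T.val.map fun t : ℝ => (t : ℂ)) where
  mem_off y hy := by
    obtain ⟨x, hx, rfl⟩ := Multiset.mem_map.1 hy
    exact c.mem_off hk (interior_subset (hT x hx).1)
  count_le z _ := by
    by_cases hz : z ∈ T.val.map fun t : ℝ => (t : ℂ)
    · obtain ⟨x, hx, rfl⟩ := Multiset.mem_map.1 hz
      obtain ⟨n, hn⟩ := (hT x hx).2
      rw [RealAnalyticOn.count_map_ofReal, if_pos (by simpa using hx), hn]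
      norm_cast
      omega
    · rw [Multiset.count_eq_zero_of_notMem hz]; simp
  im_prod x := by rw [RealAnalyticOn.multiset_prod_eq_nodal, Complex.ofReal_im]

/-- The total number of orthogonality relations from level `k` on. -/
lemma card_le (c : Chain m Δ κ) (hP : P ≠ 0) (ho : OrthChain m κ N P)
    (hdeg : P.natDegree ≤ ∑ i ∈ Finset.Ico 0 m, N i + e) (hk : k < m) (Y : Multiset ℂ)
    (hY : ZeroSet Δ κ P k Y) : Y.card ≤ ∑ i ∈ Finset.Ico k m, N i + e := by
  induction k generalizing Y with
  | zero =>
    refine le_trans ?_ hdeg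
    rw [← Polynomial.natDegree_map (algebraMap ℝ ℂ)]
    refine card_le_natDegree _ (by rwa [Polynomial.map_ne_zero_iff (algebraMap ℝ ℂ).injective]) Y
      fun z => ?_
    simpa [secondType, Polynomial.eval_map_algebraMap] using
      hY.count_le z (by rw [c.zero]; exact fun x hx => hx.elim)
  | succ k ih =>
    have hk' : k < m := by omega
    -- A zero set `Y` at level k + 1 gives N k + |Y| relations, hence that many zeros of odd order
    -- at level k. These form a zero set bounded by the induction hypothesis, and N k cancels.
    obtain ⟨s, hs, -, hso⟩ := c.exists_orth ho hk' hY
    obtain ⟨T, hTc, hT⟩ := (c.realAnalyticOn hk' (ih hk')).exists_odd_zeros hs (c.compact k hk')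
      (c.convex k hk') hso
    have h1 := ih hk' _ (c.zeroSet_of_odd hk' hT)
    rw [Multiset.card_map, Finset.card_val, hTc, Finset.sum_eq_sum_Ico_succ_bot hk'] at h1
    omega

/-- Descending from the last level: the relations at level k + 1 force zeros there, and these become
additional relations at level k. -/
lemma exists_orth_sum (c : Chain m Δ κ) (hP : P ≠ 0) (ho : OrthChain m κ N P)
    (hdeg : P.natDegree ≤ ∑ i ∈ Finset.Ico 0 m, N i + e) (hk : k < m) :
    ∃ s, Tame s (Δ (k + 1)) ∧ supp s = supp (κ k) ∧
      Orth s (fun x => secondType κ P k x) (∑ i ∈ Finset.Ico k m, N i) := by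
  induction hd : m - 1 - k generalizing k with
  | zero =>
    obtain rfl : m = k + 1 := by omega
    exact ⟨κ k, c.tame k hk, rfl, by simpa using ho k hk⟩
  | succ d ih =>
    have hk' : k + 1 < m := by omega
    obtain ⟨s, hs, -, hso⟩ := ih hk' (by omega)
    obtain ⟨T, hTc, hT⟩ := (c.realAnalyticOn hk' (c.card_le hP ho hdeg hk')).exists_odd_zeros hs
      (c.compact _ hk') (c.convex _ hk') hso
    obtain ⟨s', hs'⟩ := c.exists_orth ho hk (c.zeroSet_of_odd hk' hT)
    rw [Multiset.card_map, Finset.card_val, hTc, ← Finset.sum_eq_sum_Ico_succ_bot hk] at hs'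
    exact ⟨s', hs'⟩

lemma exists_zeros (c : Chain m Δ κ) (hP : P ≠ 0) (ho : OrthChain m κ N P)
    (hdeg : P.natDegree ≤ ∑ i ∈ Finset.Ico 0 m, N i + e) (hk : k < m) :
    ∃ T : Finset ℝ, T.card = ∑ i ∈ Finset.Ico k m, N i ∧ ∀ x ∈ T, x ∈ interior (Δ (k + 1)) ∧
      ∃ n : ℕ, analyticOrderAt (secondType κ P k) x = (2 * n + 1 : ℕ) := by
  obtain ⟨s, hs, -, hso⟩ := c.exists_orth_sum hP ho hdeg hk
  exact (c.realAnalyticOn hk (c.card_le hP ho hdeg hk)).exists_odd_zeros hs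
      (c.compact _ hk) (c.convex _ hk) hso

/-- The excess degree 1 leaves room for just one zero beyond those of odd order already found,
whereas a multiple zero `x` would add two copies. If `x` is itself one of the odd zeros, its order
is odd and at least 2, so at least 3, which still covers the two extra copies. -/
lemma order_le_one (c : Chain m Δ κ) (hP : P ≠ 0) (ho : OrthChain m κ N P)
    (hdeg : P.natDegree ≤ ∑ i ∈ Finset.Ico 0 m, N i + 1) (hk : k < m) {x : ℝ} (hx : x ∈ Δ (k + 1)) :
    analyticOrderAt (secondType κ P k) x ≤ 1 := by
  classical
  by_contra hlt
  have h2 : 2 ≤ analyticOrderAt (secondType κ P k) x := by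
    rw [← one_add_one_eq_two]; exact Order.add_one_le_of_lt (not_le.1 hlt)
  obtain ⟨T, hTc, hT⟩ := c.exists_zeros hP ho hdeg hk
  have h1 := c.zeroSet_of_odd hk hT
  have h3 := c.card_le hP ho hdeg hk ((x : ℂ) ::ₘ (x : ℂ) ::ₘ T.val.map fun t : ℝ => (t : ℂ))
    { mem_off := fun y hy => by
        rcases Multiset.mem_cons.1 hy with rfl | hy
        · exact c.mem_off hk hx
        rcases Multiset.mem_cons.1 hy with rfl | hy
        · exact c.mem_off hk hx
        · exact h1.mem_off y hy
      count_le := fun z hz => by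
        by_cases hzx : z = x
        · subst hzx
          rw [Multiset.count_cons_self, Multiset.count_cons_self, RealAnalyticOn.count_map_ofReal]
          split_ifs with hxT
          · obtain ⟨n, hn⟩ := (hT x hxT).2
            rw [hn] at h2 ⊢
            norm_cast at h2 ⊢
            omega
          · exact h2
        · rw [Multiset.count_cons_of_ne hzx, Multiset.count_cons_of_ne hzx]
          exact h1.count_le z hz
      im_prod := fun y => by
        rw [Multiset.map_cons, Multiset.map_cons, Multiset.prod_cons, Multiset.prod_cons,
          RealAnalyticOn.multiset_prod_eq_nodal]
        norm_cast }
  simp only [Multiset.card_cons, Multiset.card_map, Finset.card_val, hTc] at h3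
  omega

lemma order_pos (c : Chain m Δ κ) (hk : k ≤ m) {z : ℂ} (hz : z ∈ off (Δ k)) (h0 : secondType κ P k z = 0) :
    1 ≤ analyticOrderAt (secondType κ P k) z := by
  rw [Order.one_le_iff_ne_zero, analyticOrderAt_ne_zero]
  exact ⟨c.analyticAt P hk hz, h0⟩

/-- If the degree of `P` is at most the total number of orthogonality relations, then the zeros of
`secondType κ P k` are simple, lie in the interior of `Δ (k + 1)`, and their number is the number
of relations from level `k` on. -/
theorem zeros (c : Chain m Δ κ) (hP : P ≠ 0) (ho : OrthChain m κ N P)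
    (hdeg : P.natDegree ≤ ∑ i ∈ Finset.Ico 0 m, N i) (hk : k < m) :
    ∃ T : Finset ℝ, T.card = ∑ i ∈ Finset.Ico k m, N i ∧
      (∀ x ∈ T, x ∈ interior (Δ (k + 1)) ∧ analyticOrderAt (secondType κ P k) x = 1) ∧
      ∀ z ∈ off (Δ k), secondType κ P k z = 0 → ∃ x ∈ T, z = (x : ℂ) := by
  classical
  obtain ⟨T, hTc, hT⟩ := c.exists_zeros (e := 0) hP ho hdeg hk
  have h1 := c.zeroSet_of_odd hk hT
  refine ⟨T, hTc, fun x hx => ⟨(hT x hx).1, le_antisymm (c.order_le_one hP ho (by omega) hk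
    (interior_subset (hT x hx).1)) ?_⟩, fun z hz h0 => ?_⟩
  · obtain ⟨n, hn⟩ := (hT x hx).2
    rw [hn]; norm_cast; omega
  by_contra hzT
  push Not at hzT
  have hzT' : z ∉ T.val.map fun t : ℝ => (t : ℂ) := fun h => by
    obtain ⟨x, hx, rfl⟩ := Multiset.mem_map.1 h
    exact hzT x hx rfl
  have hcount : ∀ w : ℂ, w ∉ (T.val.map fun t : ℝ => (t : ℂ)) →
    Multiset.count w (T.val.map fun t : ℝ => (t : ℂ)) = 0 := fun w => Multiset.count_eq_zero_of_notMem
  -- A further zero exceeds the bound: a real one is added alone, a nonreal one with its conjugate,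
  -- since zero sets must be symmetric.
  by_cases him : z.im = 0
  · obtain ⟨x, rfl⟩ : ∃ x : ℝ, z = x := ⟨z.re, Complex.ext rfl (by simp [him])⟩
    have h3 := c.card_le (e := 0) hP ho hdeg hk ((x : ℂ) ::ₘ T.val.map fun t : ℝ => (t : ℂ))
      { mem_off := fun y hy => by
          rcases Multiset.mem_cons.1 hy with rfl | hy
          · exact hz
          · exact h1.mem_off y hy
        count_le := fun w hw => by
          by_cases hwx : w = x
          · subst hwx
            rw [Multiset.count_cons_self, hcount _ hzT']
            exact c.order_pos hk.le hz h0
          · rw [Multiset.count_cons_of_ne hwx]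
            exact h1.count_le w hw
        im_prod := fun y => by
          rw [Multiset.map_cons, Multiset.prod_cons, RealAnalyticOn.multiset_prod_eq_nodal]
          norm_cast }
    simp only [Multiset.card_cons, Multiset.card_map, Finset.card_val, hTc] at h3
    omega
  · have hz' : starRingEnd ℂ z ∈ off (Δ k) := mem_off_of_im_ne_zero (by simpa using him)
    have h0' : secondType κ P k (starRingEnd ℂ z) = 0 := by rw [c.secondType_conj P hk.le, h0, map_zero]
    have hzz : z ≠ starRingEnd ℂ z := fun h => him (Complex.conj_eq_iff_im.1 h.symm)
    have hzT'' : starRingEnd ℂ z ∉ T.val.map fun t : ℝ => (t : ℂ) := fun h => by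
      obtain ⟨x, hx, hxz⟩ := Multiset.mem_map.1 h
      exact hzT x hx (by rw [← Complex.conj_ofReal, hxz, Complex.conj_conj])
    have h3 := c.card_le (e := 0) hP ho hdeg hk
      (z ::ₘ starRingEnd ℂ z ::ₘ T.val.map fun t : ℝ => (t : ℂ))
      { mem_off := fun y hy => by
          rcases Multiset.mem_cons.1 hy with rfl | hy
          · exact hz
          rcases Multiset.mem_cons.1 hy with rfl | hy
          · exact hz'
          · exact h1.mem_off y hy
        count_le := fun w hw => by
          by_cases hwx : w = z
          · subst hwx
            rw [Multiset.count_cons_self, Multiset.count_cons_of_ne hzz, hcount _ hzT']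
            exact c.order_pos hk.le hz h0
          by_cases hwx' : w = starRingEnd ℂ z
          · subst hwx'
            rw [Multiset.count_cons_of_ne hzz.symm, Multiset.count_cons_self, hcount _ hzT'']
            exact c.order_pos hk.le hz' h0'
          · rw [Multiset.count_cons_of_ne hwx, Multiset.count_cons_of_ne hwx']
            exact h1.count_le w hw
        im_prod := fun y => by
          have h5 : ((y : ℂ) - z) * ((y : ℂ) - starRingEnd ℂ z) = (Complex.normSq (y - z) : ℝ) := by
            rw [← Complex.mul_conj, map_sub, Complex.conj_ofReal]
          rw [Multiset.map_cons, Multiset.map_cons, Multiset.prod_cons, Multiset.prod_cons,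
            RealAnalyticOn.multiset_prod_eq_nodal, ← mul_assoc, h5]
          norm_cast }
    simp only [Multiset.card_cons, Multiset.card_map, Finset.card_val, hTc] at h3
    omega

/-- There is at most one zero on the closure of a gap of the support. -/
theorem false_of_gap (c : Chain m Δ κ) (hP : P ≠ 0) (ho : OrthChain m κ N P)
    (hdeg : P.natDegree ≤ ∑ i ∈ Finset.Ico 0 m, N i) (hk : k < m) {a b : ℝ} (ha : a ∈ Δ (k + 1))
    (hb : b ∈ Δ (k + 1)) (hab : a < b) (h0a : secondType κ P k a = 0) (h0b : secondType κ P k b = 0)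
    (hgap : Disjoint (Ioo a b) (supp (κ k))) : False := by
  classical
  obtain ⟨T, hTc, hT, hall⟩ := c.zeros hP ho hdeg hk
  obtain ⟨s, hs, hsupp, hso⟩ := c.exists_orth_sum (e := 0) hP ho hdeg hk
  have hF := c.realAnalyticOn hk (c.card_le (e := 0) hP ho hdeg hk)
  have hmem : ∀ x ∈ Δ (k + 1), secondType κ P k x = 0 → x ∈ T := fun x hx h0 => by
    obtain ⟨y, hy, hxy⟩ := hall x (c.mem_off hk hx) h0
    rwa [Complex.ofReal_injective hxy]
  have haT := hmem a ha h0a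
  have hbT : b ∈ T.erase a := Finset.mem_erase.2 ⟨hab.ne', hmem b hb h0b⟩
  have hnod : ∀ x : ℝ, (RealAnalyticOn.nodal T).eval x =
      (x - a) * (x - b) * (RealAnalyticOn.nodal ((T.erase a).erase b)).eval x := fun x => by
    rw [RealAnalyticOn.nodal, ← Finset.mul_prod_erase T _ haT, ← Finset.mul_prod_erase _ _ hbT]
    simp [RealAnalyticOn.nodal, mul_assoc]
  -- The test polynomial omits the factor (x - a)(x - b). On the support this factor is positive or
  -- the function vanishes, so the product with the shorter polynomial keeps its sign, while its
  -- degree is now below the number of relations.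
  have hdeg' : (RealAnalyticOn.nodal ((T.erase a).erase b)).natDegree <
      ∑ i ∈ Finset.Ico k m, N i := by
    rw [RealAnalyticOn.natDegree_nodal, ← hTc]
    exact (Finset.card_erase_lt_of_mem hbT).trans (Finset.card_erase_lt_of_mem haT)
  have hsgn : ∀ x ∈ supp s, 0 < (x - a) * (x - b) ∨ secondType κ P k x = 0 := fun x hx => by
    rw [hsupp] at hx
    rcases lt_trichotomy x a with h | h | h
    · exact Or.inl (mul_pos_of_neg_of_neg (by linarith) (by linarith))
    · exact Or.inr (by rw [h, h0a])
    rcases lt_trichotomy x b with h' | h' | h'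
    · exact (disjoint_left.1 hgap ⟨h, h'⟩ hx).elim
    · exact Or.inr (by rw [h', h0b])
    · exact Or.inl (mul_pos (by linarith) (by linarith))
  rcases hF.nonneg_or_nonpos_mul_nodal (c.convex k hk) (hs.infinite.nontrivial.mono hs.supp_subset)
    (T := T) (fun x hx => ⟨fun h => ⟨0, by rw [(hT x h).2]; rfl⟩, fun ⟨n, hn⟩ => hmem x
      (interior_subset hx) (analyticOrderAt_ne_zero.1 fun h => by
        rw [h] at hn; norm_cast at hn).2⟩) with h1 | h1
  · refine hF.false_of_orth hs (c.compact k hk) hso (RealAnalyticOn.nodal_monic _).ne_zero hdeg'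
      fun x hx => ?_
    rcases hsgn x hx with h2 | h2
    · have h3 := h1 x (hs.supp_subset hx)
      rw [hnod, mul_left_comm] at h3
      exact nonneg_of_mul_nonneg_right h3 h2
    · rw [h2]; simp
  · refine hF.false_of_orth hs (c.compact k hk) hso
      (neg_ne_zero.2 (RealAnalyticOn.nodal_monic _).ne_zero) (by rwa [Polynomial.natDegree_neg])
      fun x hx => ?_
    rcases hsgn x hx with h2 | h2
    · have h3 := h1 x (hs.supp_subset hx)
      rw [hnod, mul_left_comm, ← neg_nonneg, ← mul_neg] at h3
      rw [Polynomial.eval_neg, mul_neg]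
      exact nonneg_of_mul_nonneg_right h3 h2
    · rw [h2]; simp

/-- The orthogonality relations determine a lower bound for the degree. -/
theorem le_natDegree (c : Chain m Δ κ) (hm : 0 < m) (hP : P ≠ 0) (ho : OrthChain m κ N P) :
    ∑ i ∈ Finset.Ico 0 m, N i ≤ P.natDegree := by
  by_contra hlt
  obtain ⟨s, hs, -, hso⟩ := c.exists_orth_sum (e := 0) hP ho (not_le.1 hlt).le hm
  -- A polynomial of too small a degree may be tested against itself.
  refine (c.realAnalyticOn hm (c.card_le (e := 0) hP ho (not_le.1 hlt).le hm)).false_of_orth hs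
    (c.compact 0 hm) hso hP (not_le.1 hlt) fun x _ => ?_
  have h1 : (secondType κ P 0 x).re = P.eval x := by
    simp only [secondType]
    rw [← Complex.coe_algebraMap, Polynomial.aeval_algebraMap_apply, Polynomial.coe_aeval_eq_eval]
    rfl
  rw [h1]
  exact mul_self_nonneg _

lemma secondType_combination (c : Chain m Δ κ) (P R : ℝ[X]) (a b : ℝ) (hk : k ≤ m) {z : ℂ}
    (hz : z ∈ off (Δ k)) :
    secondType κ (Polynomial.C a * P + Polynomial.C b * R) k z =
      a * secondType κ P k z + b * secondType κ R k z := by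
  induction k generalizing z with
  | zero => simp [secondType]
  | succ k ih =>
    have ht := c.tame k hk
    have hK := c.compact k hk
    have h1 : ∀ (a : ℝ) P, ContinuousOn (fun x : ℝ => (a : ℂ) * (secondType κ P k x / (z - x)))
        (Δ (k + 1)) := fun a P => continuousOn_const.mul (Carried.continuousOn_div hz (c.continuousOn P hk))
    simp only [secondType, transform]
    rw [← ht.integral_const_mul, ← ht.integral_const_mul, ← ht.integral_add hK
      (h1 a P) (h1 b R)]
    refine ht.integral_congr fun x hx => ?_
    rw [ih (by omega) (c.mem_off hk hx)]
    ring

end Chain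

/-! ### Interlacing from a nonvanishing Wronskian. -/

section wronskian

variable {J : Set ℝ} {f g f' g' : ℝ → ℝ}

/-- If `g` had no zero in between, then Rolle's theorem for f/g would give a zero of the Wronskian,
the numerator of (f/g)'. -/
lemma exists_zero_between (hJ : J.OrdConnected) (hf : ∀ x ∈ J, HasDerivAt f (f' x) x)
    (hg : ∀ x ∈ J, HasDerivAt g (g' x) x) (hW : ∀ x ∈ J, f' x * g x - f x * g' x ≠ 0) {a b : ℝ}
    (ha : a ∈ J) (hb : b ∈ J) (hab : a < b) (h0a : f a = 0) (h0b : f b = 0) :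
    ∃ c ∈ Ioo a b, g c = 0 := by
  by_contra! hcon
  have hga : g a ≠ 0 := fun h => hW a ha (by rw [h, h0a]; ring)
  have hgb : g b ≠ 0 := fun h => hW b hb (by rw [h, h0b]; ring)
  have hIcc : Icc a b ⊆ J := hJ.out ha hb
  have hne : ∀ x ∈ Icc a b, g x ≠ 0 := fun x hx => by
    rcases hx.1.eq_or_lt with rfl | h1
    · exact hga
    rcases hx.2.eq_or_lt with rfl | h2
    · exact hgb
    exact hcon x ⟨h1, h2⟩
  have hd : ∀ x ∈ Icc a b, HasDerivAt (fun x => f x / g x)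
      ((f' x * g x - f x * g' x) / g x ^ 2) x := fun x hx =>
    (hf x (hIcc hx)).div (hg x (hIcc hx)) (hne x hx)
  obtain ⟨c, hc, h0⟩ := exists_hasDerivAt_eq_zero hab
    (fun x hx => (hd x hx).continuousAt.continuousWithinAt) (by simp [h0a, h0b])
    fun x hx => hd x (Ioo_subset_Icc_self hx)
  have hc' := Ioo_subset_Icc_self hc
  exact div_ne_zero (hW c (hIcc hc')) (pow_ne_zero 2 (hne c hc')) h0

lemma existsUnique_zero_between (hJ : J.OrdConnected) (hf : ∀ x ∈ J, HasDerivAt f (f' x) x)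
    (hg : ∀ x ∈ J, HasDerivAt g (g' x) x) (hW : ∀ x ∈ J, f' x * g x - f x * g' x ≠ 0) {a b : ℝ}
    (ha : a ∈ J) (hb : b ∈ J) (hab : a < b) (h0a : f a = 0) (h0b : f b = 0)
    (hne : ∀ c ∈ Ioo a b, f c ≠ 0) : ∃! c, c ∈ Ioo a b ∧ g c = 0 := by
  obtain ⟨c, hc, h0⟩ := exists_zero_between hJ hf hg hW ha hb hab h0a h0b
  -- Uniqueness by exchanging the roles: two zeros of `g` would enclose a further zero of `f`.
  have hW' : ∀ x ∈ J, g' x * f x - g x * f' x ≠ 0 := fun x hx h => hW x hx (by linarith)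
  have hIcc : Icc a b ⊆ J := hJ.out ha hb
  have key : ∀ u v : ℝ, u ∈ Ioo a b → v ∈ Ioo a b → g u = 0 → g v = 0 → ¬ u < v := by
    intro u v hu hv h1 h2 huv
    obtain ⟨w, hw, h3⟩ := exists_zero_between hJ hg hf hW' (hIcc (Ioo_subset_Icc_self hu))
      (hIcc (Ioo_subset_Icc_self hv)) huv h1 h2
    exact hne w ⟨hu.1.trans hw.1, hw.2.trans hv.2⟩ h3
  exact ⟨c, ⟨hc, h0⟩, fun d hd => le_antisymm (not_lt.1 (key c d hc hd.1 h0 hd.2))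
    (not_lt.1 (key d c hd.1 hc hd.2 h0))⟩

end wronskian

lemma two_le_analyticOrderAt {F : ℂ → ℂ} {z : ℂ} (hF : AnalyticAt ℂ F z) (h0 : F z = 0)
    (h1 : deriv F z = 0) : 2 ≤ analyticOrderAt F z := by
  have h2 : analyticOrderAt (deriv F) z + 1 = analyticOrderAt (fun w => F w - F z) z :=
    hF.analyticOrderAt_deriv_add_one
  rw [h0] at h2
  simp only [sub_zero] at h2
  rw [← h2, ← one_add_one_eq_two]
  gcongr
  exact Order.one_le_iff_ne_zero.2 (analyticOrderAt_ne_zero.2 ⟨hF.deriv, h1⟩)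

/-- If no nontrivial real combination of two real analytic functions has a multiple zero on `K`,
then their zeros on `K` interlace. -/
lemma RealAnalyticOn.separatesZeros {F G : ℂ → ℂ} {K : Set ℝ} (hF : RealAnalyticOn F K)
    (hG : RealAnalyticOn G K) (hK : Convex ℝ K) (hnt : K.Nontrivial)
    (h : ∀ a b : ℝ, (a ≠ 0 ∨ b ≠ 0) → ∀ x ∈ K,
      analyticOrderAt (fun z => a * F z + b * G z) x ≤ 1) : SeparatesZeros K F G := by
  have hd : ∀ {F : ℂ → ℂ}, RealAnalyticOn F K → ∀ x ∈ K,
      HasDerivAt (fun x : ℝ => (F x).re) (deriv F x).re x := fun hF x hx =>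
    (hF.analyticAt x hx).differentiableAt.hasDerivAt.real_of_complex
  have hz : ∀ {F : ℂ → ℂ}, RealAnalyticOn F K → ∀ x ∈ K, F x = 0 ↔ (F x).re = 0 := fun hF x hx =>
    ⟨fun h => by rw [h, Complex.zero_re], fun h => Complex.ext h (hF.im_eq_zero x hx)⟩
  have hne : (interior K).Nonempty := closure_nonempty_iff.1
    (hnt.nonempty.mono (RealAnalyticOn.subset_closure_interior hK hnt))
  have him : ∀ {F : ℂ → ℂ}, RealAnalyticOn F K → ∀ x ∈ K, (deriv F x).im = 0 := fun {F} hF x hx => by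
    have h1 := Complex.imCLM.hasFDerivAt.comp_hasDerivAt x
      (hF.analyticAt x hx).differentiableAt.hasDerivAt.comp_ofReal
    have h2 : HasDerivWithinAt (fun _ : ℝ => (0 : ℝ)) (deriv F x).im K x :=
      h1.hasDerivWithinAt.congr (fun y hy => (hF.im_eq_zero y hy).symm) (hF.im_eq_zero x hx).symm
    exact (uniqueDiffOn_convex hK hne x hx).eq_deriv _ h2 (hasDerivWithinAt_const _ _ _)
  have hre : ∀ {F : ℂ → ℂ}, RealAnalyticOn F K → ∀ x ∈ K, ((deriv F x).re : ℂ) = deriv F x :=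
    fun hF x hx => Complex.ext rfl (him hF x hx).symm
  have key : ∀ a b x : ℝ, (a ≠ 0 ∨ b ≠ 0) → x ∈ K → a * (F x).re + b * (G x).re = 0 →
      a * (deriv F x).re + b * (deriv G x).re ≠ 0 := fun a b x hab hx h0 h1 => by
    have hFx := hF.analyticAt x hx
    have hGx := hG.analyticAt x hx
    refine absurd (h a b hab x hx) (not_le.2 (lt_of_lt_of_le (by norm_num) (two_le_analyticOrderAt
      ((analyticAt_const.mul hFx).add (analyticAt_const.mul hGx)) ?_ ?_)))
    · rw [← hF.ofReal_re hx, ← hG.ofReal_re hx]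
      exact_mod_cast h0
    · refine ((hFx.differentiableAt.hasDerivAt.const_mul (a : ℂ)).add
        (hGx.differentiableAt.hasDerivAt.const_mul (b : ℂ))).deriv.trans ?_
      rw [← hre hF x hx, ← hre hG x hx]
      exact_mod_cast h1
  -- If the Wronskian vanishes at x, the combination with coefficients (G(x), -F(x)) has a multiple
  -- zero there. If both values vanish, the coefficients (G'(x), -F'(x)) do the same, or (1, 0) when
  -- F'(x) = 0.
  have hW : ∀ x ∈ K, (deriv F x).re * (G x).re - (F x).re * (deriv G x).re ≠ 0 := fun x hx h0 => by
    by_cases h1 : (G x).re ≠ 0 ∨ -(F x).re ≠ 0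
    · exact key _ _ x h1 hx (by ring) (by linarith)
    · push Not at h1
      refine key 1 0 x (Or.inl one_ne_zero) hx (by linarith) ?_
      by_contra h2
      refine key (deriv G x).re (-(deriv F x).re) x (Or.inr fun h3 => h2 (by linarith)) hx
        (by rw [h1.1, neg_eq_zero.1 h1.2]; ring) (by ring)
  intro a ha b hb hab h0a h0b hcons
  have hIcc := hK.ordConnected.out ha hb
  obtain ⟨c, ⟨hc, hc0⟩, huniq⟩ := existsUnique_zero_between hK.ordConnected (hd hF) (hd hG) hW ha hb hab
    ((hz hF a ha).1 h0a) ((hz hF b hb).1 h0b) fun c hc h0 => hcons c hc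
      ((hz hF c (hIcc (Ioo_subset_Icc_self hc))).2 h0)
  exact ⟨c, ⟨hc, (hz hG c (hIcc (Ioo_subset_Icc_self hc))).2 hc0⟩, fun d hd => huniq d
    ⟨hd.1, (hz hG d (hIcc (Ioo_subset_Icc_self hd.1))).1 hd.2⟩⟩

namespace Chain

variable {m : ℕ} {Δ : ℕ → Set ℝ} {κ : ℕ → SignedMeasure ℝ} {N : ℕ → ℕ} {P R : ℝ[X]} {k : ℕ}

lemma orthChain_combination (c : Chain m Δ κ) (hP : OrthChain m κ N P) (hR : OrthChain m κ N R)
    (a b : ℝ) : OrthChain m κ N (Polynomial.C a * P + Polynomial.C b * R) := fun k hk ν hν => by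
  have ht := c.tame k hk
  have h1 : ∀ (a : ℝ) P, ContinuousOn (fun x : ℝ => (a : ℂ) * (secondType κ P k x * (x : ℂ) ^ ν))
      (Δ (k + 1)) := fun a P => continuousOn_const.mul ((c.continuousOn P hk).mul (by fun_prop))
  have h2 : ∀ x ∈ Δ (k + 1), secondType κ (Polynomial.C a * P + Polynomial.C b * R) k x *
      (x : ℂ) ^ ν = a * (secondType κ P k x * (x : ℂ) ^ ν) +
        b * (secondType κ R k x * (x : ℂ) ^ ν) := fun x hx => by
    rw [c.secondType_combination P R a b hk.le (c.mem_off hk hx)]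
    ring
  rw [ht.integral_congr h2, ht.integral_add (c.compact k hk) (h1 a P) (h1 b R),
    ht.integral_const_mul, ht.integral_const_mul, hP k hk ν hν, hR k hk ν hν]
  simp

/-- Interlacing of the zeros of the functions of second type of two polynomials of consecutive
degrees that satisfy the same orthogonality relations. -/
theorem separatesZeros (c : Chain m Δ κ) (hP0 : P ≠ 0) (hP : OrthChain m κ N P)
    (hR : OrthChain m κ N R) (hPdeg : P.natDegree ≤ ∑ i ∈ Finset.Ico 0 m, N i)
    (hRdeg : R.natDegree = P.natDegree + 1) (hk : k < m) :
    SeparatesZeros (Δ (k + 1)) (secondType κ P k) (secondType κ R k) ∧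
      SeparatesZeros (Δ (k + 1)) (secondType κ R k) (secondType κ P k) := by
  have hR0 : R ≠ 0 := fun h => by rw [h] at hRdeg; simp at hRdeg
  have hne : ∀ a b : ℝ, (a ≠ 0 ∨ b ≠ 0) → Polynomial.C a * P + Polynomial.C b * R ≠ 0 := by
    intro a b hab h0
    by_cases hb : b = 0
    · have ha : a ≠ 0 := by simpa [hb] using hab
      rw [hb, Polynomial.C_0, zero_mul, add_zero] at h0
      exact mul_ne_zero (Polynomial.C_ne_zero.2 ha) hP0 h0
    · have h1 := congrArg (fun p => p.coeff R.natDegree) h0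
      simp only [Polynomial.coeff_add, Polynomial.coeff_C_mul, Polynomial.coeff_zero] at h1
      rw [Polynomial.coeff_eq_zero_of_natDegree_lt (p := P) (by omega), mul_zero, zero_add] at h1
      exact mul_ne_zero hb (Polynomial.leadingCoeff_ne_zero.2 hR0) h1
  -- The degree of `R` exceeds the number of relations by at most one, the excess that
  -- `order_le_one` tolerates.
  have hdeg : ∀ a b : ℝ, (Polynomial.C a * P + Polynomial.C b * R).natDegree ≤
      ∑ i ∈ Finset.Ico 0 m, N i + 1 := fun a b => by
    refine (Polynomial.natDegree_add_le_of_degree_le (n := R.natDegree)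
      ((Polynomial.natDegree_C_mul_le _ _).trans (by omega)) (Polynomial.natDegree_C_mul_le _ _)).trans
      (by omega)
  have horder : ∀ a b : ℝ, (a ≠ 0 ∨ b ≠ 0) → ∀ x ∈ Δ (k + 1),
      analyticOrderAt (fun z => a * secondType κ P k z + b * secondType κ R k z) x ≤ 1 := by
    intro a b hab x hx
    refine le_of_eq_of_le (analyticOrderAt_congr ?_)
      (c.order_le_one (hne a b hab) (c.orthChain_combination hP hR a b) (hdeg a b) hk hx)
    have hopen : IsOpen (off (Δ k)) := by
      cases k with
      | zero => rw [c.zero]; exact isOpen_off isCompact_empty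
      | succ k => exact isOpen_off (c.compact k (by omega))
    filter_upwards [hopen.mem_nhds (c.mem_off hk hx)] with z hz
    rw [c.secondType_combination P R a b hk.le hz]
  have hPr := c.realAnalyticOn hk (c.card_le (e := 0) hP0 hP hPdeg hk)
  have hRr := c.realAnalyticOn hk (c.card_le (e := 1) hR0 hR (by omega) hk)
  have hnt : (Δ (k + 1)).Nontrivial :=
    ((c.tame k hk).infinite.mono (c.tame k hk).supp_subset).nontrivial
  exact ⟨hPr.separatesZeros hRr (c.convex k hk) hnt horder,
    hRr.separatesZeros hPr (c.convex k hk) hnt fun a b hab x hx => by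
      simpa only [add_comm] using horder b a hab.symm x hx⟩

end Chain

/-! ### Product identities for Cauchy transforms. -/

lemma eqOn_off_of_im_ne_zero {K : Set ℝ} {F G : ℂ → ℂ} (hF : ContinuousOn F (off K))
    (hG : ContinuousOn G (off K))
    (h : ∀ z : ℂ, z.im ≠ 0 → F z = G z) : ∀ z ∈ off K, F z = G z := by
  have hcl : closure {z : ℂ | z.im ≠ 0} = univ := by
    have h1 := Complex.closure_preimage_im {0}ᶜ
    rw [closure_compl_singleton] at h1
    exact h1
  exact Set.EqOn.of_subset_closure (s := {z : ℂ | z.im ≠ 0}) (fun z hz => h z hz) hF hG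
    (fun z hz => mem_off_of_im_ne_zero hz) (by rw [hcl]; exact subset_univ _)

section angle

variable {s t τ w w' : SignedMeasure ℝ} {K L : Set ℝ}

lemma Tame.angle (hs : Tame s K) (ht : Tame t L) (hK : IsCompact K) (hKc : Convex ℝ K)
    (hL : IsCompact L) (hLc : Convex ℝ L) (hKL : Disjoint K L) : Tame (angle s t) K :=
  hs.density hK (ht.signedOn_cauchyReal hL hLc ht.nonempty hKc hKL.symm)

lemma supp_angle (hs : Tame s K) (ht : Tame t L) (hK : IsCompact K) (hKc : Convex ℝ K)
    (hL : IsCompact L) (hLc : Convex ℝ L) (hKL : Disjoint K L) : supp (angle s t) = supp s :=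
  supp_density hK hs.toCarried (ht.signedOn_cauchyReal hL hLc ht.nonempty hKc hKL.symm)

lemma integral_angle (hs : Tame s K) (ht : Tame t L) (hK : IsCompact K) (hKc : Convex ℝ K)
    (hL : IsCompact L) (hLc : Convex ℝ L) (hKL : Disjoint K L) (f : ℝ → ℂ) :
    ∫ᵛ x, f x ∂<•(Nikishin.angle s t) = ∫ᵛ x, cauchy t x * f x ∂<•s := by
  rw [Nikishin.angle, integral_density hK hs.toCarried
    (ht.signedOn_cauchyReal hL hLc ht.nonempty hKc hKL.symm)]
  simp_rw [ht.cauchy_ofReal]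

lemma transform_angle (hs : Tame s K) (ht : Tame t L) (hK : IsCompact K) (hKc : Convex ℝ K)
    (hL : IsCompact L) (hLc : Convex ℝ L) (hKL : Disjoint K L) (g : ℝ → ℂ) (z : ℂ) :
    transform (Nikishin.angle s t) g z = transform s (fun x => cauchy t x * g x) z := by
  rw [transform, integral_angle hs ht hK hKc hL hLc hKL]
  simp_rw [transform, mul_div_assoc]

lemma Carried.continuousOn_cauchy_real (h : Carried s K) (hK : IsCompact K) (hKL : Disjoint K L) :
    ContinuousOn (fun x : ℝ => cauchy s x) L := by
  simp_rw [h.cauchy_ofReal]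
  exact Complex.continuous_ofReal.comp_continuousOn (h.continuousOn_cauchyReal hK hKL)

/-- `∫ s(du) / (z - u)` against `w` and `∫ w(dt) / (z - t)` against `s` add up to the product of
the Cauchy transforms. -/
lemma transform_cauchy_add (hs : Carried s K) (hw : Carried w L) (hK : IsCompact K)
    (hL : IsCompact L) (hKL : Disjoint K L) {z : ℂ} (hzK : z ∈ off K) (hzL : z ∈ off L) :
    transform w (fun u => cauchy s u) z + transform s (fun t => cauchy w t) z =
      cauchy s z * cauchy w z := by
  have huK : ∀ u ∈ L, (u : ℂ) ∈ off K := fun u hu => ofReal_mem_off.2 fun h =>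
    disjoint_left.1 hKL h hu
  have hcw := hw.continuousOn_cauchy_real hL hKL.symm
  have h1 : ∀ u ∈ L, cauchy s u / (z - u) = ∫ᵛ t, ((u : ℂ) - t)⁻¹ * (z - u)⁻¹ ∂<•s :=
    fun u _ => by rw [hs.integral_mul_const]; rfl
  have h2 : ∀ t ∈ K, ∫ᵛ u, ((u : ℂ) - t)⁻¹ * (z - u)⁻¹ ∂<•w =
      (z - t)⁻¹ * cauchy w z - cauchy w t / (z - t) := fun t ht => by
    have htL : (t : ℂ) ∈ off L := ofReal_mem_off.2 fun h => disjoint_left.1 hKL ht h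
    have hzt := sub_ne_zero_of_mem_off hzK ht
    have h3 : ∀ u ∈ L, ((u : ℂ) - t)⁻¹ * (z - u)⁻¹ =
        (z - t)⁻¹ * (z - u)⁻¹ - (z - t)⁻¹ * ((t : ℂ) - u)⁻¹ := fun u hu => by
      have e1 := sub_ne_zero_of_mem_off hzL hu
      have e2 := sub_ne_zero_of_mem_off htL hu
      have e3 := sub_ne_zero_of_mem_off (huK u hu) ht
      field_simp
      ring
    have e4 : ContinuousOn (fun u : ℝ => (z - t)⁻¹ * (z - u)⁻¹) L := continuousOn_const.mul
      (ContinuousOn.inv₀ (by fun_prop) fun x hx => sub_ne_zero_of_mem_off hzL hx)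
    have e5 : ContinuousOn (fun u : ℝ => (z - t)⁻¹ * ((t : ℂ) - u)⁻¹) L := continuousOn_const.mul
      (ContinuousOn.inv₀ (by fun_prop) fun x hx => sub_ne_zero_of_mem_off htL hx)
    rw [hw.integral_congr h3, hw.integral_sub hL e4 e5, hw.integral_const_mul, hw.integral_const_mul,
      div_eq_mul_inv, mul_comm (cauchy w t)]
    rfl
  rw [transform, hw.integral_congr h1, hw.integral_integral_swap hs hL hK, hs.integral_congr h2,
    hs.integral_sub hK, hs.integral_mul_const]
  · rw [transform, sub_add_cancel]
    rfl
  · exact (ContinuousOn.inv₀ (by fun_prop) fun x hx => sub_ne_zero_of_mem_off hzK hx).mul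
      continuousOn_const
  · exact Carried.continuousOn_div hzK hcw
  · exact (ContinuousOn.inv₀ (by fun_prop) fun p hp => sub_ne_zero_of_mem_off (huK _ hp.1) hp.2).mul
      (ContinuousOn.inv₀ (by fun_prop) fun p hp => sub_ne_zero_of_mem_off hzL hp.1)

/-- The Cauchy transform of `⟨τ, ŝ w⟩`, where `τ` is inverse to `s`. -/
lemma cauchy_angle_mul_cauchy (hs : Tame s K) (hτ : Tame τ K) (hw : Tame w L) (hw' : Tame w' L)
    (hK : IsCompact K) (hKc : Convex ℝ K) (hL : IsCompact L) (hLc : Convex ℝ L) (hKL : Disjoint K L)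
    {l₀ l₁ : ℝ} (hinv : ∀ z ∈ off K, (l₁ * z + l₀ + cauchy τ z) * cauchy s z = 1)
    (hww : ∀ f : ℝ → ℂ, ∫ᵛ x, f x ∂<•w' = ∫ᵛ x, cauchy s x * f x ∂<•w) {z : ℂ} (hz : z ∈ off K) :
    cauchy (angle τ w') z * cauchy s z =
      -transform s (fun t => cauchy w t) z - l₁ * (∫ᵛ x, cauchy s x ∂<•w) * cauchy s z := by
  have hcs := hs.continuousOn_cauchy hK
  have hcw := hw.toCarried.continuousOn_cauchy_real hL hKL.symm
  have hta := (hτ.angle hw' hK hKc hL hLc hKL)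
  -- The computation needs `z` off `L` as well as off `K`. It is done for nonreal `z`; continuity
  -- then covers the real points, including those of `L`.
  refine eqOn_off_of_im_ne_zero ((hta.continuousOn_cauchy hK).mul hcs)
    ((hs.differentiableOn_transform hK hcw).continuousOn.neg.sub (continuousOn_const.mul hcs))
    (fun z hz => ?_) z hz
  change cauchy (angle τ w') z * cauchy s z =
    -transform s (fun t => cauchy w t) z - l₁ * (∫ᵛ x, cauchy s x ∂<•w) * cauchy s z
  have hzK : z ∈ off K := mem_off_of_im_ne_zero hz
  have hzL : z ∈ off L := mem_off_of_im_ne_zero hz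
  have hcsL : ContinuousOn (fun u : ℝ => cauchy s u) L :=
    hs.toCarried.continuousOn_cauchy_real hK hKL
  have huK : ∀ u ∈ L, (u : ℂ) ∈ off K := fun u hu => ofReal_mem_off.2 fun h =>
    disjoint_left.1 hKL h hu
  have h1 : cauchy (angle τ w') z =
      ∫ᵛ u, cauchy s u * ((cauchy τ z - cauchy τ u) / (z - u)) ∂<•w := by
    rw [← hww, cauchy_eq_transform, transform_angle hτ hw' hK hKc hL hLc hKL]
    have e1 : ∀ t ∈ K, cauchy w' t * 1 / (z - t) = ∫ᵛ u, ((t : ℂ) - u)⁻¹ * (z - t)⁻¹ ∂<•w' :=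
      fun t _ => by rw [hw'.integral_mul_const, mul_one]; rfl
    rw [transform, hτ.integral_congr e1, hτ.integral_integral_swap hw'.toCarried hK hL]
    · refine hw'.integral_congr fun u hu => ?_
      have hzu : z - u ≠ 0 := sub_ne_zero_of_mem_off hzL hu
      have e2 : ∀ t ∈ K, ((t : ℂ) - u)⁻¹ * (z - t)⁻¹ =
          ((z - t)⁻¹ - ((u : ℂ) - t)⁻¹) * (z - u)⁻¹ := fun t ht => by
        have e3 := sub_ne_zero_of_mem_off hzK ht
        have e4 := sub_ne_zero_of_mem_off (huK u hu) ht
        have e5 : (t : ℂ) - u ≠ 0 := by rw [← neg_sub]; exact neg_ne_zero.2 e4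
        field_simp
        ring
      rw [hτ.integral_congr e2, hτ.integral_mul_const, hτ.integral_sub hK, div_eq_mul_inv]
      · rfl
      · exact ContinuousOn.inv₀ (by fun_prop) fun x hx => sub_ne_zero_of_mem_off hzK hx
      · exact ContinuousOn.inv₀ (by fun_prop) fun x hx => sub_ne_zero_of_mem_off (huK u hu) hx
    · refine ContinuousOn.mul (ContinuousOn.inv₀ (by fun_prop) fun p hp => ?_)
        (ContinuousOn.inv₀ (by fun_prop) fun p hp => sub_ne_zero_of_mem_off hzK hp.1)
      rw [← neg_sub]
      exact neg_ne_zero.2 (sub_ne_zero_of_mem_off (huK _ hp.2) hp.1)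
  -- Replace τ̂ by 1/ŝ - ℓ at both points: the difference quotient of ℓ is the constant `l₁`, which
  -- is why no linear factor remains.
  have h2 : ∀ u ∈ L, cauchy s u * ((cauchy τ z - cauchy τ u) / (z - u)) * cauchy s z =
      cauchy s u / (z - u) - l₁ * cauchy s z * cauchy s u - cauchy s z * (z - u)⁻¹ := fun u hu => by
    have hzu : z - u ≠ 0 := sub_ne_zero_of_mem_off hzL hu
    have e1 := hinv z hzK
    have e2 := hinv u (huK u hu)
    field_simp
    linear_combination cauchy s u * e1 - cauchy s z * e2
  rw [h1, ← hw.integral_mul_const, hw.integral_congr h2, hw.integral_sub hL, hw.integral_sub hL,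
    hw.integral_const_mul, hw.integral_const_mul]
  · have h3 := transform_cauchy_add hs.toCarried hw.toCarried hK hL hKL hzK hzL
    change transform w _ z - _ - cauchy s z * cauchy w z = _
    linear_combination h3
  · exact Carried.continuousOn_div hzL hcsL
  · exact continuousOn_const.mul hcsL
  · exact (Carried.continuousOn_div hzL hcsL).sub (continuousOn_const.mul hcsL)
  · exact continuousOn_const.mul (ContinuousOn.inv₀ (by fun_prop) fun x hx => sub_ne_zero_of_mem_off hzL hx)

/-- A relation between Cauchy transforms on the next interval is inherited. -/
lemma exists_cauchy_angle_mul_cauchy {μ s₁ : SignedMeasure ℝ} {A : Finset ℕ} {c : ℕ → ℂ}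
    {u : ℕ → ℝ → ℂ} {p₀ p₁ : ℂ} (hμ : Tame μ K) (hs₁ : Tame s₁ L) (hτ : Tame τ K) (hw : Tame w L)
    (hw' : Tame w' L)
    (hK : IsCompact K) (hKc : Convex ℝ K) (hL : IsCompact L) (hLc : Convex ℝ L) (hKL : Disjoint K L)
    {l₀ l₁ : ℝ} (hinv : ∀ z ∈ off K, (l₁ * z + l₀ + cauchy τ z) * cauchy (angle μ s₁) z = 1)
    (hww : ∀ f : ℝ → ℂ, ∫ᵛ x, f x ∂<•w' = ∫ᵛ x, cauchy (angle μ s₁) x * f x ∂<•w)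
    (hu : ∀ a ∈ A, ContinuousOn (u a) K)
    (hrel : ∀ t ∈ K, cauchy w t * cauchy s₁ t =
      ∑ a ∈ A, c a * u a t + (p₀ + p₁ * t) * cauchy s₁ t) :
    ∃ d q : ℂ, ∀ z ∈ off K, cauchy (angle τ w') z * cauchy (angle μ s₁) z =
      d * p₁ - ∑ a ∈ A, c a * transform μ (u a) z + (q - p₁ * z) * cauchy (angle μ s₁) z := by
  have hs := hμ.angle hs₁ hK hKc hL hLc hKL
  -- The term p₁ t under the integral becomes p₁ z times the transform minus `p₁` times the total
  -- mass; the mass is the first witness.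
  refine ⟨∫ᵛ x, (1 : ℂ) ∂<•(angle μ s₁),
    -p₀ - l₁ * (∫ᵛ x, cauchy (angle μ s₁) x ∂<•w), fun z hz => ?_⟩
  rw [cauchy_angle_mul_cauchy hs hτ hw hw' hK hKc hL hLc hKL hinv hww hz,
    transform_angle hμ hs₁ hK hKc hL hLc hKL]
  have hc1 := hs₁.toCarried.continuousOn_cauchy_real hL hKL.symm
  have h1 : ∀ t ∈ K, cauchy s₁ t * cauchy w t / (z - t) =
      ∑ a ∈ A, c a * (u a t / (z - t)) + p₀ * (cauchy s₁ t / (z - t)) +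
        p₁ * (cauchy s₁ t * t / (z - t)) := fun t ht => by
    rw [mul_comm (cauchy s₁ t), hrel t ht, add_div, Finset.sum_div]
    simp_rw [mul_div_assoc]
    ring
  have h2 := hs.mul_transform hK (g := fun _ => 1) continuousOn_const hz
  rw [← cauchy_eq_transform, transform_angle hμ hs₁ hK hKc hL hLc hKL] at h2
  have e1 : ∀ a ∈ A, ContinuousOn (fun t : ℝ => c a * (u a t / (z - t))) K := fun a ha =>
    continuousOn_const.mul (Carried.continuousOn_div hz (hu a ha))
  have e2 : ContinuousOn (fun t : ℝ => p₀ * (cauchy s₁ t / (z - t))) K :=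
    continuousOn_const.mul (Carried.continuousOn_div hz hc1)
  have e3 : ContinuousOn (fun t : ℝ => p₁ * (cauchy s₁ t * t / (z - t))) K :=
    continuousOn_const.mul (Carried.continuousOn_div hz (hc1.mul (by fun_prop)))
  have e0 : ContinuousOn (fun t : ℝ => ∑ a ∈ A, c a * (u a t / (z - t))) K :=
    continuousOn_finsetSum _ e1
  have e02 : ContinuousOn (fun t : ℝ => ∑ a ∈ A, c a * (u a t / (z - t)) +
      p₀ * (cauchy s₁ t / (z - t))) K := e0.add e2
  have h3 : transform μ (fun t => cauchy s₁ t) z = cauchy (angle μ s₁) z := by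
    rw [cauchy_eq_transform (angle μ s₁), transform_angle hμ hs₁ hK hKc hL hLc hKL]
    simp only [mul_one]
  have h4 : transform μ (fun x => cauchy s₁ x * cauchy w x) z =
      ∑ a ∈ A, c a * transform μ (u a) z + p₀ * cauchy (angle μ s₁) z +
        p₁ * transform μ (fun t => cauchy s₁ t * t) z := by
    rw [transform, hμ.integral_congr h1, hμ.integral_add hK e02 e3, hμ.integral_add hK e0 e2, hμ.integral_sum hK _ e1,
      hμ.integral_const_mul, hμ.integral_const_mul, ← h3]
    simp_rw [hμ.integral_const_mul]
    rfl
  simp only [mul_one] at h2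
  linear_combination -h4 + p₁ * h2

/-- Moving a factor z under the integral costs the moment ∫ g x^ν ds, zero for ν < N; hence
exponents up to and including `N` are allowed. -/
lemma transform_mul_pow (hs : Carried s K) (hK : IsCompact K) {g : ℝ → ℂ} (hg : ContinuousOn g K)
    {N : ℕ} (ho : Orth s g N) {ν : ℕ} (hν : ν ≤ N) {z : ℂ} (hz : z ∈ off K) :
    transform s g z * z ^ ν = transform s (fun x => g x * (x : ℂ) ^ ν) z := by
  induction ν with
  | zero => simp
  | succ ν ih =>
    rw [pow_succ, ← mul_assoc, ih (by omega), mul_comm, hs.mul_transform hK (by fun_prop) hz,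
      ho ν (by omega), zero_add]
    congr 1
    ext x
    ring

/-- Moments of a Cauchy transform. -/
lemma integral_transform_mul_pow (hs : Carried s K) (hw : Carried w L) (hK : IsCompact K)
    (hL : IsCompact L) (hKL : Disjoint K L) {g : ℝ → ℂ} (hg : ContinuousOn g K) {N : ℕ}
    (ho : Orth s g N) {ν : ℕ} (hν : ν ≤ N) :
    ∫ᵛ y, transform s g y * (y : ℂ) ^ ν ∂<•w = -∫ᵛ x, g x * (x : ℂ) ^ ν * cauchy w x ∂<•s := by
  have hy : ∀ y ∈ L, (y : ℂ) ∈ off K := fun y hy => ofReal_mem_off.2 fun h =>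
    disjoint_left.1 hKL h hy
  have h1 : ∀ y ∈ L, transform s g y * (y : ℂ) ^ ν =
      ∫ᵛ x, g x * (x : ℂ) ^ ν / ((y : ℂ) - x) ∂<•s := fun y h =>
    transform_mul_pow hs hK hg ho hν (hy y h)
  rw [hw.integral_congr h1, hw.integral_integral_swap hs hL hK, ← neg_one_mul,
    ← hs.integral_const_mul]
  · refine hs.integral_congr fun x hx => ?_
    rw [cauchy, ← hw.integral_const_mul, ← hw.integral_const_mul]
    refine hw.integral_congr fun y hyL => ?_
    have h2 := sub_ne_zero_of_mem_off (hy y hyL) hx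
    have h3 : (x : ℂ) - y ≠ 0 := by rw [← neg_sub]; exact neg_ne_zero.2 h2
    field_simp
    ring
  · refine ContinuousOn.div (ContinuousOn.mul (hg.comp continuousOn_snd fun p hp => hp.2)
      (by fun_prop)) (by fun_prop) fun p hp => sub_ne_zero_of_mem_off (hy _ hp.1) hp.2

end angle

/-! ### Brackets and the passage to the following system. -/

lemma bracket_self (μ : ℕ → SignedMeasure ℝ) (i : ℕ) : bracket μ i i = μ i := by
  simp [bracket, bracketAux]

lemma bracket_of_lt (μ : ℕ → SignedMeasure ℝ) {i j : ℕ} (h : i < j) :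
    bracket μ i j = angle (μ i) (bracket μ (i + 1) j) := by
  rw [bracket, bracket, show j - i = j - (i + 1) + 1 by omega]
  rfl

lemma bracket_congr {μ ν : ℕ → SignedMeasure ℝ} {i j : ℕ} (hij : i ≤ j)
    (h : ∀ a, i ≤ a → a ≤ j → μ a = ν a) : bracket μ i j = bracket ν i j := by
  induction hd : j - i generalizing i with
  | zero =>
    obtain rfl : i = j := by omega
    rw [bracket_self, bracket_self, h i le_rfl le_rfl]
  | succ d ih =>
    rw [bracket_of_lt μ (by omega), bracket_of_lt ν (by omega), h i le_rfl hij,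
      ih (by omega) (fun a h1 h2 => h a (by omega) h2) (by omega)]

/-- Measures `μ (k + 1), …, μ m` on compact intervals `Δ (k + 1), …, Δ m`, consecutive intervals
being disjoint. -/
structure IsSystem (k m : ℕ) (Δ : ℕ → Set ℝ) (μ : ℕ → SignedMeasure ℝ) : Prop where
  compact : ∀ j, k < j → j ≤ m → IsCompact (Δ j)
  convex : ∀ j, k < j → j ≤ m → Convex ℝ (Δ j)
  disjoint : ∀ j, k < j → j < m → Disjoint (Δ j) (Δ (j + 1))
  tame : ∀ j, k < j → j ≤ m → Tame (μ j) (Δ j)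

/-- The Cauchy transform of `⟨μ_i, …, μ_a⟩`, taken to be `1` if `a < i`. -/
def tailCauchy (μ : ℕ → SignedMeasure ℝ) (i a : ℕ) (z : ℂ) : ℂ :=
  if a < i then 1 else cauchy (bracket μ i a) z

/-- The measure whose density `⟨μ_{i-1}, …, μ_r⟩^` is `⟨ν_i, …, ν_j⟩`, where `ν` is the system
following `μ`. -/
def reduced (μ ν : ℕ → SignedMeasure ℝ) (r i j : ℕ) : SignedMeasure ℝ :=
  if j = i then inverse (bracket μ i r) else angle (inverse (bracket μ i r)) (bracket ν (i + 1) j)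

lemma integral_angle_density {σ t : SignedMeasure ℝ} {g : ℝ → ℝ} {K L : Set ℝ} (hσ : Tame σ K)
    (ht : Tame t L) (hg : SignedOn g K) (hK : IsCompact K) (hKc : Convex ℝ K)
    (hL : IsCompact L) (hLc : Convex ℝ L) (hKL : Disjoint K L) (f : ℝ → ℂ) :
    ∫ᵛ x, f x ∂<•(angle (density g σ) t) = ∫ᵛ x, (g x : ℂ) * f x ∂<•(angle σ t) := by
  rw [integral_angle (hσ.density hK hg) ht hK hKc hL hLc hKL, integral_density hK hσ.toCarried hg,
    integral_angle hσ ht hK hKc hL hLc hKL]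
  simp_rw [mul_left_comm]

namespace IsSystem

variable {k m r i j a : ℕ} {Δ : ℕ → Set ℝ} {μ ν : ℕ → SignedMeasure ℝ}

lemma tame_bracket (h : IsSystem k m Δ μ) (hi : k < i) (hij : i ≤ j) (hj : j ≤ m) :
    Tame (bracket μ i j) (Δ i) := by
  induction hd : j - i generalizing i with
  | zero =>
    obtain rfl : i = j := by omega
    rw [bracket_self]
    exact h.tame i hi hj
  | succ d ih =>
    rw [bracket_of_lt μ (by omega)]
    exact (h.tame i hi (by omega)).angle (ih (by omega) (by omega) (by omega))
      (h.compact i hi (by omega)) (h.convex i hi (by omega)) (h.compact _ (by omega) (by omega))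
      (h.convex _ (by omega) (by omega)) (h.disjoint i hi (by omega))

lemma supp_bracket (h : IsSystem k m Δ μ) (hi : k < i) (hij : i ≤ j) (hj : j ≤ m) :
    supp (bracket μ i j) = supp (μ i) := by
  rcases hij.eq_or_lt with rfl | hij
  · rw [bracket_self]
  · rw [bracket_of_lt μ hij]
    exact supp_angle (h.tame i hi (by omega)) (h.tame_bracket (by omega) hij hj)
      (h.compact i hi (by omega)) (h.convex i hi (by omega)) (h.compact _ (by omega) (by omega))
      (h.convex _ (by omega) (by omega)) (h.disjoint i hi (by omega))

lemma integral_bracket (h : IsSystem k m Δ μ) (hi : k < i) (hij : i ≤ j) (hj : j ≤ m) (f : ℝ → ℂ) :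
    ∫ᵛ x, f x ∂<•(bracket μ i j) = ∫ᵛ x, tailCauchy μ (i + 1) j x * f x ∂<•(μ i) := by
  rcases hij.eq_or_lt with rfl | hij
  · rw [bracket_self]
    simp [tailCauchy]
  · rw [bracket_of_lt μ hij, integral_angle (h.tame i hi (by omega)) (h.tame_bracket (by omega) hij hj)
      (h.compact i hi (by omega)) (h.convex i hi (by omega)) (h.compact _ (by omega) (by omega))
      (h.convex _ (by omega) (by omega)) (h.disjoint i hi (by omega))]
    simp_rw [tailCauchy, if_neg (not_lt.2 (Nat.succ_le_of_lt hij))]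

lemma continuousOn_tailCauchy (h : IsSystem k m Δ μ) (hi : k < i) (him : i ≤ m) (hj : j ≤ m) :
    ContinuousOn (fun x : ℝ => tailCauchy μ (i + 1) j x) (Δ i) := by
  simp only [tailCauchy]
  split_ifs with h1
  · exact continuousOn_const
  · exact (h.tame_bracket (by omega) (not_lt.1 h1) hj).toCarried.continuousOn_cauchy_real
      (h.compact _ (by omega) (by omega)) (h.disjoint i hi (by omega)).symm

lemma transform_tailCauchy (h : IsSystem k m Δ μ) (hi : k < i) (hij : i ≤ j) (hj : j ≤ m) (z : ℂ) :
    transform (μ i) (fun x => tailCauchy μ (i + 1) j x) z = tailCauchy μ i j z := by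
  rw [tailCauchy, if_neg (not_lt.2 hij), cauchy, h.integral_bracket hi hij hj]
  rfl

lemma mem_off (h : IsSystem k m Δ μ) (hi : k < i) (him : i < m) {x : ℝ} (hx : x ∈ Δ i) :
    (x : ℂ) ∈ off (Δ (i + 1)) :=
  ofReal_mem_off.2 fun h' => disjoint_left.1 (h.disjoint i hi him) hx h'

lemma tame_inverse (h : IsSystem k m Δ μ) (hi : k < i) (hij : i ≤ j) (hj : j ≤ m) :
    Tame (inverse (bracket μ i j)) (Δ i) :=
  (inverse_spec (h.tame_bracket hi hij hj) (h.compact i hi (by omega)) (h.convex i hi (by omega))).1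

lemma signedOn (h : IsSystem k m Δ μ) (hi : k < i) (hij : i ≤ j) (hj : j ≤ m) {L : Set ℝ}
    (hL : Convex ℝ L) (hd : Disjoint (Δ i) L) : SignedOn (cauchyReal (bracket μ i j)) L :=
  have ht := h.tame_bracket hi hij hj
  ht.signedOn_cauchyReal (h.compact i hi (by omega)) (h.convex i hi (by omega)) ht.nonempty hL hd

/-- The intervals stay the same. Each new density is a Cauchy transform from the preceding interval,
disjoint from the present one, so it has no zeros or sign changes there. -/
lemma next (h : IsSystem k m Δ μ) (hr : k + 1 ≤ r) (hrm : r ≤ m) :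
    IsSystem (k + 1) m Δ (nextSystem μ k r) where
  compact j h1 := h.compact j (by omega)
  convex j h1 := h.convex j (by omega)
  disjoint j h1 := h.disjoint j (by omega)
  tame j h1 h2 := by
    rw [nextSystem]
    split_ifs with c1 c2 c3 c4
    · exact h.tame j (by omega) h2
    · rw [c2]; exact h.tame_inverse (by omega) (by omega) hrm
    · obtain ⟨i, rfl⟩ : ∃ i, j = i + 1 := ⟨j - 1, by omega⟩
      exact (h.tame_inverse (by omega) c3 hrm).density (h.compact _ (by omega) (by omega))
        (h.signedOn (by omega) (by omega) hrm (h.convex _ (by omega) (by omega))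
          (h.disjoint i (by omega) (by omega)))
    · rw [c4]
      exact (h.tame _ (by omega) (by omega)).density (h.compact _ (by omega) (by omega))
        (h.signedOn (by omega) (by omega) hrm (h.convex _ (by omega) (by omega))
          (h.disjoint r (by omega) (by omega)))
    · exact h.tame j (by omega) h2

lemma tame_reduced (h : IsSystem k m Δ μ) (hν : IsSystem (k + 1) m Δ ν) (hi : k + 1 < i) (hir : i ≤ r)
    (hrm : r ≤ m) (hij : i ≤ j) (hj : j ≤ m) : Tame (reduced μ ν r i j) (Δ i) := by
  rw [reduced]
  split_ifs with h1
  · exact h.tame_inverse (by omega) hir hrm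
  · exact (h.tame_inverse (by omega) hir hrm).angle (hν.tame_bracket (by omega) (by omega) hj)
      (h.compact i (by omega) (by omega)) (h.convex i (by omega) (by omega)) (h.compact _ (by omega) (by omega))
      (h.convex _ (by omega) (by omega)) (h.disjoint i (by omega) (by omega))

lemma bracket_next_first (hr : k + 1 < r) (hj : k + 2 ≤ j) :
    bracket (nextSystem μ k r) (k + 2) j = reduced μ (nextSystem μ k r) r (k + 2) j := by
  have h1 : nextSystem μ k r (k + 2) = inverse (bracket μ (k + 2) r) := by
    simp [nextSystem, hr.ne']
  rw [reduced]
  split_ifs with h2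
  · rw [h2, bracket_self, h1]
  · rw [bracket_of_lt _ (by omega), h1]

lemma integral_bracket_of_density {σ : SignedMeasure ℝ} {g : ℝ → ℝ} (hν : IsSystem k m Δ ν)
    (hi : k < i) (hij : i ≤ j) (hj : j ≤ m) (hσ : Tame σ (Δ i)) (hg : SignedOn g (Δ i))
    (h1 : ν i = density g σ) (f : ℝ → ℂ) :
    ∫ᵛ x, f x ∂<•(bracket ν i j) =
      ∫ᵛ x, (g x : ℂ) * f x ∂<•(if j = i then σ else angle σ (bracket ν (i + 1) j)) := by
  split_ifs with h2
  · rw [h2, bracket_self, h1, integral_density (hν.compact i hi (by omega)) hσ.toCarried hg]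
  · rw [bracket_of_lt _ (by omega), h1]
    exact integral_angle_density hσ (hν.tame_bracket (by omega) (by omega) hj) hg
      (hν.compact i hi (by omega)) (hν.convex i hi (by omega)) (hν.compact _ (by omega) (by omega))
      (hν.convex _ (by omega) (by omega)) (hν.disjoint i hi (by omega)) f

lemma integral_bracket_next (h : IsSystem k m Δ μ) (hi : k + 1 < i) (hir : i + 1 ≤ r)
    (hrm : r ≤ m) (hij : i + 1 ≤ j) (hj : j ≤ m) (f : ℝ → ℂ) :
    ∫ᵛ x, f x ∂<•(bracket (nextSystem μ k r) (i + 1) j) =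
      ∫ᵛ x, cauchy (bracket μ i r) x * f x ∂<•(reduced μ (nextSystem μ k r) r (i + 1) j) := by
  rw [(h.next (r := r) (by omega) hrm).integral_bracket_of_density (by omega) hij hj
    (h.tame_inverse (by omega) hir hrm) (h.signedOn (by omega) (by omega) hrm
      (h.convex _ (by omega) (by omega)) (h.disjoint i (by omega) (by omega)))
    (by rw [nextSystem, if_neg (by omega), if_neg (by omega), if_pos hir, Nat.add_sub_cancel])]
  simp_rw [(h.tame_bracket (i := i) (j := r) (by omega) (by omega) hrm).cauchy_ofReal]
  rfl

lemma integral_bracket_next_last (h : IsSystem k m Δ μ) (hr : k + 1 < r) (hrj : r < j) (hj : j ≤ m)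
    (f : ℝ → ℂ) :
    ∫ᵛ x, f x ∂<•(bracket (nextSystem μ k r) (r + 1) j) =
      ∫ᵛ x, cauchy (bracket μ r r) x * f x ∂<•(bracket μ (r + 1) j) := by
  rw [(h.next (r := r) (by omega) (by omega)).integral_bracket_of_density (by omega) hrj hj
    (h.tame _ (by omega) (by omega)) (h.signedOn (by omega) le_rfl (by omega)
      (h.convex _ (by omega) (by omega)) (h.disjoint r (by omega) (by omega)))
    (by rw [nextSystem, if_neg (by omega), if_neg (by omega), if_neg (by omega), if_pos rfl])]
  simp_rw [(h.tame_bracket (i := r) (j := r) (by omega) le_rfl (by omega)).cauchy_ofReal]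
  congr 1
  split_ifs with h1
  · rw [h1, bracket_self]
  · rw [bracket_of_lt _ (by omega : r + 1 < j)]
    congr 1
    refine bracket_congr (by omega) fun a h2 h3 => ?_
    rw [nextSystem, if_neg (by omega), if_neg (by omega), if_neg (by omega), if_neg (by omega)]

/-- The Cauchy transforms of the brackets of the following system, expressed by those of the
original system. -/
lemma exists_cauchy_reduced (h : IsSystem k m Δ μ) (hi : k < i) (hir : i + 1 ≤ r) (hrm : r ≤ m)
    (hij : i + 1 ≤ j) (hj : j ≤ m) (hki : k + 1 ≤ i) :
    ∃ (c : ℕ → ℂ) (p₀ p₁ : ℂ), (r < j → p₁ = 0) ∧ ∀ z ∈ off (Δ (i + 1)),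
      cauchy (reduced μ (nextSystem μ k r) r (i + 1) j) z * cauchy (bracket μ (i + 1) r) z =
        ∑ a ∈ (if j ≤ r then Finset.Ico i j else {j}), c a * tailCauchy μ (i + 1) a z +
          (p₀ + p₁ * z) * cauchy (bracket μ (i + 1) r) z := by
  have hνs := h.next (r := r) (by omega) hrm
  -- Descending induction on i. It starts at i + 1 = min j r, where either the bracket is a single
  -- inverse measure or r = i + 1 < j.
  induction hd : min j r - (i + 1) generalizing i with
  | zero =>
    obtain ⟨hτ, l₀, l₁, hinv⟩ := inverse_spec (h.tame_bracket (i := i + 1) (by omega) hir hrm)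
      (h.compact _ (by omega) (by omega)) (h.convex _ (by omega) (by omega))
    rcases le_or_gt j r with hjr | hjr
    · obtain rfl : j = i + 1 := by omega
      -- This is the defining relation τ̂ ŝ = 1 - ℓ ŝ; the constant 1 is `tailCauchy` at the index a
      -- = i, just below the start of the bracket.
      refine ⟨fun _ => 1, -l₀, -l₁, fun h1 => by omega, fun z hz => ?_⟩
      have h1 := hinv z hz
      rw [reduced, if_pos rfl, if_pos hjr, Nat.Ico_succ_singleton, Finset.sum_singleton, tailCauchy,
        if_pos (by omega)]
      linear_combination h1
    · obtain rfl : r = i + 1 := by omega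
      refine ⟨fun _ => -1, -(l₁ * ∫ᵛ x, cauchy (bracket μ (i + 1) (i + 1)) x ∂<•(bracket μ (i + 2) j)),
        0, fun _ => rfl, fun z hz => ?_⟩
      rw [reduced, if_neg (by omega), if_neg (by omega), Finset.sum_singleton, tailCauchy,
        if_neg (by omega), cauchy_angle_mul_cauchy (h.tame_bracket (by omega) le_rfl (by omega)) hτ
        (h.tame_bracket (i := i + 2) (by omega) (by omega) hj)
        (hνs.tame_bracket (by omega) (by omega) hj)
        (h.compact _ (by omega) (by omega)) (h.convex _ (by omega) (by omega))
        (h.compact _ (by omega) (by omega)) (h.convex _ (by omega) (by omega))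
        (h.disjoint _ (by omega) (by omega)) hinv
        (h.integral_bracket_next_last (by omega) (by omega) hj) hz, bracket_self,
        bracket_of_lt μ (by omega : i + 1 < j), cauchy_eq_transform (angle _ _),
        transform_angle (h.tame (i + 1) (by omega) (by omega))
          (h.tame_bracket (i := i + 2) (by omega) (by omega) hj)
        (h.compact _ (by omega) (by omega)) (h.convex _ (by omega) (by omega))
        (h.compact _ (by omega) (by omega)) (h.convex _ (by omega) (by omega))
        (h.disjoint _ (by omega) (by omega))]
      simp only [mul_one]
      ring
  | succ d ih =>
    obtain ⟨c, p₀, p₁, hp, hrel⟩ := ih (i := i + 1) (by omega) (by omega) (by omega) (by omega) (by omega)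
    obtain ⟨hτ, l₀, l₁, hinv⟩ := inverse_spec (h.tame_bracket (i := i + 1) (by omega) hir hrm)
      (h.compact _ (by omega) (by omega)) (h.convex _ (by omega) (by omega))
    have hbr := bracket_of_lt μ (by omega : i + 1 < r)
    have hmem : ∀ a ∈ (if j ≤ r then Finset.Ico (i + 1) j else {j}), i + 1 ≤ a ∧ a ≤ m := by
      intro a ha
      split_ifs at ha
      · rw [Finset.mem_Ico] at ha; omega
      · rw [Finset.mem_singleton] at ha; omega
    obtain ⟨d', q, hdq⟩ := exists_cauchy_angle_mul_cauchy (u := fun a x => tailCauchy μ (i + 2) a x)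
      (c := c) (p₀ := p₀) (p₁ := p₁)
      (h.tame (i + 1) (by omega) (by omega))
      (h.tame_bracket (i := i + 2) (j := r) (by omega) (by omega) hrm) hτ
      (h.tame_reduced hνs (i := i + 2) (j := j) (r := r) (by omega) (by omega) hrm (by omega) hj)
      (hνs.tame_bracket (i := i + 2) (j := j) (by omega) (by omega) hj)
      (h.compact _ (by omega) (by omega)) (h.convex _ (by omega) (by omega))
      (h.compact _ (by omega) (by omega)) (h.convex _ (by omega) (by omega))
      (h.disjoint _ (by omega) (by omega)) (l₀ := l₀) (l₁ := l₁) (by rw [← hbr]; exact hinv)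
      (by rw [← hbr]; exact h.integral_bracket_next (by omega) (by omega) hrm (by omega) hj)
      (fun a ha => h.continuousOn_tailCauchy (by omega) (by omega) (hmem a ha).2)
      (fun t ht => hrel t (h.mem_off (by omega) (by omega) ht))
    rw [← hbr] at hdq
    have hsum : ∀ z, ∑ a ∈ (if j ≤ r then Finset.Ico (i + 1) j else {j}),
        c a * transform (μ (i + 1)) (fun x => tailCauchy μ (i + 2) a x) z =
        ∑ a ∈ (if j ≤ r then Finset.Ico (i + 1) j else {j}), c a * tailCauchy μ (i + 1) a z :=
      fun z => Finset.sum_congr rfl fun a ha => by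
        rw [h.transform_tailCauchy (by omega) (hmem a ha).1 (hmem a ha).2]
    -- The new constant d' p₁ is stored at the new index a = i, where `tailCauchy` is 1. For r < j
    -- it is absent, because p₁ = 0.
    refine ⟨fun a => if a = i then d' * p₁ else -c a, q, -p₁, fun h1 => by rw [hp h1, neg_zero],
      fun z hz => ?_⟩
    rw [reduced, if_neg (by omega), hdq z hz, hsum]
    have hsum' : ∀ I : Finset ℕ, i ∉ I →
        ∑ a ∈ I, (if a = i then d' * p₁ else -c a) * tailCauchy μ (i + 1) a z =
        -∑ a ∈ I, c a * tailCauchy μ (i + 1) a z := fun I hI => by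
      rw [← Finset.sum_neg_distrib]
      refine Finset.sum_congr rfl fun a ha => ?_
      rw [if_neg (ne_of_mem_of_not_mem ha hI), neg_mul]
    split_ifs with hjr
    · rw [Finset.sum_eq_sum_Ico_succ_bot (by omega : i < j), hsum' _ (by simp)]
      have h3 : tailCauchy μ (i + 1) i z = 1 := by rw [tailCauchy, if_pos (by omega)]
      simp only [h3, if_true]
      ring
    · rw [hsum' _ (by simp; omega), hp (by omega)]
      ring

/-- Passing to the following system, the orthogonality relations carry over. -/
theorem orth_next (h : IsSystem k m Δ μ) (hr : k + 1 ≤ r) (hrm : r ≤ m) {F : ℝ → ℂ}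
    (hF : ContinuousOn F (Δ (k + 1))) {n : ℕ → ℕ}
    (ho : ∀ j, k + 1 ≤ j → j ≤ m → Orth (bracket μ (k + 1) j) F (n j))
    (hmax : ∀ j, k + 1 ≤ j → j ≤ m → n j ≤ n r) (hlt : ∀ j, k + 1 ≤ j → j < r → n j < n r)
    (hanti : ∀ a b, k + 1 ≤ a → a < b → b < r → n b ≤ n a) (hj : k + 2 ≤ j) (hjm : j ≤ m) :
    Orth (bracket (nextSystem μ k r) (k + 2) j) (fun y => transform (bracket μ (k + 1) r) F y)
      (if j ≤ r then n (j - 1) else n j) := by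
  have hνs := h.next (r := r) (by omega) hrm
  have hν : (if j ≤ r then n (j - 1) else n j) ≤ n r := by
    split_ifs with h1
    · exact (hlt (j - 1) (by omega) (by omega)).le
    · exact hmax j (by omega) hjm
  intro ν hνlt
  have hs := h.tame_bracket (i := k + 1) (j := r) (by omega) hr hrm
  have hμ := h.tame (k + 1) (by omega) (by omega)
  have hK := h.compact (k + 1) (by omega) (by omega)
  rw [integral_transform_mul_pow hs.toCarried (hνs.tame_bracket (by omega) hj hjm).toCarried hK
    (h.compact _ (by omega) (by omega)) (h.disjoint (k + 1) (by omega) (by omega)) hF (ho r hr hrm)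
    (by omega), neg_eq_zero]
  have hz : ∀ a, k + 1 ≤ a → a ≤ m → ν < n a →
      ∫ᵛ x, tailCauchy μ (k + 2) a x * (F x * (x : ℂ) ^ ν) ∂<•(μ (k + 1)) = 0 := fun a h1 h2 h3 => by
    rw [← h.integral_bracket (by omega) h1 h2]
    exact ho a h1 h2 ν h3
  rcases hr.eq_or_lt with rfl | hr'
  · have h1 : bracket (nextSystem μ k (k + 1)) (k + 2) j = bracket μ (k + 2) j :=
      bracket_congr hj fun a _ _ => by rw [nextSystem, if_pos rfl]
    rw [if_neg (by omega)] at hνlt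
    rw [bracket_self, h1, ← hz j (by omega) hjm hνlt]
    refine hμ.integral_congr fun x _ => ?_
    rw [tailCauchy, if_neg (by omega), mul_comm]
  · obtain ⟨c, p₀, p₁, hp, hrel⟩ := h.exists_cauchy_reduced (i := k + 1) (j := j) (r := r) (by omega)
      hr' hrm hj hjm le_rfl
    rw [bracket_next_first hr' hj,
      h.integral_bracket (by omega) hr hrm]
    -- For j ≤ r only indices a ≤ j - 1 < r occur, and the components before r are nonincreasing, so
    -- n a ≥ n (j - 1) > ν.
    have hsub : ∀ a ∈ (if j ≤ r then Finset.Ico (k + 1) j else {j}),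
        k + 1 ≤ a ∧ a ≤ m ∧ ν < n a := by
      intro a ha
      split_ifs at ha hνlt with h1
      · rw [Finset.mem_Ico] at ha
        refine ⟨ha.1, by omega, hνlt.trans_le ?_⟩
        rcases (show a ≤ j - 1 by omega).eq_or_lt with h2 | h2
        · rw [h2]
        · exact hanti a (j - 1) ha.1 h2 (by omega)
      · rw [Finset.mem_singleton] at ha
        rw [ha]
        exact ⟨by omega, hjm, hνlt⟩
    have e1 : ∀ x ∈ Δ (k + 1), tailCauchy μ (k + 2) r x * (F x * (x : ℂ) ^ ν *
        cauchy (reduced μ (nextSystem μ k r) r (k + 2) j) x) =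
        ∑ a ∈ (if j ≤ r then Finset.Ico (k + 1) j else {j}),
          c a * (tailCauchy μ (k + 2) a x * (F x * (x : ℂ) ^ ν)) +
        p₀ * (tailCauchy μ (k + 2) r x * (F x * (x : ℂ) ^ ν)) +
        p₁ * (tailCauchy μ (k + 2) r x * (F x * (x : ℂ) ^ (ν + 1))) := fun x hx => by
      have h2 := hrel x (h.mem_off (by omega) (by omega) hx)
      have h3 : cauchy (bracket μ (k + 2) r) x = tailCauchy μ (k + 2) r x := by
        rw [tailCauchy, if_neg (by omega)]
      change _ * cauchy (bracket μ (k + 2) r) x = _ + _ * cauchy (bracket μ (k + 2) r) x at h2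
      rw [h3] at h2
      have h4 : ∀ I : Finset ℕ, ∑ a ∈ I, c a * (tailCauchy μ (k + 2) a x * (F x * (x : ℂ) ^ ν)) =
          (∑ a ∈ I, c a * tailCauchy μ (k + 2) a x) * (F x * (x : ℂ) ^ ν) := fun I => by
        rw [Finset.sum_mul]
        exact Finset.sum_congr rfl fun a _ => by ring
      rw [h4]
      linear_combination F x * (x : ℂ) ^ ν * h2
    have hc : ∀ a ≤ m, ∀ ν : ℕ, ContinuousOn (fun x : ℝ => tailCauchy μ (k + 2) a x *
        (F x * (x : ℂ) ^ ν)) (Δ (k + 1)) := fun a ha ν =>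
      (h.continuousOn_tailCauchy (by omega) (by omega) ha).mul (by fun_prop)
    have c1 : ∀ a ∈ (if j ≤ r then Finset.Ico (k + 1) j else {j}), ContinuousOn (fun x : ℝ =>
        c a * (tailCauchy μ (k + 2) a x * (F x * (x : ℂ) ^ ν))) (Δ (k + 1)) := fun a ha =>
      continuousOn_const.mul (hc a (hsub a ha).2.1 ν)
    have c0 : ContinuousOn (fun x : ℝ => ∑ a ∈ (if j ≤ r then Finset.Ico (k + 1) j else {j}),
        c a * (tailCauchy μ (k + 2) a x * (F x * (x : ℂ) ^ ν))) (Δ (k + 1)) :=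
      continuousOn_finsetSum _ c1
    have c2 : ContinuousOn (fun x : ℝ => p₀ * (tailCauchy μ (k + 2) r x * (F x * (x : ℂ) ^ ν)))
        (Δ (k + 1)) := continuousOn_const.mul (hc r hrm ν)
    have c02 : ContinuousOn (fun x : ℝ => ∑ a ∈ (if j ≤ r then Finset.Ico (k + 1) j else {j}),
        c a * (tailCauchy μ (k + 2) a x * (F x * (x : ℂ) ^ ν)) +
        p₀ * (tailCauchy μ (k + 2) r x * (F x * (x : ℂ) ^ ν))) (Δ (k + 1)) := c0.add c2
    have c3 : ContinuousOn (fun x : ℝ => p₁ * (tailCauchy μ (k + 2) r x * (F x * (x : ℂ) ^ (ν + 1))))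
        (Δ (k + 1)) := continuousOn_const.mul (hc r hrm _)
    -- The linear factor needs the relation of degree ν + 1 at r. For j ≤ r it is available since ν
    -- < n (j - 1) < n r; for j > r equality n j = n r may occur, but then p₁ = 0.
    have hzr : p₁ * ∫ᵛ x, tailCauchy μ (k + 2) r x * (F x * (x : ℂ) ^ (ν + 1)) ∂<•(μ (k + 1)) = 0 := by
      rcases le_or_gt j r with hjr | hjr
      · rw [← h.integral_bracket (by omega) hr hrm, ho r hr hrm (ν + 1), mul_zero]
        rw [if_pos hjr] at hνlt
        have := hlt (j - 1) (by omega) (by omega)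
        omega
      · rw [hp hjr, zero_mul]
    rw [hμ.integral_congr e1, hμ.integral_add hK c02 c3, hμ.integral_add hK c0 c2,
      hμ.integral_sum hK _ c1, hμ.integral_const_mul, hμ.integral_const_mul, hzr,
      hz r hr hrm (by omega), Finset.sum_eq_zero fun a ha => by
        rw [hμ.integral_const_mul, hz a (hsub a ha).1 (hsub a ha).2.1 (hsub a ha).2.2, mul_zero]]
    simp

end IsSystem

lemma Carried.integral_mul_linear {s : SignedMeasure ℝ} {K : Set ℝ} (h : Carried s K)
    (hK : IsCompact K) {g : ℝ → ℂ} (hg : ContinuousOn g K) {N : ℕ} (ho : Orth s g N) {ν : ℕ}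
    (hν : ν + 1 < N) (a b : ℂ) : ∫ᵛ x, g x * (x : ℂ) ^ ν * (a + b * x) ∂<•s = 0 := by
  have h1 : ∀ x ∈ K, g x * (x : ℂ) ^ ν * (a + b * x) =
      a * (g x * (x : ℂ) ^ ν) + b * (g x * (x : ℂ) ^ (ν + 1)) := fun x _ => by ring
  have h2 : ∀ (a : ℂ) (ν : ℕ), ContinuousOn (fun x : ℝ => a * (g x * (x : ℂ) ^ ν)) K := fun a ν =>
    continuousOn_const.mul (by fun_prop)
  rw [h.integral_congr h1, h.integral_add hK (h2 a ν) (h2 b _), h.integral_const_mul,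
    h.integral_const_mul, ho ν (by omega), ho (ν + 1) hν]
  simp

/-! ### The exceptional case of three increasing components. -/

section exceptional

variable {μ ν : SignedMeasure ℝ} {K L : Set ℝ}

lemma signedOn_div (hμ : Tame μ K) (hν : Tame ν L) (hK : IsCompact K) (hKc : Convex ℝ K)
    (hL : IsCompact L) (hLc : Convex ℝ L) (hKL : Disjoint K L) :
    SignedOn (fun x => cauchyReal (angle ν μ) x / cauchyReal ν x) K := by
  have h1 := hν.angle hμ hL hLc hK hKc hKL.symm
  have e1 := h1.signedOn_cauchyReal hL hLc h1.nonempty hKc hKL.symm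
  have e2 := hν.signedOn_cauchyReal hL hLc hν.nonempty hKc hKL.symm
  have ne : ∀ {f : ℝ → ℝ}, SignedOn f K → ∀ x ∈ K, f x ≠ 0 := fun hf x hx => by
    rcases hf.sign with h | h
    exacts [(h x hx).ne', (h x hx).ne]
  exact SignedOn.of_ne_zero (e1.cont.div e2.cont (ne e2)) hKc.isPreconnected
    fun x hx => div_ne_zero (ne e1 x hx) (ne e2 x hx)

/-- The Cauchy transform of `(⟨ν, μ⟩^ / ν̂) dτ`, where `τ` is inverse to `⟨μ, ν⟩`. -/
lemma exists_cauchy_density_div_mul (hμ : Tame μ K) (hν : Tame ν L) (hK : IsCompact K)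
    (hKc : Convex ℝ K) (hL : IsCompact L) (hLc : Convex ℝ L) (hKL : Disjoint K L) :
    ∃ a b : ℂ, ∀ z ∈ off K, cauchy (density (fun x => cauchyReal (angle ν μ) x / cauchyReal ν x)
      (inverse (angle μ ν))) z * cauchy (angle μ ν) z =
        cauchy μ z + (a + b * z) * cauchy (angle μ ν) z := by
  have hs := hμ.angle hν hK hKc hL hLc hKL
  have hs' := hν.angle hμ hL hLc hK hKc hKL.symm
  obtain ⟨hτ, l₀, l₁, hinv⟩ := inverse_spec hs hK hKc
  obtain ⟨hτ', k₀, k₁, hinv'⟩ := inverse_spec hν hL hLc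
  have hω := hτ'.angle hs hL hLc hK hKc hKL.symm
  have hKoff : ∀ x ∈ K, (x : ℂ) ∈ off L := fun x hx => ofReal_mem_off.2 fun h =>
    disjoint_left.1 hKL hx h
  have hI : ∫ᵛ x, (1 : ℂ) ∂<•(angle μ ν) = ∫ᵛ x, cauchy ν x ∂<•μ := by
    rw [integral_angle hμ hν hK hKc hL hLc hKL]
    simp only [mul_one]
  -- the density is, up to a constant, a Cauchy transform
  have hg : ∀ x ∈ K, ((cauchyReal (angle ν μ) x / cauchyReal ν x : ℝ) : ℂ) =
      -cauchy (angle (inverse ν) (angle μ ν)) x - k₁ * (∫ᵛ x, cauchy ν x ∂<•μ) := fun x hx => by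
    have h1 := cauchy_angle_mul_cauchy hν hτ' hμ hs hL hLc hK hKc hKL.symm hinv'
      (integral_angle hμ hν hK hKc hL hLc hKL) (hKoff x hx)
    have h2 : transform ν (fun t => cauchy μ t) x = cauchy (angle ν μ) x := by
      rw [cauchy_eq_transform (angle ν μ), transform_angle hν hμ hL hLc hK hKc hKL.symm]
      simp only [mul_one]
    have h3 := hν.cauchy_ne_zero hL hLc hν.nonempty (hKoff x hx)
    rw [h2] at h1
    rw [Complex.ofReal_div, ← hs'.cauchy_ofReal, ← hν.cauchy_ofReal, div_eq_iff h3]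
    linear_combination h1
  have hgS := signedOn_div hμ hν hK hKc hL hLc hKL
  refine ⟨l₁ * (∫ᵛ x, cauchy (angle μ ν) x ∂<•(inverse ν)) - k₀ +
    k₁ * (∫ᵛ x, cauchy ν x ∂<•μ) * l₀, k₁ * (∫ᵛ x, cauchy ν x ∂<•μ) * l₁ - k₁, fun z hz => ?_⟩
  have h1 : cauchy (density (fun x => cauchyReal (angle ν μ) x / cauchyReal ν x)
      (inverse (angle μ ν))) z = -cauchy (angle (inverse (angle μ ν))
        (angle (inverse ν) (angle μ ν))) z -
        k₁ * (∫ᵛ x, cauchy ν x ∂<•μ) * cauchy (inverse (angle μ ν)) z := by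
    have e1 : ∀ x ∈ K, ((cauchyReal (angle ν μ) x / cauchyReal ν x : ℝ) : ℂ) * (z - x)⁻¹ =
        (-1) * (cauchy (angle (inverse ν) (angle μ ν)) x * (z - x)⁻¹) -
        k₁ * (∫ᵛ x, cauchy ν x ∂<•μ) * (z - x)⁻¹ := fun x hx => by rw [hg x hx]; ring
    have hc : ContinuousOn (fun x : ℝ => (z - x)⁻¹) K :=
      ContinuousOn.inv₀ (by fun_prop) fun x hx => sub_ne_zero_of_mem_off hz hx
    have hc' := hω.toCarried.continuousOn_cauchy_real hL hKL.symm
    have hc1 : ContinuousOn (fun x : ℝ => (-1 : ℂ) * (cauchy (angle (inverse ν) (angle μ ν)) x *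
      (z - x)⁻¹)) K := continuousOn_const.mul (hc'.mul hc)
    have hc2 : ContinuousOn (fun x : ℝ => k₁ * (∫ᵛ x, cauchy ν x ∂<•μ) * (z - x)⁻¹) K :=
      continuousOn_const.mul hc
    rw [cauchy, integral_density hK hτ.toCarried hgS, hτ.integral_congr e1, hτ.integral_sub hK hc1 hc2,
      hτ.integral_const_mul, hτ.integral_const_mul, neg_one_mul, cauchy.eq_def (angle (inverse _) _),
      integral_angle hτ hω hK hKc hL hLc hKL]
    rfl
  have h2 := cauchy_angle_mul_cauchy hs hτ hτ' hω hK hKc hL hLc hKL hinv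
    (integral_angle hτ' hs hL hLc hK hKc hKL.symm) hz
  -- Under ⟨μ, ν⟩ the integrand carries ν̂ times the transform of the inverse of ν, that is, 1 minus
  -- a linear polynomial times ν̂; the 1 yields the leading term μ̂.
  have h3 : transform (angle μ ν) (fun t => cauchy (inverse ν) t) z = cauchy μ z -
      (k₀ + k₁ * z) * cauchy (angle μ ν) z + k₁ * (∫ᵛ x, cauchy ν x ∂<•μ) := by
    have e1 : ∀ x ∈ K, cauchy ν x * cauchy (inverse ν) x / (z - x) =
        1 / (z - x) - (k₀ * (cauchy ν x / (z - x)) + k₁ * (cauchy ν x * x / (z - x))) := fun x hx => by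
      have := hinv' x (hKoff x hx)
      rw [show cauchy ν x * cauchy (inverse ν) x = 1 - (k₁ * x + k₀) * cauchy ν x by
        linear_combination this]
      ring
    have hcν := hν.toCarried.continuousOn_cauchy_real hL hKL.symm
    have c1 : ContinuousOn (fun x : ℝ => 1 / (z - x)) K :=
      Carried.continuousOn_div hz continuousOn_const
    have c2 : ContinuousOn (fun x : ℝ => k₀ * (cauchy ν x / (z - x))) K :=
      continuousOn_const.mul (Carried.continuousOn_div hz hcν)
    have c3 : ContinuousOn (fun x : ℝ => k₁ * (cauchy ν x * x / (z - x))) K :=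
      continuousOn_const.mul (Carried.continuousOn_div hz (hcν.mul (by fun_prop)))
    have c23 : ContinuousOn (fun x : ℝ => k₀ * (cauchy ν x / (z - x)) +
        k₁ * (cauchy ν x * x / (z - x))) K := c2.add c3
    have h4 := hs.mul_transform hK (g := fun _ => 1) continuousOn_const hz
    rw [← cauchy_eq_transform, transform_angle hμ hν hK hKc hL hLc hKL, hI] at h4
    simp only [mul_one] at h4
    have h5 : transform μ (fun t => cauchy ν t) z = cauchy (angle μ ν) z := by
      rw [cauchy_eq_transform (angle μ ν), transform_angle hμ hν hK hKc hL hLc hKL]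
      simp only [mul_one]
    rw [transform_angle hμ hν hK hKc hL hLc hKL, transform, hμ.integral_congr e1,
      hμ.integral_sub hK c1 c23, hμ.integral_add hK c2 c3, hμ.integral_const_mul,
      hμ.integral_const_mul, cauchy_eq_transform μ, ← h5]
    rw [← h5] at h4
    simp only [transform] at h4 ⊢
    linear_combination k₁ * h4
  rw [h1]
  have h4 := hinv z hz
  linear_combination -h2 + h3 - k₁ * (∫ᵛ x, cauchy ν x ∂<•μ) * h4

end exceptional

namespace IsSystem

variable {Δ : ℕ → Set ℝ} {σ : ℕ → SignedMeasure ℝ} {n : ℕ → ℕ} {F : ℝ → ℂ}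

lemma tame_exceptionalKernel (h : IsSystem 0 3 Δ σ) {k : ℕ} (hk : k < 3) :
    Tame (exceptionalKernel σ k) (Δ (k + 1)) ∧
      supp (exceptionalKernel σ k) = supp (exceptionalFirst σ k) := by
  have d := h.disjoint 2 (by omega) (by omega)
  have c2 := h.compact 2 (by omega) (by omega)
  have v2 := h.convex 2 (by omega) (by omega)
  have t2 := h.tame 2 (by omega) (by omega)
  have c3 := h.compact 3 (by omega) (by omega)
  have v3 := h.convex 3 (by omega) (by omega)
  have t3 := h.tame 3 (by omega) (by omega)
  have s1 := signedOn_div t2 t3 c2 v2 c3 v3 d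
  have s2 := signedOn_div t3 t2 c3 v3 c2 v2 d.symm
  have i1 := (inverse_spec (t2.angle t3 c2 v2 c3 v3 d) c2 v2).1
  have i2 := (inverse_spec (t3.angle t2 c3 v3 c2 v2 d.symm) c3 v3).1
  interval_cases k
  · exact ⟨h.tame_bracket (i := 1) (by omega) (by omega) le_rfl,
      h.supp_bracket (i := 1) (by omega) (by omega) le_rfl⟩
  · exact ⟨i1.density c2 s1, supp_density c2 i1.toCarried s1⟩
  · exact ⟨i2.density c3 s2, rfl⟩

lemma bracket_two_three : bracket σ 2 3 = s23 σ := by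
  rw [bracket_of_lt σ (by omega), bracket_self, s23]

lemma integral_bracket_one_three (h : IsSystem 0 3 Δ σ) (f : ℝ → ℂ) :
    ∫ᵛ x, f x ∂<•(bracket σ 1 3) = ∫ᵛ x, cauchy (s23 σ) x * f x ∂<•(σ 1) := by
  rw [h.integral_bracket (by omega) (by omega) le_rfl]
  rw [← bracket_two_three]
  rfl

lemma continuousOn_cauchy_s23 (h : IsSystem 0 3 Δ σ) :
    ContinuousOn (fun x : ℝ => cauchy (s23 σ) x) (Δ 1) := by
  rw [← bracket_two_three]
  exact h.continuousOn_tailCauchy (i := 1) (j := 3) (by omega) (by omega) le_rfl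

/-- The transform of the new kernel times ŝ_{2,3} equals σ̂_2 plus a linear polynomial times
ŝ_{2,3}. The first term uses the n 2 relations for s_{1,2}, the second those for s_{1,3}, where n 2
< n 3 leaves one degree to spare. -/
lemma orth_exceptional_one (h : IsSystem 0 3 Δ σ) (hF : ContinuousOn F (Δ 1))
    (ho : ∀ j, 1 ≤ j → j ≤ 3 → Orth (bracket σ 1 j) F (n j)) (h23 : n 2 < n 3) :
    Orth (exceptionalKernel σ 1) (fun y => transform (bracket σ 1 3) F y) (n 2) := by
  intro ν hν
  have c1 := h.compact 1 (by omega) (by omega)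
  have t1 := h.tame 1 (by omega) (by omega)
  have c2 := h.compact 2 (by omega) (by omega)
  have ht := h.tame_bracket (i := 1) (j := 3) (by omega) (by omega) le_rfl
  obtain ⟨a, b, hab⟩ := exists_cauchy_density_div_mul (h.tame 2 (by omega) (by omega))
    (h.tame 3 (by omega) (by omega)) c2 (h.convex 2 (by omega) (by omega))
    (h.compact 3 (by omega) (by omega)) (h.convex 3 (by omega) (by omega))
    (h.disjoint 2 (by omega) (by omega))
  rw [integral_transform_mul_pow ht.toCarried (h.tame_exceptionalKernel (k := 1) (by omega)).1.toCarried
    c1 c2 (h.disjoint 1 (by omega) (by omega)) hF (ho 3 (by omega) le_rfl) (by omega), neg_eq_zero,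
    h.integral_bracket_one_three]
  have e1 : ∀ x ∈ Δ 1, cauchy (s23 σ) x * (F x * (x : ℂ) ^ ν * cauchy (exceptionalKernel σ 1) x) =
      cauchy (σ 2) x * (F x * (x : ℂ) ^ ν) + cauchy (s23 σ) x * (F x * (x : ℂ) ^ ν * (a + b * x)) :=
    fun x hx => by
      have h1 := hab x (h.mem_off (by omega) (by omega) hx)
      change cauchy (exceptionalKernel σ 1) x * cauchy (s23 σ) x =
        _ + _ * cauchy (s23 σ) x at h1
      linear_combination F x * (x : ℂ) ^ ν * h1
  have k1 := (h.tame 2 (by omega) (by omega)).toCarried.continuousOn_cauchy_real c2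
    (h.disjoint 1 (by omega) (by omega)).symm
  have k2 := h.continuousOn_cauchy_s23
  have k3 : ContinuousOn (fun x : ℝ => cauchy (σ 2) x * (F x * (x : ℂ) ^ ν)) (Δ 1) :=
    k1.mul (by fun_prop)
  have k4 : ContinuousOn (fun x : ℝ => cauchy (s23 σ) x * (F x * (x : ℂ) ^ ν * (a + b * x)))
    (Δ 1) := k2.mul (by fun_prop)
  rw [t1.integral_congr e1, t1.integral_add c1 k3 k4,
    ← h.integral_bracket_one_three,
    ht.integral_mul_linear c1 hF (ho 3 (by omega) le_rfl) (by omega), add_zero,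
    ← ho 2 (by omega) (by omega) ν hν, h.integral_bracket (by omega) (by omega) (by omega)]
  simp only [tailCauchy, bracket_self]
  rfl

/-- The density ŝ_{3,2}/σ̂_3 of the second kernel times the transform of the third is 1 plus a
linear polynomial times that density. The linear part uses the previous relations, as n 1 < n 2. The
1 leaves moments against τ_{2,3}, which 1/ŝ_{2,3} = ℓ + τ̂_{2,3} carries back to the n 1 relations
for σ_1. -/
lemma orth_exceptional_two (h : IsSystem 0 3 Δ σ) (hF : ContinuousOn F (Δ 1))
    (ho : ∀ j, 1 ≤ j → j ≤ 3 → Orth (bracket σ 1 j) F (n j)) (h12 : n 1 < n 2) (h23 : n 2 < n 3) :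
    Orth (exceptionalKernel σ 2) (fun y => transform (exceptionalKernel σ 1)
      (fun x => transform (bracket σ 1 3) F x) y) (n 1) := by
  intro ν hν
  have c1 := h.compact 1 (by omega) (by omega)
  have t1 := h.tame 1 (by omega) (by omega)
  have c2 := h.compact 2 (by omega) (by omega)
  have v2 := h.convex 2 (by omega) (by omega)
  have t2 := h.tame 2 (by omega) (by omega)
  have c3 := h.compact 3 (by omega) (by omega)
  have v3 := h.convex 3 (by omega) (by omega)
  have t3 := h.tame 3 (by omega) (by omega)
  have d1 := h.disjoint 1 (by omega) (by omega)
  have d2 := h.disjoint 2 (by omega) (by omega)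
  have ht := h.tame_bracket (i := 1) (j := 3) (by omega) (by omega) le_rfl
  have hκ := (h.tame_exceptionalKernel (k := 1) (by omega)).1
  have hs32 := t3.angle t2 c3 v3 c2 v2 d2.symm
  obtain ⟨hτ, l₀, l₁, hinv⟩ : Tame (inverse (s23 σ)) (Δ 2) ∧ _ :=
    inverse_spec (t2.angle t3 c2 v2 c3 v3 d2) c2 v2
  obtain ⟨a, b, hab⟩ := exists_cauchy_density_div_mul t3 t2 c3 v3 c2 v2 d2.symm
  have hΨ : ContinuousOn (fun x : ℝ => transform (bracket σ 1 3) F x) (Δ 2) :=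
    ht.continuousOn_transform_real c1 hF d1
  have hsg := signedOn_div t2 t3 c2 v2 c3 v3 d2
  have ho1 := h.orth_exceptional_one hF ho h23
  have hz1 : ∫ᵛ x, F x * (x : ℂ) ^ ν * cauchy (inverse (s23 σ)) x ∂<•(bracket σ 1 3) = 0 := by
    have e1 : ∀ x ∈ Δ 1, cauchy (s23 σ) x * (F x * (x : ℂ) ^ ν * cauchy (inverse (s23 σ)) x) =
        F x * (x : ℂ) ^ ν - cauchy (s23 σ) x * (F x * (x : ℂ) ^ ν * (l₀ + l₁ * x)) := fun x hx => by
      have h1 := hinv x (h.mem_off (by omega) (by omega) hx)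
      change (_ + cauchy (inverse (s23 σ)) x) * cauchy (s23 σ) x = 1 at h1
      linear_combination F x * (x : ℂ) ^ ν * h1
    have k3 : ContinuousOn (fun x : ℝ => F x * (x : ℂ) ^ ν) (Δ 1) := by fun_prop
    have k4 : ContinuousOn (fun x : ℝ => cauchy (s23 σ) x * (F x * (x : ℂ) ^ ν * (l₀ + l₁ * x)))
      (Δ 1) := h.continuousOn_cauchy_s23.mul (by fun_prop)
    rw [h.integral_bracket_one_three, t1.integral_congr e1, t1.integral_sub c1 k3 k4, ← h.integral_bracket_one_three,
      ht.integral_mul_linear c1 hF (ho 3 (by omega) le_rfl) (by omega), sub_zero,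
      ← ho 1 (by omega) (by omega) ν hν, bracket_self]
  have hz2 : ∫ᵛ y, transform (bracket σ 1 3) F y * (y : ℂ) ^ ν ∂<•(inverse (s23 σ)) = 0 := by
    rw [integral_transform_mul_pow ht.toCarried hτ.toCarried c1 c2 d1 hF (ho 3 (by omega) le_rfl)
      (by omega), neg_eq_zero]
    exact hz1
  rw [integral_transform_mul_pow hκ.toCarried
    (h.tame_exceptionalKernel (k := 2) (by omega)).1.toCarried c2 c3 d2 hΨ ho1 (by omega), neg_eq_zero]
  have hκi : ∀ f : ℝ → ℂ, ∫ᵛ x, f x ∂<•(exceptionalKernel σ 1) = ∫ᵛ x,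
      ((cauchyReal (angle (σ 3) (σ 2)) x / cauchyReal (σ 3) x : ℝ) : ℂ) * f x ∂<•(inverse (s23 σ)) :=
    fun f => integral_density c2 hτ.toCarried hsg f
  have e2 : ∀ x ∈ Δ 2, ((cauchyReal (angle (σ 3) (σ 2)) x / cauchyReal (σ 3) x : ℝ) : ℂ) *
      (transform (bracket σ 1 3) F x * (x : ℂ) ^ ν * cauchy (exceptionalKernel σ 2) x) =
      transform (bracket σ 1 3) F x * (x : ℂ) ^ ν +
      ((cauchyReal (angle (σ 3) (σ 2)) x / cauchyReal (σ 3) x : ℝ) : ℂ) *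
        (transform (bracket σ 1 3) F x * (x : ℂ) ^ ν * (a + b * x)) := fun x hx => by
    have hx3 := h.mem_off (by omega) (by omega) hx
    have h1 := hab x hx3
    have h2 := t3.cauchy_ne_zero c3 v3 t3.nonempty hx3
    change cauchy (exceptionalKernel σ 2) x * _ = _ at h1
    rw [Complex.ofReal_div, ← hs32.cauchy_ofReal, ← t3.cauchy_ofReal]
    field_simp
    linear_combination transform (bracket σ 1 3) F x * (x : ℂ) ^ ν * h1
  have k1 : ContinuousOn (fun x : ℝ => ((cauchyReal (angle (σ 3) (σ 2)) x / cauchyReal (σ 3) x : ℝ) : ℂ))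
      (Δ 2) := Complex.continuous_ofReal.comp_continuousOn hsg.cont
  have k2 : ContinuousOn (fun x : ℝ => transform (bracket σ 1 3) F x * (x : ℂ) ^ ν) (Δ 2) := by
    fun_prop
  have k3 : ContinuousOn (fun x : ℝ =>
      ((cauchyReal (angle (σ 3) (σ 2)) x / cauchyReal (σ 3) x : ℝ) : ℂ) *
        (transform (bracket σ 1 3) F x * (x : ℂ) ^ ν * (a + b * x))) (Δ 2) :=
    k1.mul (by fun_prop)
  rw [hκi, hτ.integral_congr e2, hτ.integral_add c2 k2 k3, hz2, ← hκi,
    hκ.integral_mul_linear c2 hΨ ho1 (by omega), add_zero]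

end IsSystem

/-! ### Combinatorics of the multi-indices. -/

section indices

variable {m k r : ℕ} {n n' : ℕ → ℕ}

lemma firstMax_spec (hk : k < m) (n : ℕ → ℕ) :
    (k + 1 ≤ firstMax m k n ∧ firstMax m k n ≤ m ∧
      ∀ j, k + 1 ≤ j → j ≤ m → n j ≤ n (firstMax m k n)) ∧
    ∀ j, k + 1 ≤ j → j < firstMax m k n → n j < n (firstMax m k n) := by
  have hne : {r | k + 1 ≤ r ∧ r ≤ m ∧ ∀ j, k + 1 ≤ j → j ≤ m → n j ≤ n r}.Nonempty := by
    obtain ⟨r, hr, hmax⟩ := (Finset.Icc (k + 1) m).exists_max_image n ⟨m, by simp; omega⟩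
    rw [Finset.mem_Icc] at hr
    exact ⟨r, hr.1, hr.2, fun j h1 h2 => hmax j (Finset.mem_Icc.2 ⟨h1, h2⟩)⟩
  have hmem := Nat.sInf_mem hne
  change firstMax m k n ∈ _ at hmem
  refine ⟨hmem, fun j h1 h2 => lt_of_not_ge fun h3 => Nat.notMem_of_lt_sInf h2 ?_⟩
  exact ⟨h1, h2.le.trans hmem.2.1, fun i h4 h5 => (hmem.2.2 i h4 h5).trans h3⟩

lemma firstMax_eq (h1 : k + 1 ≤ r) (h2 : r ≤ m) (hlt : ∀ j, k + 1 ≤ j → j < r → n j < n r)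
    (hle : ∀ j, r < j → j ≤ m → n j ≤ n r) : firstMax m k n = r := by
  obtain ⟨⟨h3, h4, h5⟩, h6⟩ := firstMax_spec (show k < m by omega) n
  rcases lt_trichotomy (firstMax m k n) r with h | h | h
  · exact absurd (hlt _ h3 h) (not_lt.2 (h5 r h1 h2))
  · exact h
  · exact absurd (h6 r h1 h) (not_lt.2 (hle _ h h4))

/-- The position in `n^k` of the `j`-th component of `n^{k+1}`, when the `r`-th one is deleted. -/
def shift (r j : ℕ) : ℕ := if j ≤ r then j - 1 else j

lemma index_succ (m : ℕ) (n : ℕ → ℕ) (k j : ℕ) :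
    index m n (k + 1) j = index m n k (shift (rIndex m n k) j) := by
  rw [shift, index]
  split_ifs <;> simp_all [rIndex]

lemma shift_lt_shift {i j : ℕ} (hi : 1 ≤ i) (hij : i < j) : shift r i < shift r j := by
  simp only [shift]
  split_ifs <;> omega

lemma lt_shift {i : ℕ} (hi : k + 1 < i) : k < shift r i := by
  simp only [shift]
  split_ifs <;> omega

lemma shift_le (i : ℕ) : shift r i ≤ i := by
  simp only [shift]
  split_ifs <;> omega

/-- There are no `a < b < c` in `{k + 1, …, m}` with `n a < n b < n c`. -/
def NoTriple (m k : ℕ) (n : ℕ → ℕ) : Prop :=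
  ∀ a b c, k < a → a < b → b < c → c ≤ m → n a < n b → ¬ n b < n c

/-- Deleting a component keeps the others in their order: `shift` is strictly increasing. -/
lemma noTriple_index (h : NoTriple m 0 n) (k : ℕ) : NoTriple m k (index m n k) := by
  induction k with
  | zero => exact h
  | succ k ih =>
    intro a b c h1 h2 h3 h4 h5 h6
    rw [index_succ, index_succ] at h5 h6
    exact ih _ _ _ (lt_shift h1) (shift_lt_shift (by omega) h2) (shift_lt_shift (by omega) h3)
      ((shift_le _).trans h4) h5 h6

lemma noTriple_of_inStar (h : InStar m n) (hex : ¬ Exceptional m n) : NoTriple m 0 n := by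
  intro a b c h1 h2 h3 h4 h5 h6
  rcases h with rfl | h
  · obtain ⟨rfl, rfl, rfl⟩ : a = 1 ∧ b = 2 ∧ c = 3 := by omega
    exact hex ⟨rfl, h5, h6⟩
  · exact h ⟨a, b, c, h1, h2, h3, h4, h5, h6⟩

/-- `n` and `n'` are ordered alike on `{k + 1, …, m}`. -/
def OrderedAlike (m k : ℕ) (n n' : ℕ → ℕ) : Prop :=
  ∀ i j, k < i → i < j → j ≤ m → (n i < n j ↔ n' i < n' j)

lemma OrderedAlike.firstMax_eq (h : OrderedAlike m k n n') (hk : k < m) :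
    firstMax m k n = firstMax m k n' := by
  obtain ⟨⟨h3, h4, h5⟩, h6⟩ := firstMax_spec hk n'
  refine Nikishin.firstMax_eq h3 h4 (fun j h1 h2 => (h j _ h1 h2 h4).2 (h6 j h1 h2)) fun j h1 h2 => ?_
  exact not_lt.1 fun h7 => not_lt.2 (h5 j (by omega) h2) ((h _ j h3 h1 h2).1 h7)

lemma OrderedAlike.index (h : OrderedAlike m 0 n n') (hk : k ≤ m) :
    OrderedAlike m k (index m n k) (Nikishin.index m n' k) := by
  induction k with
  | zero => exact h
  | succ k ih =>
    intro i j h1 h2 h3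
    have h4 : rIndex m n k = rIndex m n' k := (ih (by omega)).firstMax_eq (by omega)
    rw [index_succ, index_succ, index_succ, index_succ, h4]
    exact ih (by omega) _ _ (lt_shift h1) (shift_lt_shift (by omega) h2) ((shift_le _).trans h3)

lemma OrderedAlike.rIndex_eq (h : OrderedAlike m 0 n n') (hk : k < m) :
    rIndex m n k = rIndex m n' k := (h.index hk.le).firstMax_eq hk

lemma OrderedAlike.index_le (h : OrderedAlike m 0 n n') (hle : ∀ j, n j ≤ n' j) (hk : k ≤ m) (j : ℕ) :
    Nikishin.index m n k j ≤ Nikishin.index m n' k j := by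
  induction k generalizing j with
  | zero => exact hle j
  | succ k ih =>
    rw [index_succ, index_succ, h.rIndex_eq (by omega)]
    exact ih (by omega) _

/-- Ties go to the smaller index, so for i < j the index j is chosen first only if its component is
strictly larger. Thus τ determines all strict comparisons between an earlier and a later component.
-/
lemma IsOrdering.lt_iff {τ : Equiv.Perm (Icc 1 m)} (h : IsOrdering m n τ) {i j : Icc 1 m}
    (hij : i < j) : n i < n j ↔ τ.symm j < τ.symm i := by
  have h1 : ∀ p q : Icc 1 m, p < q → ∀ i' < p, τ i' ≠ τ q := fun p q hpq i' hi' h2 =>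
    (hi'.trans hpq).ne (τ.injective h2)
  rcases lt_trichotomy (τ.symm i) (τ.symm j) with h2 | h2 | h2
  · have h3 := (h (τ.symm i) (τ (τ.symm j)) (h1 _ _ h2)).2
    rw [Equiv.apply_symm_apply, Equiv.apply_symm_apply] at h3
    exact ⟨fun h4 => absurd h4 (not_lt.2 (h3 hij)), fun h4 => absurd h4 (not_lt.2 h2.le)⟩
  · exact absurd (τ.symm.injective h2) hij.ne
  · have h3 := (h (τ.symm j) (τ (τ.symm i)) (h1 _ _ h2)).1
    rw [Equiv.apply_symm_apply, Equiv.apply_symm_apply] at h3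
    exact ⟨fun _ => h2, fun _ => h3 hij⟩

lemma IsOrdering.orderedAlike {τ : Equiv.Perm (Icc 1 m)} (h : IsOrdering m n τ)
    (h' : IsOrdering m n' τ) : OrderedAlike m 0 n n' := fun i j h1 h2 h3 => by
  have hij : (⟨i, h1, h2.le.trans h3⟩ : Icc 1 m) < ⟨j, (Nat.succ_le_of_lt h1).trans h2.le, h3⟩ := h2
  rw [h.lt_iff hij, ← h'.lt_iff hij]

lemma OrderedAlike.exceptional_iff (h : OrderedAlike m 0 n n') :
    Exceptional m n ↔ Exceptional m n' :=
  and_congr_right fun hm =>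
    and_congr (h 1 2 (by omega) (by omega) (by omega)) (h 2 3 (by omega) (by omega) (by omega))

lemma indexSize_eq_add (hk : k < m) (n : ℕ → ℕ) :
    indexSize m n k = index m n k (rIndex m n k) + indexSize m n (k + 1) := by
  obtain ⟨⟨h1, h2, -⟩, -⟩ := firstMax_spec hk (index m n k)
  change k + 1 ≤ rIndex m n k at h1
  change rIndex m n k ≤ m at h2
  have hI : ∀ a, Finset.Icc a m = Finset.Ico a (m + 1) := fun a => by
    ext; simp
  simp only [indexSize, index_succ, hI]
  generalize rIndex m n k = r at h1 h2
  generalize index m n k = f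
  rw [← Finset.sum_Ico_consecutive f h1 (by omega : r ≤ m + 1),
    ← Finset.sum_Ico_consecutive _ (by omega : k + 1 + 1 ≤ r + 1) (by omega : r + 1 ≤ m + 1),
    Finset.sum_eq_sum_Ico_succ_bot (by omega : r < m + 1) f, ← Finset.sum_Ico_add' _ (k + 1) r 1]
  have e1 : ∑ j ∈ Finset.Ico (k + 1) r, f (shift r (j + 1)) = ∑ j ∈ Finset.Ico (k + 1) r, f j :=
    Finset.sum_congr rfl fun j hj => by
      rw [Finset.mem_Ico] at hj
      rw [shift, if_pos (by omega), Nat.add_sub_cancel]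
  have e2 : ∑ j ∈ Finset.Ico (r + 1) (m + 1), f (shift r j) =
      ∑ j ∈ Finset.Ico (r + 1) (m + 1), f j :=
    Finset.sum_congr rfl fun j hj => by
      rw [Finset.mem_Ico] at hj
      rw [shift, if_neg (by omega)]
  rw [e1, e2]
  ring

/-- Each step removes one maximal component, so the removed components from step k on add up to
|n^k|; this turns counts of relations into the counts of the theorem. -/
lemma sum_index_rIndex (hk : k ≤ m) (n : ℕ → ℕ) :
    ∑ i ∈ Finset.Ico k m, index m n i (rIndex m n i) = indexSize m n k := by
  induction hd : m - k generalizing k with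
  | zero =>
    obtain rfl : k = m := by omega
    simp [indexSize]
  | succ d ih =>
    rw [indexSize_eq_add (by omega), Finset.sum_eq_sum_Ico_succ_bot (by omega),
      ih (by omega) (by omega)]

lemma Exceptional.index_rIndex (h : Exceptional m n) :
    index m n 0 (rIndex m n 0) = n 3 ∧ index m n 1 (rIndex m n 1) = n 2 ∧
      index m n 2 (rIndex m n 2) = n 1 := by
  obtain ⟨rfl, h1, h2⟩ := h
  have e0 : rIndex 3 n 0 = 3 := firstMax_eq (by omega) le_rfl (fun j h3 h4 => by
    change n j < n 3
    interval_cases j <;> omega) fun j h3 h4 => by omega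
  have e12 : index 3 n 1 2 = n 1 := by rw [index_succ, e0]; rfl
  have e13 : index 3 n 1 3 = n 2 := by rw [index_succ, e0]; rfl
  have e1 : rIndex 3 n 1 = 3 := firstMax_eq (by omega) le_rfl (fun j h3 h4 => by
    obtain rfl : j = 2 := by omega
    rw [e12, e13]; exact h1) fun j h3 h4 => by omega
  have e2 : rIndex 3 n 2 = 3 := firstMax_eq le_rfl le_rfl (fun j h3 h4 => by omega)
    fun j h3 h4 => by omega
  refine ⟨by rw [e0]; rfl, by rw [e1, e13], ?_⟩
  rw [e2, index_succ, e1]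
  exact e12

end indices

/-! ### The chain attached to a Nikishin system. -/

section system

variable {m k : ℕ} {σ : ℕ → SignedMeasure ℝ} {n n' : ℕ → ℕ}

lemma OrderedAlike.system_eq (h : OrderedAlike m 0 n n') (hk : k ≤ m) :
    system m σ n k = system m σ n' k := by
  induction k with
  | zero => rfl
  | succ k ih => rw [system, system, ih (by omega), h.rIndex_eq (by omega)]

/-- The kernels see a multi-index only through its strict comparisons, so n and n_l share one chain
and their second type functions may be combined linearly. -/
lemma OrderedAlike.kernel_eq (h : OrderedAlike m 0 n n') (hk : k < m) :
    kernel m σ n k = kernel m σ n' k := by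
  rw [kernel, kernel, h.system_eq hk.le, h.rIndex_eq hk]
  by_cases hex : Exceptional m n
  · rw [if_pos hex, if_pos (h.exceptional_iff.1 hex)]
  · rw [if_neg hex, if_neg fun hex' => hex (h.exceptional_iff.2 hex')]

lemma Generates.isSystem (h : Generates m σ) : IsSystem 0 m (Delta σ) σ := by
  have hD : ∀ j, 0 < j → Delta σ j = hull (σ j) := fun j hj => if_neg hj.ne'
  refine ⟨fun j h1 h2 => ?_, fun j h1 h2 => ?_, fun j h1 h2 => ?_, fun j h1 h2 => ?_⟩
  · rw [hD j h1]; exact isCompact_convexHull (h.1 j h1 h2).2.1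
  · rw [hD j h1]; exact convex_convexHull _ _
  · rw [hD j h1, hD _ (by omega)]; exact h.2 j h1 h2
  · rw [hD j h1]
    exact ⟨⟨(h.1 j h1 h2).1, subset_convexHull _ _⟩, (h.1 j h1 h2).2.2⟩

lemma Generates.isSystem_system (h : Generates m σ) (hk : k ≤ m) :
    IsSystem k m (Delta σ) (system m σ n k) := by
  induction k with
  | zero => exact h.isSystem
  | succ k ih =>
    obtain ⟨⟨h1, h2, -⟩, -⟩ := firstMax_spec (show k < m by omega) (index m n k)
    exact (ih (by omega)).next h1 h2

lemma Generates.tame_kernel (h : Generates m σ) (hk : k < m) :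
    Tame (kernel m σ n k) (Delta σ (k + 1)) ∧
      supp (kernel m σ n k) = supp (firstMeasure m σ n k) := by
  by_cases hex : Exceptional m n
  · rw [kernel, firstMeasure, if_pos hex, if_pos hex]
    obtain ⟨rfl, -⟩ := hex
    exact h.isSystem.tame_exceptionalKernel hk
  · rw [kernel, firstMeasure, if_neg hex, if_neg hex]
    obtain ⟨⟨h1, h2, -⟩, -⟩ := firstMax_spec hk (index m n k)
    exact ⟨(h.isSystem_system hk.le).tame_bracket (by omega) h1 h2,
      (h.isSystem_system hk.le).supp_bracket (by omega) h1 h2⟩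

lemma Generates.chain (h : Generates m σ) (n : ℕ → ℕ) : Chain m (Delta σ) (kernel m σ n) where
  zero := if_pos rfl
  compact k hk := h.isSystem.compact _ (by omega) (by omega)
  convex k hk := h.isSystem.convex _ (by omega) (by omega)
  disjoint k hk := by
    rcases Nat.eq_zero_or_pos k with rfl | hk0
    · rw [show Delta σ 0 = ∅ from if_pos rfl]; exact empty_disjoint _
    · exact h.isSystem.disjoint k hk0 hk
  tame k hk := (h.tame_kernel hk).1

/-- Multiple orthogonality entails the orthogonality relations of the functions of second type. -/
theorem Generates.orthChain (h : Generates m σ) (hn : InStar m n) {P : ℝ[X]}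
    (hP : ∀ j, 1 ≤ j → j ≤ m → Orth (bracket σ 1 j) (fun x => Polynomial.aeval (x : ℂ) P) (n j)) :
    OrthChain m (kernel m σ n) (fun k => index m n k (rIndex m n k)) P := by
  have hc := h.chain n
  by_cases hex : Exceptional m n
  · obtain ⟨e0, e1, e2⟩ := hex.index_rIndex
    have hF := hc.continuousOn P (k := 0)
    have hker : kernel m σ n = exceptionalKernel σ := funext fun k => if_pos hex
    obtain ⟨rfl, h12, h23⟩ := hex
    rw [hker] at hF ⊢
    intro k hk
    interval_cases k
    · simp only [e0]
      exact hP 3 (by omega) le_rfl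
    · simp only [e1]
      exact h.isSystem.orth_exceptional_one (hF (by omega)) hP h23
    · simp only [e2]
      exact h.isSystem.orth_exceptional_two (hF (by omega)) hP h12 h23
  · have hnt := noTriple_index (noTriple_of_inStar hn hex)
    have hker : ∀ k, kernel m σ n k = bracket (system m σ n k) (k + 1) (rIndex m n k) :=
      fun k => if_neg hex
    -- The induction must carry the relations for all brackets of the system, although only the one
    -- ending at r_k is kept. The components before r_k are nonincreasing because an increase among
    -- them, followed by the larger maximum, would be a forbidden triple.
    have key : ∀ k < m, ∀ j, k + 1 ≤ j → j ≤ m → Orth (bracket (system m σ n k) (k + 1) j)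
        (fun x => secondType (kernel m σ n) P k x) (index m n k j) := by
      intro k
      induction k with
      | zero => exact fun _ j h1 h2 => hP j h1 h2
      | succ k ih =>
        intro hk j h1 h2
        obtain ⟨⟨h3, h4, h5⟩, h6⟩ := firstMax_spec (show k < m by omega) (index m n k)
        simp only [secondType, hker k]
        exact (h.isSystem_system (by omega)).orth_next h3 h4 (hc.continuousOn P (by omega))
          (ih (by omega)) h5 h6 (fun a b e1 e2 e3 => not_lt.1 fun e4 =>
            hnt k a b _ e1 e2 e3 h4 e4 (h6 b (by omega) e3)) h1 h2
    intro k hk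
    obtain ⟨⟨h3, h4, -⟩, -⟩ := firstMax_spec hk (index m n k)
    rw [hker]
    exact key k hk _ h3 h4

lemma secondType_congr {κ κ' : ℕ → SignedMeasure ℝ} (P : ℝ[X]) (h : ∀ i < k, κ i = κ' i) :
    secondType κ P k = secondType κ' P k := by
  induction k with
  | zero => rfl
  | succ k ih => rw [secondType, secondType, ih fun i hi => h i (by omega), h k (by omega)]

lemma psi_eq_secondType (P : ℝ[X]) (k : ℕ) :
    Psi m σ n (P.map (algebraMap ℝ ℂ)) k = secondType (kernel m σ n) P k := by
  induction k with
  | zero => ext z; simp [Psi, secondType, Polynomial.eval_map_algebraMap]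
  | succ k ih => rw [Psi, secondType, ih]; rfl

end system

/-! ### Real coefficients and full degree. -/

lemma exists_re_im (Q : ℂ[X]) : ∃ A B : ℝ[X], (∀ i, A.coeff i = (Q.coeff i).re) ∧
    (∀ i, B.coeff i = (Q.coeff i).im) ∧
    Q = A.map (algebraMap ℝ ℂ) + Polynomial.C Complex.I * B.map (algebraMap ℝ ℂ) := by
  have h1 : ∀ f : ℂ → ℝ, f 0 = 0 → ∀ i, (∑ j ∈ Finset.range (Q.natDegree + 1),
      Polynomial.monomial j (f (Q.coeff j))).coeff i = f (Q.coeff i) := fun f hf i => by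
    simp only [Polynomial.finsetSum_coeff, Polynomial.coeff_monomial, Finset.sum_ite_eq',
      Finset.mem_range]
    split_ifs with h2
    · rfl
    · rw [Polynomial.coeff_eq_zero_of_natDegree_lt (by omega), hf]
  refine ⟨_, _, h1 Complex.re rfl, h1 Complex.im rfl, ?_⟩
  ext i
  rw [Polynomial.coeff_add, Polynomial.coeff_C_mul, Polynomial.coeff_map, Polynomial.coeff_map,
    h1 Complex.re rfl, h1 Complex.im rfl, mul_comm]
  exact (Complex.re_add_im _).symm

/-- Multiple orthogonal polynomials have real coefficients and full degree. -/
theorem IsMultipleOrthogonal.exists_real {m : ℕ} {σ : ℕ → SignedMeasure ℝ} {n : ℕ → ℕ} {Q : ℂ[X]}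
    (h : Generates m σ) (hm : 0 < m) (hn : InStar m n) (hQ : IsMultipleOrthogonal m σ n Q) :
    ∃ P : ℝ[X], Q = P.map (algebraMap ℝ ℂ) ∧ P ≠ 0 ∧ P.natDegree = indexSize m n 0 ∧
      OrthChain m (kernel m σ n) (fun k => index m n k (rIndex m n k)) P := by
  obtain ⟨A, B, hA, hB, hAB⟩ := exists_re_im Q
  have heval : ∀ (P : ℝ[X]) (x : ℝ), Polynomial.aeval (x : ℂ) P = ((P.eval x : ℝ) : ℂ) := fun P x => by
    rw [← Complex.coe_algebraMap, Polynomial.aeval_algebraMap_apply, Polynomial.coe_aeval_eq_eval]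
  have horth : ∀ j, 1 ≤ j → j ≤ m →
      Orth (bracket σ 1 j) (fun x => Polynomial.aeval (x : ℂ) A) (n j) ∧
      Orth (bracket σ 1 j) (fun x => Polynomial.aeval (x : ℂ) B) (n j) := by
    intro j h1 h2
    have ht := h.isSystem.tame_bracket (i := 1) (by omega) h1 h2
    have hK := h.isSystem.compact 1 (by omega) (by omega)
    have hreal : ∀ (P : ℝ[X]) (ν : ℕ), ∃ c : ℝ,
        ∫ᵛ x, Polynomial.aeval (x : ℂ) P * (x : ℂ) ^ ν ∂<•(bracket σ 1 j) = c := fun P ν =>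
      ⟨∫ᵛ x, P.eval x * x ^ ν ∂<•(bracket σ 1 j), by
        rw [← ht.integral_ofReal]
        refine ht.integral_congr fun x _ => ?_
        rw [heval]
        push_cast
        rfl⟩
    have key : ∀ ν < n j, ∫ᵛ x, Polynomial.aeval (x : ℂ) A * (x : ℂ) ^ ν ∂<•(bracket σ 1 j) = 0 ∧
        ∫ᵛ x, Polynomial.aeval (x : ℂ) B * (x : ℂ) ^ ν ∂<•(bracket σ 1 j) = 0 := fun ν hν => by
      have h3 := hQ.2.2 j h1 h2 ν hν
      obtain ⟨a, ha⟩ := hreal A ν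
      obtain ⟨b, hb⟩ := hreal B ν
      have e1 : ∀ x ∈ Delta σ 1, Q.eval (x : ℂ) * (x : ℂ) ^ ν =
          Polynomial.aeval (x : ℂ) A * (x : ℂ) ^ ν +
            Complex.I * (Polynomial.aeval (x : ℂ) B * (x : ℂ) ^ ν) := fun x _ => by
        conv_lhs => rw [hAB]
        rw [Polynomial.eval_add, Polynomial.eval_mul, Polynomial.eval_C,
          Polynomial.eval_map_algebraMap, Polynomial.eval_map_algebraMap]
        ring
      have hc : ∀ P : ℝ[X], ContinuousOn (fun x : ℝ => Polynomial.aeval (x : ℂ) P * (x : ℂ) ^ ν)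
          (Delta σ 1) := fun P => by
        simp_rw [heval]
        exact (Continuous.mul (Complex.continuous_ofReal.comp P.continuous) (by fun_prop)).continuousOn
      have hc' : ContinuousOn (fun x : ℝ => Complex.I * (Polynomial.aeval (x : ℂ) B * (x : ℂ) ^ ν))
          (Delta σ 1) := continuousOn_const.mul (hc B)
      rw [ht.integral_congr e1, ht.integral_add hK (hc A) hc', ht.integral_const_mul, ha, hb] at h3
      have h4 := congrArg Complex.re h3
      have h5 := congrArg Complex.im h3
      simp at h4 h5
      rw [ha, hb, h4, h5]
      simp
    exact ⟨fun ν hν => (key ν hν).1, fun ν hν => (key ν hν).2⟩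
  have hAo := h.orthChain hn fun j h1 h2 => (horth j h1 h2).1
  have hBo := h.orthChain hn fun j h1 h2 => (horth j h1 h2).2
  have hsum := sum_index_rIndex (Nat.zero_le m) n
  have hdeg : Q.natDegree ≤ indexSize m n 0 := hQ.2.1
  -- A nonzero imaginary part satisfies the same relations, so its degree would be at least |n| and
  -- hence equal to that of `Q`; but `Q` is monic, and the imaginary part of 1 is 0.
  have hB0 : B = 0 := by
    by_contra hne
    have h1 := (h.chain n).le_natDegree hm hne hBo
    rw [hsum] at h1
    have h2 : B.natDegree ≤ Q.natDegree := Polynomial.natDegree_le_iff_coeff_eq_zero.2 fun i hi => by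
      rw [hB, Polynomial.coeff_eq_zero_of_natDegree_lt hi, Complex.zero_im]
    have h3 : B.natDegree = Q.natDegree := by omega
    refine hne (Polynomial.leadingCoeff_eq_zero.1 ?_)
    rw [Polynomial.leadingCoeff, hB, h3, hQ.1.coeff_natDegree, Complex.one_im]
  have hQA : Q = A.map (algebraMap ℝ ℂ) := by
    conv_lhs => rw [hAB]
    rw [hB0]
    simp
  have hA0 : A ≠ 0 := fun h0 => hQ.1.ne_zero (by rw [hQA, h0, Polynomial.map_zero])
  refine ⟨A, hQA, hA0, le_antisymm ?_ ?_, hAo⟩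
  · rwa [hQA, Polynomial.natDegree_map] at hdeg
  · rw [← hsum]; exact (h.chain n).le_natDegree hm hA0 hAo

lemma Ioo_subset_of_mem_closure {C : Set ℝ} (hC : IsPreconnected C) {a b : ℝ} (ha : a ∈ closure C)
    (hb : b ∈ closure C) : Ioo a b ⊆ C := fun c hc => by
  obtain ⟨a', h1, h2⟩ := mem_closure_iff.1 ha (Iio c) isOpen_Iio hc.1
  obtain ⟨b', h3, h4⟩ := mem_closure_iff.1 hb (Ioi c) isOpen_Ioi hc.2
  exact hC.ordConnected.out h2 h4 ⟨le_of_lt h1, le_of_lt h3⟩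

end Nikishin

end

/-! ### Zero count, gaps and interlacing for a Nikishin system. -/

theorem mainTheorem5 (m : ℕ) (σ : ℕ → MeasureTheory.SignedMeasure ℝ)
    (hσ : Nikishin.Generates m σ) (n : ℕ → ℕ) (hn : Nikishin.InStar m n)
    (Q : Polynomial ℂ) (hQ : Nikishin.IsMultipleOrthogonal m σ n Q) :
    (∀ k < m,
      -- exactly `|n^k|` zeros in the interior of `Δ_{k+1}`
      {x : ℝ | x ∈ interior (Nikishin.Delta σ (k + 1)) ∧
        Nikishin.Psi m σ n Q k (x : ℂ) = 0}.encard = (Nikishin.indexSize m n k : ℕ∞) ∧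
      -- they are simple
      (∀ x ∈ interior (Nikishin.Delta σ (k + 1)), Nikishin.Psi m σ n Q k (x : ℂ) = 0 →
        analyticOrderAt (Nikishin.Psi m σ n Q k) (x : ℂ) = 1) ∧
      -- there are no other zeros in `ℂ ∖ Δ_k`
      (∀ z : ℂ, (∀ y ∈ Nikishin.Delta σ k, z ≠ (y : ℂ)) → Nikishin.Psi m σ n Q k z = 0 →
        ∃ x ∈ interior (Nikishin.Delta σ (k + 1)), z = (x : ℂ)) ∧
      -- at most one zero on the closure of each component of `Δ_{k+1} ∖ supp σ^k_{k+1}`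
      (∀ x ∈ Nikishin.Delta σ (k + 1) \ Nikishin.supp (Nikishin.firstMeasure m σ n k),
        {y : ℝ | y ∈ closure (connectedComponentIn
            (Nikishin.Delta σ (k + 1) \ Nikishin.supp (Nikishin.firstMeasure m σ n k)) x) ∧
          Nikishin.Psi m σ n Q k (y : ℂ) = 0}.Subsingleton)) ∧
    -- interlacing
    (∀ (τ : Equiv.Perm (Set.Icc 1 m)) (l : ℕ), 1 ≤ l → l ≤ m →
      Nikishin.InStarClass m τ n → Nikishin.InStarClass m τ (Nikishin.bump n l) →
      ∀ Q' : Polynomial ℂ, Nikishin.IsMultipleOrthogonal m σ (Nikishin.bump n l) Q' →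
      ∀ k < m,
        Nikishin.SeparatesZeros (Nikishin.Delta σ (k + 1))
          (Nikishin.Psi m σ (Nikishin.bump n l) Q' k) (Nikishin.Psi m σ n Q k) ∧
        Nikishin.SeparatesZeros (Nikishin.Delta σ (k + 1))
          (Nikishin.Psi m σ n Q k) (Nikishin.Psi m σ (Nikishin.bump n l) Q' k)) := by
  refine ⟨fun k hk => ?_, fun τ l hl1 hl2 hτ hτ' Q' hQ' k hk => ?_⟩
  · have hm : 0 < m := by omega
    obtain ⟨P, rfl, hP0, hdeg, ho⟩ := hQ.exists_real hσ hm hn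
    have hc := hσ.chain n
    rw [Nikishin.psi_eq_secondType]
    have hsum := Nikishin.sum_index_rIndex (Nat.zero_le m) n
    obtain ⟨T, hTc, hT, hall⟩ := hc.zeros hP0 ho (by rw [hsum, hdeg]) hk
    rw [Nikishin.sum_index_rIndex hk.le] at hTc
    have hmem : ∀ x ∈ Nikishin.Delta σ (k + 1),
        Nikishin.secondType (Nikishin.kernel m σ n) P k (x : ℂ) = 0 → x ∈ T := fun x hx h0 => by
      obtain ⟨y, hy, hxy⟩ := hall x (hc.mem_off hk hx) h0
      rwa [Complex.ofReal_injective hxy]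
    refine ⟨?_, fun x hx h0 => (hT x (hmem x (interior_subset hx) h0)).2, fun z hz h0 => ?_, ?_⟩
    · rw [← hTc, ← Set.encard_coe_eq_coe_finsetCard]
      congr 1
      ext x
      exact ⟨fun hx => hmem x (interior_subset hx.1) hx.2, fun hx => ⟨(hT x hx).1,
        (analyticOrderAt_ne_zero.1 (by rw [(hT x hx).2]; exact one_ne_zero)).2⟩⟩
    · obtain ⟨x, hx, rfl⟩ := hall z hz h0
      exact ⟨x, (hT x hx).1, rfl⟩
    · intro x _
      have hsub : connectedComponentIn (Nikishin.Delta σ (k + 1) \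
          Nikishin.supp (Nikishin.firstMeasure m σ n k)) x ⊆ _ := connectedComponentIn_subset _ _
      have hcl : closure (connectedComponentIn (Nikishin.Delta σ (k + 1) \
          Nikishin.supp (Nikishin.firstMeasure m σ n k)) x) ⊆ Nikishin.Delta σ (k + 1) :=
        closure_minimal (hsub.trans Set.sdiff_subset) (hc.compact k hk).isClosed
      have key : ∀ a b : ℝ, a ∈ closure (connectedComponentIn (Nikishin.Delta σ (k + 1) \
          Nikishin.supp (Nikishin.firstMeasure m σ n k)) x) →
          b ∈ closure (connectedComponentIn (Nikishin.Delta σ (k + 1) \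
          Nikishin.supp (Nikishin.firstMeasure m σ n k)) x) →
          Nikishin.secondType (Nikishin.kernel m σ n) P k a = 0 →
          Nikishin.secondType (Nikishin.kernel m σ n) P k b = 0 → ¬ a < b := by
        intro a b ha hb h0a h0b hab
        refine hc.false_of_gap hP0 ho (by rw [hsum, hdeg]) hk (hcl ha) (hcl hb) hab h0a h0b ?_
        rw [(hσ.tame_kernel hk).2]
        exact Set.disjoint_left.2 fun c hcab => (hsub (Nikishin.Ioo_subset_of_mem_closure
          isPreconnected_connectedComponentIn ha hb hcab)).2
      exact fun a ha b hb => le_antisymm (not_lt.1 (key b a hb.1 ha.1 hb.2 ha.2))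
        (not_lt.1 (key a b ha.1 hb.1 ha.2 hb.2))
  · have hm : 0 < m := by omega
    obtain ⟨P, rfl, hP0, hdeg, ho⟩ := hQ.exists_real hσ hm hn
    obtain ⟨R, rfl, hR0, hRdeg, hRo⟩ := hQ'.exists_real hσ hm hτ'.1
    have hc := hσ.chain n
    have halike := hτ.2.orderedAlike hτ'.2
    have hsum := Nikishin.sum_index_rIndex (Nat.zero_le m) n
    have hle : ∀ j, n j ≤ Nikishin.bump n l j := fun j => by
      rw [Nikishin.bump, Function.update_apply]
      split_ifs with h
      · rw [h]; omega
      · rfl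
    have hsize : Nikishin.indexSize m (Nikishin.bump n l) 0 = Nikishin.indexSize m n 0 + 1 := by
      have hl : l ∈ Finset.Icc (0 + 1) m := Finset.mem_Icc.2 ⟨hl1, hl2⟩
      simp only [Nikishin.indexSize, Nikishin.index, Nikishin.bump]
      rw [Finset.sum_update_of_mem hl, ← Finset.add_sum_erase _ _ hl, Finset.sdiff_singleton_eq_erase]
      ring
    have hker : ∀ i < m, Nikishin.kernel m σ (Nikishin.bump n l) i = Nikishin.kernel m σ n i :=
      fun i hi => (halike.kernel_eq hi).symm
    -- The kernels agree and the components of n_l dominate those of n, so `R` satisfies the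
    -- relations for n; its degree exceeds their number by one.
    have hRo' : Nikishin.OrthChain m (Nikishin.kernel m σ n)
        (fun k => Nikishin.index m n k (Nikishin.rIndex m n k)) R := fun i hi => by
      have h1 := hRo i hi
      rw [hker i hi, Nikishin.secondType_congr R fun j hj => hker j (by omega)] at h1
      refine h1.mono ?_
      simp only [← halike.rIndex_eq hi]
      exact halike.index_le hle hi.le _
    rw [Nikishin.psi_eq_secondType, Nikishin.psi_eq_secondType,
      Nikishin.secondType_congr R fun j hj => hker j (by omega)]
    exact (hc.separatesZeros hP0 ho hRo' (by rw [hsum, hdeg]) (by omega) hk).symm
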